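/- **Conventions.** Let $k$ be a field of characteristic $0$ and $X/k$ a regular variety: an integral scheme of finite type over $k$, all of whose local rings are regular. Let $M$ be a locally free $\mathcal O_X$-module of finite rank. For a $k$-algebra $A$ with $I=\ker(A\otimes_kA\to A)$ and an $A$-module $N$ put $\mathcal P^n(N)=\big((A\otimes_kA)/I^{n+1}\big)\otimes_AN=(A\otimes_kN)/I^{n+1}(A\otimes_kN)$, an $A$-module through the left factor; these modules glue to the sheaf $\mathcal P^n_{X/k}(M)$. Let $\mathcal D^n_X(M)=\mathcal Hom_{\mathcal O_X}(\mathcal P^n_{X/k}(M),M)$ be the sheaf of differential operators of order $\le n$ on $M$ (acting on $M$ through $m\mapsto 1\otimes m$), and $\mathcal D_X(M)=\bigcup_n\mathcal D^n_X(M)$. For a finite-dimensional $k$-subspace $V\subset\Gamma(X,M)$ and $x\in X$ with residue field $k_x$ consider the fibre of the Taylor map $$d^n_V(x):k_x\otimes_kV\to k_x\otimes_{\mathcal O_x}\mathcal P^n_{X/k}(M)_x,\qquad c\otimes v\mapsto c\otimes(1\otimes v).$$ $V$ is *separated* if for every $x\in X$ there is $N$ such that $d^n_V(x)$ is injective for all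 $n\ge N$. Let $n_{inj}(x)$ be the smallest $n \geq 0$ for which $d^n_V(x)$ is injective, and $n_{inj}=\sup_{x\in X}n_{inj}(x)$. Put $\mathcal D^{n,V}=\{P\in\mathcal D^n_X(M): P\cdot V\subset V\}$, $\operatorname{Ann}^n=\{P\in\mathcal D^n_X(M):P\cdot V=0\}$, and likewise $\mathcal D^V$, $\operatorname{Ann}$ for operators of all orders; $W^n$ and $W$ send an operator preserving $V$ to its restriction to $V$. **Theorem.** (1) Let $X/k$ be a regular affine variety, $M$ a locally free $\mathcal O_X$-module of finite rank and $V\subset\Gamma(X,M)$ a separated finite-dimensional $k$-subspace. Then $n_{inj}<\infty$; for every $n\ge n_{inj}$ the sequence $$0\to\Gamma(X,\operatorname{Ann}^n)\to\Gamma(X,\mathcal D^{n,V})\xrightarrow{W^n}\operatorname{End}_k(V)\to0$$ is exact; and the sequence $$0\to\Gamma(X,\operatorname{Ann})\to\Gamma(X,\mathcal D^{V})\xrightarrow{W}\operatorname{End}_k(V)\to0$$ is exact. Hence $\Gamma(X,\mathcal D^V)$ acts irreducibly on $V$: a subspace of $V$ which is stable under all operators in $\Gamma(X,\mathcal D^V)$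 is $0$ or $V$. (2) Let $X/\mathbb R$ be a regular variety (not necessarily affine or separated), $M$ a locally free $\mathcal O_X$-module of finite rank, and $X(\mathbb R)$ its set of real points (the points with residue field $\mathbb R$) with the topology induced from $X$ and with the sheaf $\mathcal O_{X(\mathbb R)}$ of the real-valued functions that are locally given by the values of sections of $\mathcal O_X$. Assume that $(X(\mathbb R),\mathcal O_{X(\mathbb R)})$ is affine, that is, isomorphic to an algebraic subset of some $\mathbb R^N$ with its Zariski topology and its sheaf of regular functions (the functions that are locally quotients of polynomials). Let $M_{\mathbb R}$ and $\mathcal D_{X(\mathbb R)}(M_{\mathbb R})$ be the inverse images on $X(\mathbb R)$ of the sheaves $M$ and $\mathcal D_X(M)$. If $X(\mathbb R)\ne\emptyset$, then $\Gamma(X,M)\to\Gamma(X(\mathbb R),M_{\mathbb R})$ is injective. For every finite-dimensional real subspace $V\subset\Gamma(X(\mathbb R),M_{\mathbb R})$, in particular (if $X(\mathbb R)\neq\emptyset$) for every finite-dimensional $V\subset\Gamma(X,M)$, the sequence $$0\to\Gamma(X(\mathbb R),\operatorname{Ann}(M_{\mathbb R}))\to\Gamma(X(\mathbb R),\mathcal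 D^V_{X(\mathbb R)}(M_{\mathbb R}))\xrightarrow{W}\operatorname{End}_{\mathbb R}(V)\to0$$ is exact, where $\mathcal D^V_{X(\mathbb R)}(M_{\mathbb R})$ and $\operatorname{Ann}(M_{\mathbb R})$ denote the operators that preserve, respectively annihilate, $V$. -/

import Mathlib

open CategoryTheory TopologicalSpace AlgebraicGeometry Opposite
open scoped TensorProduct

universe u

noncomputable section

namespace TaylorDiff

/-! ### Principal parts and differential operators of a module over a `k`-algebra -/

section Algebra

variable (k A M : Type*) [CommRing k] [CommRing A] [Algebra k A] [AddCommGroup M] [Module k M]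
  [Module A M] [IsScalarTower k A M]

/-- The action of the ring `A ⊗[k] A` on `A ⊗[k] M`: `(a ⊗ b) (c ⊗ m) = a c ⊗ b m`. -/
def ppAction : A ⊗[k] A →ₐ[k] Module.End k (A ⊗[k] M) :=
  (Module.endTensorEndAlgHom (R := k) (S := k) (A := k) (M := A) (N := M)).comp
    (Algebra.TensorProduct.map (Algebra.lmul k A) (Algebra.lsmul k k M))

theorem ppAction_tmul (a b c : A) (m : M) :
    ppAction k A M (a ⊗ₜ b) (c ⊗ₜ m) = (a * c) ⊗ₜ (b • m) := rfl

/-- The submodule `I ^ (n + 1) (A ⊗[k] M)`, where `I` is the kernel of the multiplication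
`A ⊗[k] A → A`. -/
def ppKernel (n : ℕ) : Submodule A (A ⊗[k] M) :=
  Submodule.span A {w | ∃ s ∈ KaehlerDifferential.ideal k A ^ (n + 1), ∃ z, w = ppAction k A M s z}

/-- The module of principal parts of order `n` of `M`,
`(A ⊗[k] A) / I ^ (n + 1) ⊗[A] M = (A ⊗[k] M) / I ^ (n + 1) (A ⊗[k] M)` (the tensor product over
`A` uses the right `A`-module structure of `A ⊗[k] A`), as an `A`-module through the left factor. -/
abbrev PrincipalParts (n : ℕ) : Type _ := (A ⊗[k] M) ⧸ ppKernel k A M n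

/-- The universal differential operator `M → P^n(M)`, `m ↦ 1 ⊗ m`, of order `n`. -/
def taylorMap (n : ℕ) : M →ₗ[k] PrincipalParts k A M n :=
  ((ppKernel k A M n).mkQ.restrictScalars k) ∘ₗ (TensorProduct.mk k A M 1)

theorem ppKernel_anti {m n : ℕ} (h : m ≤ n) : ppKernel k A M n ≤ ppKernel k A M m := by
  refine Submodule.span_mono ?_
  rintro w ⟨s, hs, z, rfl⟩
  exact ⟨s, Ideal.pow_le_pow_right (by omega) hs, z, rfl⟩

/-- The `k`-linear differential operators `M → M` of order at most `n`: the maps `m ↦ h (1 ⊗ m)`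
for an `A`-linear map `h : P^n(M) → M`. -/
def diffOp (n : ℕ) : Submodule k (Module.End k M) where
  carrier := {P | ∃ h : PrincipalParts k A M n →ₗ[A] M, ∀ m, P m = h (taylorMap k A M n m)}
  zero_mem' := ⟨0, fun _ => rfl⟩
  add_mem' := by
    rintro P Q ⟨g, hg⟩ ⟨h, hh⟩
    exact ⟨g + h, fun m => by simp [hg, hh]⟩
  smul_mem' := by
    rintro c P ⟨g, hg⟩
    exact ⟨algebraMap k A c • g, fun m => by simp [hg]⟩

theorem diffOp_mono {m n : ℕ} (h : m ≤ n) : diffOp k A M m ≤ diffOp k A M n := by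
  rintro P ⟨g, hg⟩
  exact ⟨g ∘ₗ Submodule.factor (ppKernel_anti k A M h), fun x => by rw [hg]; rfl⟩

variable {M} in
/-- For a local ring `A` with residue field `κ` and a `k`-linear map `ι : V → M`, the map
`κ ⊗[k] V → κ ⊗[A] P^n(M)`, `c ⊗ v ↦ c ⊗ (1 ⊗ ι v)`. -/
def fibreTaylorMap [IsLocalRing A] {V : Type*} [AddCommGroup V] [Module k V] (ι : V →ₗ[k] M)
    (n : ℕ) :
    IsLocalRing.ResidueField A ⊗[k] V →ₗ[IsLocalRing.ResidueField A]
      IsLocalRing.ResidueField A ⊗[A] PrincipalParts k A M n :=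
  LinearMap.liftBaseChange (IsLocalRing.ResidueField A)
    (((TensorProduct.mk A (IsLocalRing.ResidueField A)
      (PrincipalParts k A M n) 1).restrictScalars k) ∘ₗ taylorMap k A M n ∘ₗ ι)

end Algebra

/-! ### Modules on schemes over a field -/

section Scheme

variable (k : Type u) [Field k] (X : Scheme.{u}) [X.Over (Spec (.of k))]

/-- The structure map `k → Γ(X, U)`. -/
def baseHom (U : X.Opens) : k →+* Γ(X, U) :=
  ((Scheme.ΓSpecIso (.of k)).inv ≫ (X ↘ Spec (.of k)).appTop ≫ X.presheaf.map U.leTop.op).hom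

variable {X}

instance algebraSections (U : X.Opens) : Algebra k Γ(X, U) := (baseHom k X U).toAlgebra

instance algebraStalk (x : X) : Algebra k (X.presheaf.stalk x) :=
  ((X.presheaf.germ ⊤ x trivial).hom.comp (baseHom k X ⊤)).toAlgebra

variable (M : X.Modules)

instance moduleSections (U : X.Opens) : Module k Γ(M, U) :=
  Module.compHom _ (algebraMap k Γ(X, U))

instance isScalarTowerSections (U : X.Opens) : IsScalarTower k Γ(X, U) Γ(M, U) :=
  IsScalarTower.of_compHom _ _ _

/-- The stalk of an `𝒪_X`-module as a module over the local ring of the point. -/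
instance moduleStalk (x : X) : Module (X.presheaf.stalk x) (M.presheaf.stalk x) :=
  PresheafOfModules.instModuleCarrierStalkCommRingCatCarrierAbPresheafOpensCarrier
    (X := X.toTopCat) (R := X.presheaf) M.val x

instance moduleStalkBase (x : X) : Module k (M.presheaf.stalk x) :=
  Module.compHom _ (algebraMap k (X.presheaf.stalk x))

instance isScalarTowerStalk (x : X) :
    IsScalarTower k (X.presheaf.stalk x) (M.presheaf.stalk x) :=
  IsScalarTower.of_compHom _ _ _

theorem baseHom_res {U W : X.Opens} (h : W ≤ U) (c : k) :
    X.presheaf.map (homOfLE h).op (baseHom k X U c) = baseHom k X W c := by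
  have : baseHom k X W = (X.presheaf.map (homOfLE h).op).hom.comp (baseHom k X U) := by
    unfold baseHom
    rw [← CommRingCat.hom_comp, Category.assoc, Category.assoc, ← Functor.map_comp]
    rfl
  rw [this]
  rfl

theorem baseHom_germ {U : X.Opens} {x : X} (hx : x ∈ U) (c : k) :
    X.presheaf.germ U x hx (baseHom k X U c) = algebraMap k (X.presheaf.stalk x) c := by
  rw [← baseHom_res k (le_top : U ≤ ⊤) c]
  exact TopCat.Presheaf.germ_res_apply X.presheaf (homOfLE le_top) x hx _

/-- Restriction of sections, as a `k`-linear map. -/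
def res {U W : X.Opens} (h : W ≤ U) : Γ(M, U) →ₗ[k] Γ(M, W) where
  toFun s := M.presheaf.map (homOfLE h).op s
  map_add' s t := map_add _ s t
  map_smul' c s := by
    refine (M.map_smul (homOfLE h) (baseHom k X U c) s).trans ?_
    rw [baseHom_res]
    rfl

/-- The germ of a section at a point, as a `k`-linear map. -/
def germ {U : X.Opens} {x : X} (hx : x ∈ U) : Γ(M, U) →ₗ[k] M.presheaf.stalk x where
  toFun s := M.presheaf.germ U x hx s
  map_add' s t := map_add _ s t
  map_smul' c s := by
    refine (PresheafOfModules.germ_smul (R := X.presheaf) M.val x U hx (baseHom k X U c) s).trans ?_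
    rw [baseHom_germ]
    rfl

theorem germ_res {U W : X.Opens} (h : W ≤ U) {x : X} (hx : x ∈ W) (s : Γ(M, U)) :
    germ k M hx (res k M h s) = germ k M (h hx) s :=
  TopCat.Presheaf.germ_res_apply M.presheaf (homOfLE h) x hx s

variable {M} in
/-- `M` is locally free of finite rank: every point has an open neighbourhood `U` with finitely
many sections over `U` whose restrictions to each open `W ⊆ U` form a basis of `Γ(M, W)` over
`Γ(X, W)`, that is, which define an isomorphism `𝒪_U ^ r ≅ M|_U`. -/
def _root_.AlgebraicGeometry.Scheme.Modules.IsLocallyFreeOfFiniteRank (M : X.Modules) : Prop :=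
  ∀ x : X, ∃ U : X.Opens, x ∈ U ∧ ∃ (r : ℕ) (e : Fin r → Γ(M, U)), ∀ (W : X.Opens) (h : W ≤ U),
    ∀ s : Γ(M, W), ∃! c : Fin r → Γ(X, W), s = ∑ i, c i • M.presheaf.map (homOfLE h).op (e i)

variable (X) in
/-- All local rings of `X` are regular. -/
def IsRegularScheme : Prop := ∀ x : X, IsRegularLocalRing (X.presheaf.stalk x)

/-! ### The fibres of the Taylor map -/

variable (V : Submodule k Γ(M, ⊤))

/-- The map of fibres `κ(x) ⊗[k] V → κ(x) ⊗ P^n(M)_x` of the Taylor map at the point `x`. -/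
def taylorFibre (x : X) (n : ℕ) :
    IsLocalRing.ResidueField (X.presheaf.stalk x) ⊗[k] V
      →ₗ[IsLocalRing.ResidueField (X.presheaf.stalk x)]
    IsLocalRing.ResidueField (X.presheaf.stalk x) ⊗[X.presheaf.stalk x]
      PrincipalParts k (X.presheaf.stalk x) (M.presheaf.stalk x) n :=
  fibreTaylorMap k (X.presheaf.stalk x) (germ k M (U := ⊤) (x := x) trivial ∘ₗ V.subtype) n

/-- `V` is separated: at every point the Taylor maps of large order are injective on the fibre. -/
def IsSeparatedSubspace : Prop :=
  ∀ x : X, ∃ N : ℕ, ∀ n, N ≤ n → Function.Injective (taylorFibre k M V x n)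

/-- The injectivity order of `V` at `x`: the smallest `n` for which the map of fibres of the Taylor
map of order `n` is injective (`⊤` if there is none). -/
def nInjAt (x : X) : ℕ∞ :=
  sInf {N : ℕ∞ | ∃ n : ℕ, N = n ∧ Function.Injective (taylorFibre k M V x n)}

/-- The injectivity order of `V`, the supremum of the injectivity orders at the points of `X`. -/
def nInj : ℕ∞ := ⨆ x : X, nInjAt k M V x

/-! ### Differential operators on a scheme -/

/-- The `k`-linear endomorphisms of the sheaf `M|_U`: families of `k`-linear maps
`Γ(M, W) → Γ(M, W)`, for `W ⊆ U` open, which commute with restriction. -/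
def sheafEnd (U : X.Opens) :
    Submodule k (∀ W : {W : X.Opens // W ≤ U}, Module.End k Γ(M, W.1)) where
  carrier := {P | ∀ (W W' : {W : X.Opens // W ≤ U}) (h : W'.1 ≤ W.1) (s : Γ(M, W.1)),
    P W' (res k M h s) = res k M h (P W s)}
  zero_mem' := by
    intro W W' h s
    simp
  add_mem' := by
    intro P Q hP hQ W W' h s
    simp [hP W W' h s, hQ W W' h s]
  smul_mem' := by
    intro c P hP W W' h s
    simp [hP W W' h s]

/-- `Γ(U, 𝒟^n(M))`: the differential operators of order at most `n` on `M|_U`, namely the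
endomorphisms of the sheaf of `k`-modules `M|_U` which on each affine open `W ⊆ U` are differential
operators of order at most `n` of the `Γ(X, W)`-module `Γ(M, W)`, that is, factor through
`P^n(Γ(M, W))`. Since `P^n(M)` is quasi-coherent with sections `P^n(Γ(M, W))` over `W`, generated
by the elements `1 ⊗ m`, these are the `𝒪_U`-linear maps `P^n(M)|_U → M|_U`. -/
def sheafDiffOp (U : X.Opens) (n : ℕ) : Submodule k (sheafEnd k M U) where
  carrier := {P | ∀ (W : {W : X.Opens // W ≤ U}), IsAffineOpen W.1 →
    P.1 W ∈ diffOp k Γ(X, W.1) Γ(M, W.1) n}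
  zero_mem' := fun W _ => zero_mem (diffOp k Γ(X, W.1) Γ(M, W.1) n)
  add_mem' := fun hP hQ W hW => add_mem (hP W hW) (hQ W hW)
  smul_mem' := fun c _ hP W hW => Submodule.smul_mem _ c (hP W hW)

theorem sheafDiffOp_mono (U : X.Opens) {m n : ℕ} (h : m ≤ n) :
    sheafDiffOp k M U m ≤ sheafDiffOp k M U n :=
  fun _ hP W hW => diffOp_mono k Γ(X, W.1) Γ(M, W.1) h (hP W hW)

/-- The restriction of an endomorphism of `M|_U` to a smaller open set. -/
def restrictEnd {U U' : X.Opens} (h : U' ≤ U) (P : sheafEnd k M U) : sheafEnd k M U' :=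
  ⟨fun W => P.1 ⟨W.1, W.2.trans h⟩, fun W W' hW s => P.2 ⟨W.1, W.2.trans h⟩ ⟨W'.1, W'.2.trans h⟩ hW s⟩

theorem restrictEnd_mem {U U' : X.Opens} (h : U' ≤ U) {n : ℕ} {P : sheafEnd k M U}
    (hP : P ∈ sheafDiffOp k M U n) : restrictEnd k M h P ∈ sheafDiffOp k M U' n :=
  fun W hW => hP ⟨W.1, W.2.trans h⟩ hW

/-- The action of a globally defined endomorphism of the sheaf `M` on `Γ(X, M)`. -/
def globalAction : sheafEnd k M ⊤ →ₗ[k] Module.End k Γ(M, ⊤) where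
  toFun P := P.1 ⟨⊤, le_top⟩
  map_add' _ _ := rfl
  map_smul' _ _ := rfl

/-- `Γ(X, 𝒟(M))`, the differential operators of arbitrary (finite) order, for a quasi-compact
scheme `X`. -/
def globalDiffOp : Submodule k (sheafEnd k M ⊤) where
  carrier := {P | ∃ n, P ∈ sheafDiffOp k M ⊤ n}
  zero_mem' := ⟨0, zero_mem _⟩
  add_mem' := by
    rintro P Q ⟨m, hP⟩ ⟨n, hQ⟩
    exact ⟨max m n, add_mem (sheafDiffOp_mono k M ⊤ (le_max_left m n) hP)
      (sheafDiffOp_mono k M ⊤ (le_max_right m n) hQ)⟩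
  smul_mem' := by
    rintro c P ⟨n, hP⟩
    exact ⟨n, Submodule.smul_mem _ c hP⟩

end Scheme

/-! ### Operators which preserve, or annihilate, a subspace -/

section Preserve

variable {k D N : Type*} [CommRing k] [AddCommGroup D] [Module k D] [AddCommGroup N] [Module k N]
  (act : D →ₗ[k] Module.End k N) (S : Submodule k D) (V : Submodule k N)

/-- The operators in `S` which map `V` into `V`. -/
def preserving : Submodule k D where
  carrier := {P | P ∈ S ∧ ∀ v ∈ V, act P v ∈ V}
  zero_mem' := ⟨zero_mem S, by simp⟩
  add_mem' := by
    rintro P Q ⟨hP, hP'⟩ ⟨hQ, hQ'⟩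
    exact ⟨add_mem hP hQ, fun v hv => by simpa using add_mem (hP' v hv) (hQ' v hv)⟩
  smul_mem' := by
    rintro c P ⟨hP, hP'⟩
    exact ⟨S.smul_mem c hP, fun v hv => by simpa using V.smul_mem c (hP' v hv)⟩

/-- The operators in `S` which vanish on `V`. -/
def annihilating : Submodule k D where
  carrier := {P | P ∈ S ∧ ∀ v ∈ V, act P v = 0}
  zero_mem' := ⟨zero_mem S, by simp⟩
  add_mem' := by
    rintro P Q ⟨hP, hP'⟩ ⟨hQ, hQ'⟩
    exact ⟨add_mem hP hQ, fun v hv => by simp [hP' v hv, hQ' v hv]⟩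
  smul_mem' := by
    rintro c P ⟨hP, hP'⟩
    exact ⟨S.smul_mem c hP, fun v hv => by simp [hP' v hv]⟩

theorem annihilating_le_preserving : annihilating act S V ≤ preserving act S V :=
  fun _ hP => ⟨hP.1, fun v hv => by rw [hP.2 v hv]; exact zero_mem V⟩

/-- The evaluation map `W`, which sends an operator preserving `V` to its restriction to `V`. -/
def evalOn : preserving act S V →ₗ[k] Module.End k V where
  toFun P := (act P.1).restrict P.2.2
  map_add' P Q := by
    ext v
    simp
  map_smul' c P := by
    ext v
    simp

/-- The sequence `0 → annihilating → preserving → End_k(V) → 0` is exact. -/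
def IsExactSequence : Prop :=
  Function.Injective (Submodule.inclusion (annihilating_le_preserving act S V)) ∧
  Function.Exact (Submodule.inclusion (annihilating_le_preserving act S V)) (evalOn act S V) ∧
  Function.Surjective (evalOn act S V)

end Preserve

/-! ### Rational points, and the sheaves on them -/

section RationalPoints

variable (k : Type u) [Field k] (X : Scheme.{u}) [X.Over (Spec (.of k))]

/-- The set `X(k)` of `k`-rational points of `X`, with the topology induced from `X`. -/
abbrev RatPt : Type u :=
  {x : X // Function.Bijective (algebraMap k (IsLocalRing.ResidueField (X.presheaf.stalk x)))}

variable {X} (M : X.Modules)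

/-- `Γ(X(k), M_k)`, where `M_k` is the inverse image of the sheaf `M` on `X(k)`: the families of
germs of `M` at the rational points which are locally given by sections of `M`. -/
def ratSections : Submodule k (∀ x : RatPt k X, M.presheaf.stalk x.1) where
  carrier := {f | ∀ x : RatPt k X, ∃ (U : X.Opens) (_ : x.1 ∈ U) (s : Γ(M, U)),
    ∀ (y : RatPt k X) (hy : y.1 ∈ U), f y = germ k M hy s}
  zero_mem' := fun x => ⟨⊤, trivial, 0, fun y hy => by simp⟩
  add_mem' := by
    intro f g hf hg x
    obtain ⟨U, hU, s, hs⟩ := hf x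
    obtain ⟨U', hU', t, ht⟩ := hg x
    refine ⟨U ⊓ U', ⟨hU, hU'⟩, res k M inf_le_left s + res k M inf_le_right t, fun y hy => ?_⟩
    rw [map_add, germ_res, germ_res, Pi.add_apply, hs y hy.1, ht y hy.2]
  smul_mem' := by
    intro c f hf x
    obtain ⟨U, hU, s, hs⟩ := hf x
    exact ⟨U, hU, c • s, fun y hy => by rw [map_smul, Pi.smul_apply, hs y hy]⟩

/-- The restriction map `Γ(X, M) → Γ(X(k), M_k)`. -/
def toRatSections : Γ(M, ⊤) →ₗ[k] ratSections k M where
  toFun s := ⟨fun x => germ k M (U := ⊤) (x := x.1) trivial s,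
    fun x => ⟨⊤, trivial, s, fun y hy => rfl⟩⟩
  map_add' s t := by
    ext x
    simp
  map_smul' c s := by
    ext x
    simp

/-- `Γ(X(k), 𝒟(M_k))`, where `𝒟(M_k)` is the inverse image of the sheaf `𝒟_X(M)` on `X(k)`: the
families of endomorphisms of the stalks of `M` at the rational points which are locally given by
differential operators on `M`. -/
def ratDiffOp : Submodule k (∀ x : RatPt k X, Module.End k (M.presheaf.stalk x.1)) where
  carrier := {P | ∀ x : RatPt k X, ∃ (U : X.Opens) (_ : x.1 ∈ U) (n : ℕ) (Q : sheafEnd k M U)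
    (_ : Q ∈ sheafDiffOp k M U n), ∀ (y : RatPt k X) (W : {W : X.Opens // W ≤ U}) (hy : y.1 ∈ W.1)
      (s : Γ(M, W.1)), P y (germ k M hy s) = germ k M hy (Q.1 W s)}
  zero_mem' := fun x => ⟨⊤, trivial, 0, 0, zero_mem _, fun y W hy s => by simp⟩
  add_mem' := by
    intro P P' hP hP' x
    obtain ⟨U, hU, n, Q, hQ, h⟩ := hP x
    obtain ⟨U', hU', n', Q', hQ', h'⟩ := hP' x
    refine ⟨U ⊓ U', ⟨hU, hU'⟩, max n n', restrictEnd k M inf_le_left Q + restrictEnd k M inf_le_right Q',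
      add_mem (restrictEnd_mem k M _ (sheafDiffOp_mono k M U (le_max_left n n') hQ))
        (restrictEnd_mem k M _ (sheafDiffOp_mono k M U' (le_max_right n n') hQ')),
      fun y W hy s => ?_⟩
    have e := h y ⟨W.1, W.2.trans inf_le_left⟩ hy s
    have e' := h' y ⟨W.1, W.2.trans inf_le_right⟩ hy s
    rw [Pi.add_apply, LinearMap.add_apply, e, e', ← map_add]
    rfl
  smul_mem' := by
    intro c P hP x
    obtain ⟨U, hU, n, Q, hQ, h⟩ := hP x
    refine ⟨U, hU, n, c • Q, Submodule.smul_mem _ c hQ, fun y W hy s => ?_⟩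
    rw [Pi.smul_apply, LinearMap.smul_apply, h y W hy s, ← map_smul]
    rfl

/-- The action of `Γ(X(k), 𝒟(M_k))` on `Γ(X(k), M_k)`. -/
def ratAction : ratDiffOp k M →ₗ[k] Module.End k (ratSections k M) where
  toFun P :=
    { toFun := fun f => ⟨fun x => P.1 x (f.1 x), by
        intro x
        obtain ⟨U, hU, n, Q, hQ, h⟩ := P.2 x
        obtain ⟨U', hU', s, hs⟩ := f.2 x
        refine ⟨U ⊓ U', ⟨hU, hU'⟩, Q.1 ⟨U ⊓ U', inf_le_left⟩ (res k M inf_le_right s),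
          fun y hy => ?_⟩
        have e := h y ⟨U ⊓ U', inf_le_left⟩ hy (res k M inf_le_right s)
        rw [germ_res, ← hs y hy.2] at e
        exact e⟩
      map_add' := fun f g => by
        ext x
        simp
      map_smul' := fun c f => by
        ext x
        simp }
  map_add' P Q := rfl
  map_smul' c P := rfl

/-! ### Affine real algebraic varieties -/

variable (X) in
/-- A function on `O ⊆ X(k)` is regular if it is locally given by the values of sections of
`𝒪_X`. -/
def IsRegularOn (O : Set (RatPt k X)) (φ : RatPt k X → k) : Prop :=
  ∀ x ∈ O, ∃ (U : X.Opens) (_ : x.1 ∈ U) (s : Γ(X, U)), ∀ y ∈ O, ∀ hy : y.1 ∈ U,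
    algebraMap k (IsLocalRing.ResidueField (X.presheaf.stalk y.1)) (φ y) =
      IsLocalRing.residue _ (X.presheaf.germ U y.1 hy s)

/-- A function on a subset `O` of an algebraic set `Z` in `k ^ N` is regular if it is locally a
quotient of two polynomials. -/
def IsRegularOnAlgSet {N : ℕ} {Z : Set (Fin N → k)} (O : Set Z) (ψ : Z → k) : Prop :=
  ∀ z ∈ O, ∃ p q : MvPolynomial (Fin N) k, MvPolynomial.eval z.1 q ≠ 0 ∧
    ∀ w ∈ O, MvPolynomial.eval w.1 q ≠ 0 →
      ψ w = MvPolynomial.eval w.1 p / MvPolynomial.eval w.1 q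

variable (X) in
/-- The space `X(k)` with its sheaf of regular functions is affine: it is isomorphic to an algebraic
subset `Z` of some `k ^ N` with its Zariski topology and its sheaf of regular functions. -/
def IsAffineRatPt : Prop :=
  ∃ (N : ℕ) (I : Set (MvPolynomial (Fin N) k))
    (e : RatPt k X ≃ {z : Fin N → k | ∀ p ∈ I, MvPolynomial.eval z p = 0}),
    (∀ O : Set (RatPt k X), IsOpen O ↔
      ∃ J : Set (MvPolynomial (Fin N) k), ∀ x, x ∈ O ↔ ∃ p ∈ J, MvPolynomial.eval (e x).1 p ≠ 0) ∧
    ∀ O : Set (RatPt k X), IsOpen O → ∀ ψ : {z : Fin N → k | ∀ p ∈ I, MvPolynomial.eval z p = 0} → k,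
      IsRegularOnAlgSet k (e '' O) ψ ↔ IsRegularOn k X O (ψ ∘ e)

end RationalPoints

end TaylorDiff

end

open TaylorDiff

/-! Everything rests on dual operators. If b₁, …, b_m is a basis of V and q₁, …, q_m are
differential operators from M to functions with q_i(b_j) = δ_ij, then an endomorphism φ of V is
induced by P = ∑ q_i(·) φ(b_i). So W is surjective; the rest of exactness is formal, and
irreducibility follows because rank one endomorphisms move any nonzero vector of V to any other. All
operators live on the generic stalk of M, with values in the function field; being defined at a
point means mapping the stalk there into the local ring (`IsIntegralAt`). Since sections are the
generic elements lying in all stalks, operators preserving all stalks are global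
(`exists_sheafDiffOp`).

Local existence. Injectivity of the Taylor map on the fibre at x yields functionals of order ≤ n
from M_x to the residue field which are dual to V (`exists_dual_functionals`). At a closed point,
regularity and characteristic 0 provide coordinates t_i with dual derivations ∂_i
(`exists_localCoordinates`). The Euler operator E ν = ∑ [ν, t_i] ∂_i multiplies the leading part of
an operator ν of order n by n, so n ν = E ν − (E ν − n ν) expresses ν through operators of lower
order; by induction the functionals lift to operators with values in the local ring (`exists_lift`).
The matrix of values of the lifts on V is the identity modulo the maximal ideal, hence invertible,
and its inverse makes the lifts exactly dual.

Affine case. A differential operator maps finitely generated modules into finitely generated ones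
(`IsDO.exists_fg`), so a function u not vanishing at x clears its denominators everywhere. The u for
which u δ_ij is realized by global operators form an ideal (`dualIdeal`) contained in no maximal
ideal, hence containing 1. These ideals increase with n, so under separatedness one of them contains
1; this in turn forces injectivity at every point, closed or not, whence the injectivity order is
finite.

Real case. Separatedness is automatic at real points: by Krull's intersection theorem a
finite-dimensional space of germs meets a high power of the maximal ideal trivially. Real points are
dense near a regular real point, because the ideal of functions vanishing at them is stable under
derivations (`derivation_vanishing`, by flowing along vector fields) and thus lies in all powers of
the maximal ideal. Hence sections over X(ℝ) embed in the generic stalk, and the affine coordinates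
of X(ℝ) are rational functions whose polynomials generate the local rings as fractions
(`exists_coordinates`). The polynomials p for which p δ_ij is realized by operators integral at the
real points form an ideal without zeros on X(ℝ). A sum of squares of generators vanishes nowhere on
X(ℝ), and dividing by it gives dual operators. -/

noncomputable section

namespace TaylorDiff

/-! ### Differential operators in the sense of iterated commutators -/

section Bracket

variable {k A M N L : Type*} [CommRing k] [CommRing A] [Algebra k A]
  [AddCommGroup M] [Module k M] [Module A M] [IsScalarTower k A M]
  [AddCommGroup N] [Module k N] [Module A N] [IsScalarTower k A N]
  [AddCommGroup L] [Module k L] [Module A L] [IsScalarTower k A L]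

/-- The commutator `m ↦ q (a m) - a q m` of a `k`-linear map with the multiplication by `a`. -/
def bracket (q : M →ₗ[k] N) (a : A) : M →ₗ[k] N :=
  q ∘ₗ Algebra.lsmul k k M a - Algebra.lsmul k k N a ∘ₗ q

@[simp]
theorem bracket_apply (q : M →ₗ[k] N) (a : A) (m : M) : bracket q a m = q (a • m) - a • q m := rfl

variable (A) in
/-- `IsDO A n q` says that `q` is a differential operator of order `< n` over `A`. -/
def IsDO : ℕ → (M →ₗ[k] N) → Prop
  | 0, q => q = 0
  | n + 1, q => ∀ a : A, IsDO n (bracket q a)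

theorem bracket_zero (a : A) : bracket (0 : M →ₗ[k] N) a = 0 := by
  ext; simp

theorem bracket_add (q q' : M →ₗ[k] N) (a : A) :
    bracket (q + q') a = bracket q a + bracket q' a := by
  ext; simp; abel

theorem bracket_sub (q q' : M →ₗ[k] N) (a : A) :
    bracket (q - q') a = bracket q a - bracket q' a := by
  ext m
  simp only [bracket_apply, LinearMap.sub_apply, smul_sub]
  abel

theorem bracket_lsmul_comp (b : A) (q : M →ₗ[k] N) (a : A) :
    bracket (Algebra.lsmul k k N b ∘ₗ q) a = Algebra.lsmul k k N b ∘ₗ bracket q a := by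
  ext m
  simp only [bracket_apply, LinearMap.comp_apply, Algebra.lsmul_coe, smul_sub, smul_comm b a]

theorem bracket_smul (c : k) (q : M →ₗ[k] N) (a : A) : bracket (c • q) a = c • bracket q a := by
  ext m
  simp [smul_sub, smul_comm c a]

theorem bracket_comp (p : N →ₗ[k] L) (q : M →ₗ[k] N) (a : A) :
    bracket (p ∘ₗ q) a = bracket p a ∘ₗ q + p ∘ₗ bracket q a := by
  ext; simp

/-- Up to the double commutator, which has lower order, a ↦ [q, a] is a derivation. This is what
brings Kähler differentials into the control of orders. -/
theorem bracket_mul (q : M →ₗ[k] N) (a b : A) :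
    bracket q (a * b) =
      Algebra.lsmul k k N a ∘ₗ bracket q b + Algebra.lsmul k k N b ∘ₗ bracket q a
        + bracket (bracket q a) b := by
  ext m
  simp only [bracket_apply, LinearMap.add_apply, LinearMap.comp_apply, Algebra.lsmul_coe, smul_sub,
    mul_smul, smul_comm b a]
  abel

theorem bracket_comm (q : M →ₗ[k] N) (a b : A) :
    bracket (bracket q a) b = bracket (bracket q b) a := by
  ext m
  simp only [bracket_apply, smul_sub, smul_comm b a]
  abel

theorem bracket_add_right (q : M →ₗ[k] N) (a b : A) :
    bracket q (a + b) = bracket q a + bracket q b := by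
  ext m
  simp only [bracket_apply, LinearMap.add_apply, add_smul, map_add]
  abel

namespace IsDO

theorem zero (n : ℕ) : IsDO A n (0 : M →ₗ[k] N) := by
  induction n with
  | zero => rfl
  | succ n ih => intro a; rwa [bracket_zero]

theorem succ {n : ℕ} {q : M →ₗ[k] N} (h : IsDO A n q) : IsDO A (n + 1) q := by
  induction n generalizing q with
  | zero => rw [show q = 0 from h]; exact zero _
  | succ n ih => exact fun a => ih (h a)

theorem mono {m n : ℕ} (hmn : m ≤ n) {q : M →ₗ[k] N} (h : IsDO A m q) : IsDO A n q := by
  induction hmn with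
  | refl => exact h
  | step _ ih => exact ih.succ

theorem add {n : ℕ} {q q' : M →ₗ[k] N} (h : IsDO A n q) (h' : IsDO A n q') :
    IsDO A n (q + q') := by
  induction n generalizing q q' with
  | zero => rw [show q = 0 from h, show q' = 0 from h', add_zero]; rfl
  | succ n ih => intro a; rw [bracket_add]; exact ih (h a) (h' a)

theorem lsmul_comp {n : ℕ} {q : M →ₗ[k] N} (h : IsDO A n q) (b : A) :
    IsDO A n (Algebra.lsmul k k N b ∘ₗ q) := by
  induction n generalizing q with
  | zero => rw [show q = 0 from h, LinearMap.comp_zero]; rfl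
  | succ n ih => intro a; rw [bracket_lsmul_comp]; exact ih (h a)

theorem smul {n : ℕ} {q : M →ₗ[k] N} (h : IsDO A n q) (c : k) : IsDO A n (c • q) := by
  induction n generalizing q with
  | zero => rw [show q = 0 from h, smul_zero]; rfl
  | succ n ih => intro a; rw [bracket_smul]; exact ih (h a)

theorem sub {n : ℕ} {q q' : M →ₗ[k] N} (h : IsDO A n q) (h' : IsDO A n q') :
    IsDO A n (q - q') := by
  rw [sub_eq_add_neg, ← neg_one_smul k q']
  exact h.add (h'.smul _)

theorem sum {ι : Type*} {n : ℕ} (s : Finset ι) {q : ι → M →ₗ[k] N} (h : ∀ i ∈ s, IsDO A n (q i)) :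
    IsDO A n (∑ i ∈ s, q i) := by
  classical
  induction s using Finset.induction_on with
  | empty => simpa using zero n
  | insert i s hi ih =>
    rw [Finset.sum_insert hi]
    exact (h i (by simp)).add (ih fun j hj => h j (by simp [hj]))

/-- `IsDO A n` means order < n, so composing orders ≤ m − 1 and ≤ n − 1 gives order < m + n − 1. The
bound s avoids the subtraction and lets the Leibniz rule `bracket_comp` lower either m or n. -/
theorem comp_aux (s : ℕ) : ∀ {m n : ℕ}, m + n ≤ s + 1 → ∀ {q : M →ₗ[k] N} {p : N →ₗ[k] L},
    IsDO A m q → IsDO A n p → IsDO A s (p ∘ₗ q) := by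
  induction s with
  | zero =>
    intro m n h q p hq hp
    rcases Nat.eq_zero_or_pos m with rfl | hm
    · rw [show q = 0 from hq, LinearMap.comp_zero]; rfl
    · obtain rfl : n = 0 := by omega
      rw [show p = 0 from hp, LinearMap.zero_comp]; rfl
  | succ s ih =>
    intro m n h q p hq hp
    rcases m with _ | m
    · rw [show q = 0 from hq, LinearMap.comp_zero]; exact zero _
    rcases n with _ | n
    · rw [show p = 0 from hp, LinearMap.zero_comp]; exact zero _
    intro a
    rw [bracket_comp]
    exact (ih (m := m + 1) (n := n) (by omega) hq (hp a)).add
      (ih (m := m) (n := n + 1) (by omega) (hq a) hp)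

theorem comp {m n : ℕ} {q : M →ₗ[k] N} {p : N →ₗ[k] L} (hq : IsDO A (m + 1) q)
    (hp : IsDO A (n + 1) p) : IsDO A (m + n + 1) (p ∘ₗ q) :=
  comp_aux _ (by omega) hq hp

theorem of_linear {q : M →ₗ[k] N} (h : ∀ (a : A) (m : M), q (a • m) = a • q m) : IsDO A 1 q := by
  intro a
  change bracket q a = 0
  ext m
  simp [h a m]

/-- A map which embeds compatibly into a differential operator is a differential operator. -/
theorem of_injective {B E F : Type*} [CommRing B] [Algebra k B]
    [AddCommGroup E] [Module k E] [Module B E] [IsScalarTower k B E]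
    [AddCommGroup F] [Module k F] [Module B F] [IsScalarTower k B F]
    (φ : A → B) (j : M → E) (i : N →+ F) (hi : Function.Injective i)
    (hj : ∀ a m, j (a • m) = φ a • j m) (hi' : ∀ a m, i (a • m) = φ a • i m)
    {n : ℕ} {q : M →ₗ[k] N} {Q : E →ₗ[k] F} (hQ : IsDO B n Q) (h : ∀ m, i (q m) = Q (j m)) :
    IsDO A n q := by
  induction n generalizing q Q with
  | zero =>
    change q = 0
    ext m
    apply hi
    rw [h, show Q = 0 from hQ]
    simp
  | succ n ih =>
    intro a
    exact ih (hQ (φ a)) fun m => by simp [h, hi', hj]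

/-- A differential operator maps a localization of `S` into a localization of the image of `S`. -/
theorem mem_of_inv {K E F : Type*} [Field K] [Algebra k K]
    [AddCommGroup E] [Module k E] [Module K E] [IsScalarTower k K E]
    [AddCommGroup F] [Module k F] [Module K F] [IsScalarTower k K F]
    {L : Submodule k F} {s : K} (h0 : s ≠ 0) (hL : ∀ m ∈ L, s • m ∈ L)
    (hL' : ∀ m ∈ L, s⁻¹ • m ∈ L) {S : Set E} (hS : ∀ m ∈ S, s • m ∈ S) {n : ℕ} {q : E →ₗ[k] F}
    (hq : IsDO K n q) (h : ∀ m ∈ S, q m ∈ L) : ∀ m ∈ S, q (s⁻¹ • m) ∈ L := by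
  induction n generalizing q with
  | zero => intro m _; rw [show q = 0 from hq]; exact zero_mem _
  | succ n ih =>
    intro m hm
    -- [q, s] applied to s⁻¹ m is q m − s q(s⁻¹ m). It lies in L by induction, hence so does s q(s⁻¹
    -- m), and L is stable under s⁻¹.
    have h1 := ih (hq s) (fun m hm => by
      rw [bracket_apply]
      exact sub_mem (h _ (hS m hm)) (hL _ (h m hm))) m hm
    rw [bracket_apply, smul_inv_smul₀ h0] at h1
    have h2 := hL' _ (sub_mem (h m hm) h1)
    rw [sub_sub_cancel] at h2
    rwa [inv_smul_smul₀ h0] at h2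

/-- The image of a finitely generated module under a differential operator is contained in a
finitely generated module. -/
theorem exists_fg {K E F : Type*} [Field K] [Algebra k K]
    [AddCommGroup E] [Module k E] [Module K E] [IsScalarTower k K E]
    [AddCommGroup F] [Module k F] [Module K F] [IsScalarTower k K F]
    {R : Subalgebra k K} (hR : R.FG) {S : Submodule R E} (hS : S.FG) {n : ℕ} {q : E →ₗ[k] F}
    (hq : IsDO K n q) : ∃ L : Submodule R F, L.FG ∧ ∀ m ∈ S, q m ∈ L := by
  classical
  induction n generalizing q with
  | zero => exact ⟨⊥, Submodule.fg_bot, fun m _ => by rw [show q = 0 from hq]; exact zero_mem _⟩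
  | succ n ih =>
    choose L hL hqL using fun a : K => ih (hq a)
    obtain ⟨t, ht⟩ := hR
    obtain ⟨e, he⟩ := hS
    -- The values of q on generators of S, together with modules receiving [q, x](S) for the
    -- finitely many algebra generators x of R. This suffices because q(x m) = x q(m) + [q, x](m).
    refine ⟨Submodule.span R (e.image q) ⊔ t.sup L, ?_, ?_⟩
    · exact Submodule.FG.sup ⟨_, rfl⟩ (Submodule.fg_finset_sup _ _ fun a _ => hL a)
    set L' := Submodule.span R (↑(e.image q) : Set F) ⊔ t.sup L with hL'
    have key : ∀ a ∈ R, ∀ m ∈ S, q m ∈ L' → q (a • m) ∈ L' := by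
      intro a ha
      rw [← ht] at ha
      have hmem : ∀ b ∈ Algebra.adjoin k (t : Set K), b ∈ R := fun b hb => ht ▸ hb
      induction ha using Algebra.adjoin_induction with
      | mem x hx =>
        intro m hm h
        have h1 : bracket q x m ∈ L' :=
          (le_trans (Finset.le_sup (f := L) hx) le_sup_right) (hqL x m hm)
        have h2 := L'.smul_mem ⟨x, hmem x (Algebra.subset_adjoin hx)⟩ h
        have h3 : bracket q x m + x • q m ∈ L' := add_mem h1 h2
        simpa using h3
      | algebraMap c =>
        intro m _ h
        rw [algebraMap_smul, map_smul]
        have := L'.smul_mem (algebraMap k R c) h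
        rwa [algebraMap_smul] at this
      | add x y _ _ hx hy =>
        intro m hm h
        rw [add_smul, map_add]
        exact add_mem (hx m hm h) (hy m hm h)
      | mul x y hx' hy' hx hy =>
        intro m hm h
        rw [mul_smul]
        exact hx _ (S.smul_mem ⟨y, hmem y hy'⟩ hm) (hy m hm h)
    intro m hm
    have hm' := hm
    rw [← he] at hm'
    induction hm' using Submodule.span_induction with
    | mem x hx =>
      exact (le_sup_left (a := Submodule.span R (↑(e.image q) : Set F)))
        (Submodule.subset_span (by simpa using ⟨x, hx, rfl⟩))
    | zero => simp
    | add x y hx hy ihx ihy =>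
      rw [map_add]
      exact add_mem (ihx (he ▸ hx)) (ihy (he ▸ hy))
    | smul a x hx ihx => exact key a a.2 x (he ▸ hx) (ihx (he ▸ hx))

/-- R is noetherian, being of finite type over a field, so a module contained in a finitely
generated one is itself finitely generated. -/
theorem fg_span_image {k K E F : Type*} [Field k] [Field K] [Algebra k K]
    [AddCommGroup E] [Module k E] [Module K E] [IsScalarTower k K E]
    [AddCommGroup F] [Module k F] [Module K F] [IsScalarTower k K F]
    {R : Subalgebra k K} (hR : R.FG) {S : Submodule R E} (hS : S.FG) {n : ℕ} {q : E →ₗ[k] F}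
    (hq : IsDO K n q) : (Submodule.span R (q '' (S : Set E))).FG := by
  obtain ⟨L, hL, hqL⟩ := hq.exists_fg hR hS
  have : Algebra.FiniteType k R := R.fg_iff_finiteType.1 hR
  have : IsNoetherianRing R := Algebra.FiniteType.isNoetherianRing k R
  exact Submodule.FG.of_le hL (Submodule.span_le.2 (by rintro _ ⟨w, hw, rfl⟩; exact hqL w hw))

end IsDO

/-! ### Comparison with principal parts -/

/-- The generators 1 ⊗ a − a ⊗ 1 of the diagonal ideal act on operators as commutators. Hence
vanishing on the n-th power of the ideal and vanishing of n-fold commutators are the same condition.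
-/
theorem liftBaseChange_ppAction (q : M →ₗ[k] N) (a : A) (w : A ⊗[k] M) :
    LinearMap.liftBaseChange A q (ppAction k A M (1 ⊗ₜ a - a ⊗ₜ 1) w) =
      LinearMap.liftBaseChange A (bracket q a) w := by
  induction w using TensorProduct.induction_on with
  | zero => simp
  | add x y hx hy => rw [map_add, map_add, hx, hy, map_add]
  | tmul c m =>
    rw [map_sub, LinearMap.sub_apply, ppAction_tmul, ppAction_tmul]
    simp [smul_sub, mul_smul, smul_comm a c]

theorem isDO_iff_liftBaseChange {n : ℕ} {q : M →ₗ[k] N} :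
    IsDO A n q ↔ ∀ s ∈ KaehlerDifferential.ideal k A ^ n, ∀ z,
      LinearMap.liftBaseChange A q (ppAction k A M s z) = 0 := by
  induction n generalizing q with
  | zero =>
    constructor
    · intro h s _ z
      rw [show q = 0 from h]
      generalize ppAction k A M s z = w
      induction w using TensorProduct.induction_on with
      | zero => simp
      | add x y hx hy => rw [map_add, hx, hy, add_zero]
      | tmul c m => simp
    · intro h
      change q = 0
      ext m
      simpa using h 1 (by simp) (1 ⊗ₜ m)
  | succ n ih =>
    have hmem (a : A) : (1 ⊗ₜ a - a ⊗ₜ 1 : A ⊗[k] A) ∈ KaehlerDifferential.ideal k A := by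
      rw [← KaehlerDifferential.span_range_eq_ideal]
      exact Ideal.subset_span ⟨a, rfl⟩
    have hstep (a : A) (s : A ⊗[k] A) (z) :
        LinearMap.liftBaseChange A q (ppAction k A M (s * (1 ⊗ₜ a - a ⊗ₜ 1)) z) =
          LinearMap.liftBaseChange A (bracket q a) (ppAction k A M s z) := by
      rw [← liftBaseChange_ppAction, mul_comm, map_mul, Module.End.mul_apply]
    constructor
    · intro h s hs z
      rw [pow_succ] at hs
      induction hs using Submodule.mul_induction_on' with
      | add x _ y _ hx hy => rw [map_add, LinearMap.add_apply, map_add, hx, hy, add_zero]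
      | mem_mul_mem x hx y hy =>
        -- The last factor may be taken of the form 1 ⊗ a − a ⊗ 1: its coefficients are absorbed
        -- into x, which stays in the n-th power of the ideal.
        rw [← KaehlerDifferential.span_range_eq_ideal] at hy
        induction hy using Submodule.span_induction generalizing x with
        | zero => simp
        | add y y' _ _ hy hy' =>
          rw [mul_add, map_add, LinearMap.add_apply, map_add, hy x hx, hy' x hx, add_zero]
        | smul c y _ hy =>
          rw [smul_eq_mul, ← mul_assoc]
          exact hy _ (Ideal.mul_mem_right _ _ hx)
        | mem y hy =>
          obtain ⟨a, rfl⟩ := hy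
          rw [hstep]
          exact ih.1 (h a) x hx z
    · intro h a
      refine ih.2 fun s hs z => ?_
      rw [← hstep]
      exact h _ (by rw [pow_succ]; exact Ideal.mul_mem_mul hs (hmem a)) z

theorem isDO_iff_ppKernel_le {n : ℕ} {q : M →ₗ[k] N} :
    IsDO A (n + 1) q ↔ ppKernel k A M n ≤ LinearMap.ker (LinearMap.liftBaseChange A q) := by
  rw [isDO_iff_liftBaseChange, ppKernel, Submodule.span_le]
  constructor
  · rintro h _ ⟨s, hs, z, rfl⟩
    exact h s hs z
  · intro h s hs z
    exact h ⟨s, hs, z, rfl⟩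

/-- The linear map on principal parts defined by a differential operator. -/
def principalPartsLift {n : ℕ} (q : M →ₗ[k] N) (hq : IsDO A (n + 1) q) :
    PrincipalParts k A M n →ₗ[A] N :=
  (ppKernel k A M n).liftQ (LinearMap.liftBaseChange A q) (isDO_iff_ppKernel_le.1 hq)

theorem principalPartsLift_taylorMap {n : ℕ} (q : M →ₗ[k] N) (hq : IsDO A (n + 1) q) (m : M) :
    principalPartsLift q hq (taylorMap k A M n m) = q m := by
  change LinearMap.liftBaseChange A q (1 ⊗ₜ m) = q m
  simp

theorem isDO_of_principalParts {n : ℕ} (q : M →ₗ[k] N) (h : PrincipalParts k A M n →ₗ[A] N)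
    (hq : ∀ m, q m = h (taylorMap k A M n m)) : IsDO A (n + 1) q := by
  rw [isDO_iff_ppKernel_le]
  have : LinearMap.liftBaseChange A q = h ∘ₗ (ppKernel k A M n).mkQ := by
    ext m
    change LinearMap.liftBaseChange A q (1 ⊗ₜ m) = h (taylorMap k A M n m)
    rw [LinearMap.liftBaseChange_tmul, one_smul, hq]
  rw [this]
  intro w hw
  rw [LinearMap.mem_ker, LinearMap.comp_apply, Submodule.mkQ_apply,
    (Submodule.Quotient.mk_eq_zero _).2 hw, map_zero]

theorem mem_diffOp_iff {n : ℕ} {q : Module.End k M} : q ∈ diffOp k A M n ↔ IsDO A (n + 1) q :=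
  ⟨fun ⟨h, hh⟩ => isDO_of_principalParts q h hh,
    fun h => ⟨principalPartsLift q h, fun m => (principalPartsLift_taylorMap q h m).symm⟩⟩

end Bracket

/-! ### Injectivity of the Taylor map on a fibre and dual functionals -/

section Fibre

variable {k A M V : Type*} [Field k] [CommRing A] [IsLocalRing A] [Algebra k A]
  [AddCommGroup M] [Module k M] [Module A M] [IsScalarTower k A M] [AddCommGroup V] [Module k V]

open IsLocalRing

/-- A linear left inverse of the fibre map over the residue field, followed by the coordinates of
the basis, is a family of linear forms on principal parts, that is, of differential operators. -/
theorem exists_dual_functionals {ι : V →ₗ[k] M} {n : ℕ} {I : Type*} [Finite I] [DecidableEq I]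
    (b : Module.Basis I k V) (h : Function.Injective (fibreTaylorMap k A ι n)) :
    ∃ l : I → M →ₗ[k] ResidueField A, (∀ i, IsDO A (n + 1) (l i)) ∧
      ∀ i j, l i (ι (b j)) = if i = j then 1 else 0 := by
  obtain ⟨g, hg⟩ := LinearMap.exists_leftInverse_of_injective (fibreTaylorMap k A ι n)
    (LinearMap.ker_eq_bot.2 h)
  let b' := b.baseChange (ResidueField A)
  let φ (i : I) : PrincipalParts k A M n →ₗ[A] ResidueField A :=
    ((b'.coord i ∘ₗ g).restrictScalars A) ∘ₗ
      (TensorProduct.mk A (ResidueField A) (PrincipalParts k A M n) 1)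
  refine ⟨fun i => (φ i).restrictScalars k ∘ₗ taylorMap k A M n, fun i => ?_, fun i j => ?_⟩
  · exact isDO_of_principalParts _ (φ i) fun m => rfl
  · have h1 : fibreTaylorMap k A ι n (1 ⊗ₜ b j) =
        1 ⊗ₜ taylorMap k A M n (ι (b j)) := by
      simp [fibreTaylorMap]
    have h2 := LinearMap.congr_fun hg (1 ⊗ₜ b j)
    rw [LinearMap.comp_apply, h1] at h2
    change b'.coord i (g (1 ⊗ₜ taylorMap k A M n (ι (b j)))) = _
    rw [h2]
    have : b' j = 1 ⊗ₜ b j := Module.Basis.baseChange_apply _ _ _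
    rw [LinearMap.id_apply, ← this, Module.Basis.coord_apply, Module.Basis.repr_self,
      Finsupp.single_apply]
    simp [eq_comm]

/-- The operators induce on the fibre a left inverse up to the factor `residue A u`, which is
nonzero. A unit u in place of 1 allows for operators dual only up to a function that does not vanish
at the point. -/
theorem fibreTaylorMap_injective {ι : V →ₗ[k] M} {n : ℕ} {I : Type*} [Finite I] [DecidableEq I]
    (b : Module.Basis I k V) (q : I → M →ₗ[k] A) (hq : ∀ i, IsDO A (n + 1) (q i)) {u : A}
    (hu : IsUnit u) (h : ∀ i j, q i (ι (b j)) = if i = j then u else 0) :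
    Function.Injective (fibreTaylorMap k A ι n) := by
  let ψ (i : I) : ResidueField A ⊗[A] PrincipalParts k A M n →ₗ[ResidueField A] ResidueField A :=
    LinearMap.liftBaseChange (ResidueField A)
      (Algebra.linearMap A (ResidueField A) ∘ₗ principalPartsLift (q i) (hq i))
  let b' := b.baseChange (ResidueField A)
  have key (i : I) : ψ i ∘ₗ fibreTaylorMap k A ι n = residue A u • b'.coord i := by
    refine b'.ext fun j => ?_
    have : b' j = 1 ⊗ₜ b j := Module.Basis.baseChange_apply _ _ _
    rw [LinearMap.smul_apply, Module.Basis.coord_apply, Module.Basis.repr_self, this,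
      LinearMap.comp_apply]
    have h1 : fibreTaylorMap k A ι n (1 ⊗ₜ b j) =
        1 ⊗ₜ taylorMap k A M n (ι (b j)) := by
      simp [fibreTaylorMap]
    rw [h1]
    simp only [ψ, LinearMap.liftBaseChange_tmul, one_smul, LinearMap.comp_apply]
    rw [principalPartsLift_taylorMap, h, Finsupp.single_apply]
    simp only [eq_comm (a := j), apply_ite (Algebra.linearMap A (ResidueField A)), map_zero]
    split_ifs
    · simp [ResidueField.algebraMap_eq]
    · simp
  rw [injective_iff_map_eq_zero]
  intro w hw
  refine b'.ext_elem fun i => ?_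
  have h1 := LinearMap.congr_fun (key i) w
  rw [LinearMap.comp_apply, hw, map_zero, LinearMap.smul_apply] at h1
  have h2 : residue A u ≠ 0 := by simpa using hu
  simpa [h2] using h1.symm

theorem fibreTaylorMap_injective_mono {ι : V →ₗ[k] M} {m n : ℕ} (hmn : m ≤ n)
    (h : Function.Injective (fibreTaylorMap k A ι m)) :
    Function.Injective (fibreTaylorMap k A ι n) := by
  have : fibreTaylorMap k A ι m = (LinearMap.baseChange (ResidueField A)
      (Submodule.factor (ppKernel_anti k A M hmn))) ∘ₗ fibreTaylorMap k A ι n := by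
    ext v
    simp [fibreTaylorMap]
    rfl
  rw [this] at h
  exact Function.Injective.of_comp h

end Fibre

/-! ### Lifting differential operators along local coordinates -/

section Coordinates

variable (k R K : Type*) [Field k] [CommRing R] [Algebra k R] [Field K] [Algebra k K] [Algebra R K]

/-- Local coordinates `t i ∈ R` with dual derivations of the field `K ⊇ R` which preserve `R`. -/
structure LocalCoordinates (d : ℕ) where
  coord : Fin d → R
  der : Fin d → Derivation k K K
  derR : Fin d → Derivation k R R
  der_algebraMap : ∀ i a, der i (algebraMap R K a) = algebraMap R K (derR i a)
  derR_coord : ∀ i j, derR i (coord j) = if i = j then 1 else 0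
  span_D_coord : Submodule.span R (Set.range fun i => KaehlerDifferential.D k R (coord i)) = ⊤

variable {k R K} {d : ℕ} (c : LocalCoordinates k R K d)

variable {W : Type*} [AddCommGroup W] [Module k W] [Module R W] [IsScalarTower k R W]

theorem bracket_smul_right (q : R →ₗ[k] W) (x : k) (a : R) :
    bracket q (x • a) = x • bracket q a := by
  ext m
  simp [smul_sub]

theorem derivation_isDO {A : Type*} [CommRing A] [Algebra k A] (D : Derivation k A A) :
    IsDO A 2 (D : A →ₗ[k] A) := by
  intro a
  refine IsDO.of_linear fun b m => ?_
  simp only [bracket_apply, Derivation.coeFn_coe, Derivation.leibniz, smul_eq_mul]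
  ring

theorem coe_derivation_bracket {A : Type*} [CommRing A] [Algebra k A] (D : Derivation k A A)
    (a m : A) : bracket (D : A →ₗ[k] A) a m = D a * m := by
  simp only [bracket_apply, Derivation.coeFn_coe, Derivation.leibniz, smul_eq_mul]
  ring

namespace LocalCoordinates

include c

/-- Applying the linear forms attached to the dual derivations to any expansion of da in the dt_i
identifies its coefficients. -/
theorem D_eq (a : R) :
    KaehlerDifferential.D k R a = ∑ i, c.derR i a • KaehlerDifferential.D k R (c.coord i) := by
  have h : KaehlerDifferential.D k R a ∈
      Submodule.span R (Set.range fun i => KaehlerDifferential.D k R (c.coord i)) := by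
    rw [c.span_D_coord]; trivial
  obtain ⟨x, hx⟩ := (Submodule.mem_span_range_iff_exists_fun R).1 h
  have : ∀ i, c.derR i a = x i := fun i => by
    have := congrArg (c.derR i).liftKaehlerDifferential hx
    simpa [c.derR_coord] using this.symm
  simp_rw [this, hx]

/-- Modulo operators with `IsDO R m`, the map a ↦ [ν, a] is a derivation. The dt_j generate the
differentials, so it vanishes once it kills the coordinates. -/
theorem isDO_of_bracket_coord {m : ℕ} {ν : R →ₗ[k] W} (h : IsDO R (m + 2) ν)
    (ht : ∀ j, IsDO R m (bracket ν (c.coord j))) : IsDO R (m + 1) ν := by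
  let S : Submodule R (R →ₗ[k] W) :=
    { carrier := {q | IsDO R m q}
      add_mem' := fun ha hb => IsDO.add ha hb
      zero_mem' := IsDO.zero m
      smul_mem' := fun a q hq => IsDO.lsmul_comp hq a }
  let H : R →ₗ[k] ((R →ₗ[k] W) ⧸ S) :=
    { toFun := fun a => S.mkQ (bracket ν a)
      map_add' := fun a b => by rw [bracket_add_right, map_add]
      map_smul' := fun x a => by
        rw [bracket_smul_right]
        exact LinearMap.map_smul_of_tower S.mkQ x _ }
  let D : Derivation k R ((R →ₗ[k] W) ⧸ S) := Derivation.mk' H fun a b => by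
    change S.mkQ (bracket ν (a * b)) = a • S.mkQ (bracket ν b) + b • S.mkQ (bracket ν a)
    have : S.mkQ (bracket (bracket ν a) b) = 0 := (Submodule.Quotient.mk_eq_zero S).2 (h a b)
    rw [bracket_mul, map_add, this, add_zero, map_add, ← map_smul, ← map_smul]
    rfl
  intro a
  have h0 : D a = 0 := by
    have h1 := congrArg D.liftKaehlerDifferential (c.D_eq a)
    have h2 (j) : D (c.coord j) = 0 := (Submodule.Quotient.mk_eq_zero S).2 (ht j)
    simpa [h2] using h1
  exact (Submodule.Quotient.mk_eq_zero S).1 h0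

/-- The Euler operator `ν ↦ ∑ [ν, t i] ∂ i`. -/
def euler (ν : R →ₗ[k] W) : R →ₗ[k] W :=
  ∑ i, bracket ν (c.coord i) ∘ₗ (c.derR i : R →ₗ[k] R)

theorem euler_isDO {n : ℕ} {ν : R →ₗ[k] W} (h : IsDO R (n + 1) ν) : IsDO R (n + 1) (c.euler ν) :=
  IsDO.sum _ fun i _ => IsDO.comp_aux _ (by omega) (derivation_isDO (c.derR i)) (h (c.coord i))

theorem bracket_euler (ν : R →ₗ[k] W) (j : Fin d) :
    bracket (c.euler ν) (c.coord j) =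
      c.euler (bracket ν (c.coord j)) + bracket ν (c.coord j) := by
  ext a
  have h1 : bracket (c.euler ν) (c.coord j) =
      ∑ i, bracket (bracket ν (c.coord i) ∘ₗ (c.derR i : R →ₗ[k] R)) (c.coord j) := by
    ext a
    simp only [euler, bracket_apply, LinearMap.sum_apply, Finset.smul_sum,
      Finset.sum_sub_distrib]
  have h2 (i : Fin d) : (bracket ν (c.coord i) ∘ₗ bracket (c.derR i : R →ₗ[k] R) (c.coord j)) =
      if i = j then bracket ν (c.coord i) else 0 := by
    ext a
    rw [LinearMap.comp_apply, coe_derivation_bracket, c.derR_coord]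
    split_ifs
    · rw [one_mul]
    · rw [zero_mul, map_zero]; rfl
  rw [h1]
  simp_rw [bracket_comp, h2, Finset.sum_add_distrib, bracket_comm ν _ (c.coord j)]
  simp [euler]

/-- Euler's identity for symbols: E multiplies the leading part of an operator of order n by n. By
`bracket_euler`, the commutator of E ν − (n + 1) ν with t_j is E μ − n μ for μ = [ν, t_j], so
induction applies. -/
theorem euler_sub_isDO {n : ℕ} {ν : R →ₗ[k] W} (h : IsDO R (n + 1) ν) :
    IsDO R n (c.euler ν - (n : k) • ν) := by
  induction n generalizing ν with
  | zero =>
    have h0 (i) : bracket ν (c.coord i) = 0 := h (c.coord i)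
    change _ = 0
    simp [euler, h0]
  | succ n ih =>
    refine c.isDO_of_bracket_coord ((c.euler_isDO h).sub (h.smul _)) fun j => ?_
    have := ih (h (c.coord j))
    rw [bracket_sub, bracket_smul, bracket_euler]
    convert this using 1
    push_cast
    rw [add_smul, one_smul]
    abel

variable [IsLocalRing R] [IsScalarTower k R K] [CharZero k]

open IsLocalRing

/-- Every differential operator from `R` to its residue field is the residue of a differential
operator of `K` which preserves `R`. -/
theorem exists_lift {n : ℕ} {l : R →ₗ[k] ResidueField R} (hl : IsDO R n l) :
    ∃ q : K →ₗ[k] K, IsDO K n q ∧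
      ∀ a : R, ∃ b : R, q (algebraMap R K a) = algebraMap R K b ∧ residue R b = l a := by
  induction n generalizing l with
  | zero =>
    refine ⟨0, IsDO.zero _, fun a => ⟨0, by simp, ?_⟩⟩
    rw [show l = 0 from hl]
    simp
  | succ n ih =>
    -- In order 0 the division by n is not available, but l is then R-linear and multiplication by a
    -- lift of l(1) lifts it.
    rcases Nat.eq_zero_or_pos n with rfl | hn
    · obtain ⟨x, hx⟩ := residue_surjective (R := R) (l 1)
      refine ⟨Algebra.lsmul k k K (algebraMap R K x), IsDO.of_linear fun a m => ?_,
        fun a => ⟨x * a, by simp, ?_⟩⟩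
      · simp [mul_left_comm]
      · have h0 : bracket l a = 0 := hl a
        have h1 : l (a • 1) - a • l 1 = 0 := LinearMap.congr_fun h0 1
        rw [smul_eq_mul, mul_one, sub_eq_zero] at h1
        rw [h1, ← hx, map_mul, Algebra.smul_def, ResidueField.algebraMap_eq, mul_comm]
    choose q hq hq' using fun i => ih (hl (c.coord i))
    obtain ⟨p, hp, hp'⟩ := ih (c.euler_sub_isDO hl)
    have hn0 : (n : k) ≠ 0 := by exact_mod_cast hn.ne'
    -- This lifts l = n⁻¹ (E l − (E l − n l)): `q i` lifts [l, t_i] and `p` lifts E l − n l, both of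
    -- lower order.
    refine ⟨(n : k)⁻¹ • (∑ i, q i ∘ₗ (c.der i : K →ₗ[k] K) - p), ?_, fun a => ?_⟩
    · refine ((IsDO.sum _ fun i _ => ?_).sub hp.succ).smul _
      exact IsDO.comp_aux _ (by omega) (derivation_isDO (c.der i)) (hq i)
    · choose b hb hb' using fun i => hq' i (c.derR i a)
      obtain ⟨e, he, he'⟩ := hp' a
      refine ⟨(n : k)⁻¹ • (∑ i, b i - e), ?_, ?_⟩
      · rw [LinearMap.smul_apply, LinearMap.sub_apply, LinearMap.sum_apply, he]
        simp only [LinearMap.comp_apply, Derivation.coeFn_coe, c.der_algebraMap, hb]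
        rw [← map_sum, ← map_sub, Algebra.smul_def, Algebra.smul_def, map_mul,
          ← IsScalarTower.algebraMap_apply]
      · have h1 : residue R ((n : k)⁻¹ • (∑ i, b i - e)) =
            (n : k)⁻¹ • (residue R (∑ i, b i - e)) := by
          rw [Algebra.smul_def, map_mul, Algebra.smul_def,
            IsScalarTower.algebraMap_apply k R (ResidueField R), ResidueField.algebraMap_eq]
        rw [h1, map_sub, he', map_sum]
        simp only [hb']
        have h2 : c.euler l a = ∑ i, bracket l (c.coord i) (c.derR i a) := by
          simp [euler]
        rw [LinearMap.sub_apply, h2, sub_sub_cancel, LinearMap.smul_apply, inv_smul_smul₀ hn0]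

variable {E : Type*} [AddCommGroup E] [Module k E] [Module K E] [IsScalarTower k K E]

theorem exists_lift_pi {r n : ℕ} (b : Module.Basis (Fin r) K E)
    {l : (Fin r → R) →ₗ[k] ResidueField R} (hl : IsDO R (n + 1) l) :
    ∃ q : E →ₗ[k] K, IsDO K (n + 1) q ∧ ∀ w : Fin r → R, ∃ a : R,
      q (∑ i, algebraMap R K (w i) • b i) = algebraMap R K a ∧ residue R a = l w := by
  have hs (i : Fin r) : IsDO R (n + 1) (l ∘ₗ LinearMap.single k (fun _ => R) i) := by
    have := IsDO.comp (m := 0) (IsDO.of_linear (A := R) (q := LinearMap.single k (fun _ => R) i)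
      fun a m => by ext j; simp [Pi.single_apply]) hl
    simpa using this
  choose q hq hq' using fun i => c.exists_lift (hs i)
  refine ⟨∑ i, q i ∘ₗ (b.coord i).restrictScalars k, IsDO.sum _ fun i _ => ?_, fun w => ?_⟩
  · have := IsDO.comp (m := 0) (IsDO.of_linear (A := K) (q := (b.coord i).restrictScalars k)
      fun a m => by simp) (hq i)
    simpa using this
  · choose a ha ha' using fun i => hq' i (w i)
    refine ⟨∑ i, a i, ?_, ?_⟩
    · rw [LinearMap.sum_apply, map_sum (algebraMap R K)]
      refine Finset.sum_congr rfl fun i _ => ?_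
      rw [← ha, LinearMap.comp_apply, LinearMap.restrictScalars_apply, map_sum]
      simp [Finsupp.single_apply]
    · simp_rw [map_sum, ha', LinearMap.comp_apply, ← map_sum]
      congr 1
      ext j
      simp

/-- Functionals which are dual to the family `v` lift to differential operators dual to `v`. -/
theorem exists_dual_operators {r n m : ℕ} (b : Module.Basis (Fin r) K E)
    {l : Fin m → (Fin r → R) →ₗ[k] ResidueField R} (hl : ∀ i, IsDO R (n + 1) (l i))
    (v : Fin m → Fin r → R) (hv : ∀ i j, l i (v j) = if i = j then 1 else 0) :
    ∃ q : Fin m → E →ₗ[k] K, (∀ i, IsDO K (n + 1) (q i)) ∧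
      (∀ i, ∀ w : Fin r → R, ∃ a : R, q i (∑ i, algebraMap R K (w i) • b i) = algebraMap R K a) ∧
      ∀ i j, q i (∑ s, algebraMap R K (v j s) • b s) = if i = j then 1 else 0 := by
  choose q hq hq' using fun i => c.exists_lift_pi b (hl i)
  choose a ha ha' using hq'
  -- The lifts are dual to `v` only modulo the maximal ideal. Their matrix of values reduces to the
  -- identity, so it is invertible over R, and its inverse corrects them.
  let T : Matrix (Fin m) (Fin m) R := Matrix.of fun i j => a i (v j)
  have hT : T.map (residue R) = 1 := by
    ext i j
    simp [T, ha', hv, Matrix.one_apply]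
  have hdet : IsUnit T.det := by
    have h1 : residue R T.det = 1 := by
      have := (residue R).map_det T
      rw [this]
      change (T.map (residue R)).det = 1
      rw [hT, Matrix.det_one]
    by_contra h0
    have h2 : residue R T.det = 0 := (residue_eq_zero_iff _).2 ((mem_maximalIdeal _).2 h0)
    exact one_ne_zero (h1.symm.trans h2)
  refine ⟨fun i => ∑ s, Algebra.lsmul k k K (algebraMap R K (T⁻¹ i s)) ∘ₗ q s,
    fun i => IsDO.sum _ fun s _ => (hq s).lsmul_comp _, fun i w => ?_, fun i j => ?_⟩
  · refine ⟨∑ s, T⁻¹ i s * a s w, ?_⟩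
    rw [LinearMap.sum_apply, map_sum (algebraMap R K)]
    refine Finset.sum_congr rfl fun s _ => ?_
    rw [LinearMap.comp_apply, ha, Algebra.lsmul_coe, map_mul]
    rfl
  · have h1 : (T⁻¹ * T) i j = if i = j then 1 else 0 := by
      rw [Matrix.nonsing_inv_mul _ hdet, Matrix.one_apply]
    have h2 := congrArg (algebraMap R K) h1
    rw [Matrix.mul_apply, map_sum] at h2
    rw [LinearMap.sum_apply]
    convert h2 using 1
    · refine Finset.sum_congr rfl fun s _ => ?_
      rw [LinearMap.comp_apply, ha, Algebra.lsmul_coe, map_mul]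
      rfl
    · split_ifs <;> simp

end LocalCoordinates

end Coordinates

/-! ### Local coordinates at a regular closed point in characteristic zero -/

section Regular

open IsLocalRing

/-- Incomparability: contraction of primes along an integral extension is strictly monotone. -/
theorem ringKrullDim_le_of_isIntegral (P A : Type*) [CommRing P] [CommRing A] [Algebra P A]
    [Algebra.IsIntegral P A] : ringKrullDim A ≤ ringKrullDim P :=
  Order.krullDim_le_of_strictMono (fun q : PrimeSpectrum A => q.comap (algebraMap P A))
    fun _ _ h => Ideal.IsIntegral.comap_lt_comap (show _ < _ from h)

/-- By Noether normalization A is integral over a polynomial ring P in s variables, so dim A ≤ s. In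
characteristic 0 the algebraic extension K of Frac P is separable, hence formally étale over P, and
the s differentials of the variables form a basis of Ω_K. -/
theorem ringKrullDim_le_finrank_kaehlerDifferential (k A K : Type*) [Field k] [CharZero k]
    [CommRing A] [IsDomain A] [Algebra k A] [Algebra.FiniteType k A] [Field K] [Algebra k K]
    [Algebra A K] [IsScalarTower k A K] [IsFractionRing A K] :
    ringKrullDim A ≤ Module.finrank K (Ω[K⁄k]) := by
  obtain ⟨s, g, hg, hg'⟩ := exists_integral_inj_algHom_of_fg k A
  let P := MvPolynomial (Fin s) k
  algebraize [g.toRingHom]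
  have hPA : Algebra.IsIntegral P A := ⟨hg'⟩
  have hinj : Function.Injective (algebraMap P A) := hg
  let iPK : Algebra P K := ((algebraMap A K).comp g.toRingHom).toAlgebra
  have tPAK : IsScalarTower P A K := IsScalarTower.of_algebraMap_eq fun _ => rfl
  have tkPK : IsScalarTower k P K := IsScalarTower.of_algebraMap_eq fun x => by
    rw [IsScalarTower.algebraMap_apply k A K]
    change _ = algebraMap A K (g (algebraMap k P x))
    rw [AlgHom.commutes]
  have hPK : Function.Injective (algebraMap P K) :=
    (IsFractionRing.injective A K).comp hg
  have : FaithfulSMul P K := (faithfulSMul_iff_algebraMap_injective P K).2 hPK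
  have : FaithfulSMul P A := (faithfulSMul_iff_algebraMap_injective P A).2 hinj
  let L := FractionRing P
  let iLK : Algebra L K := FractionRing.liftAlgebra P K
  have tPLK : IsScalarTower P L K := FractionRing.isScalarTower_liftAlgebra P K
  have : Algebra.IsAlgebraic P K := by
    have : Algebra.IsAlgebraic A K := IsLocalization.isAlgebraic K (nonZeroDivisors A)
    exact Algebra.IsAlgebraic.trans P A K
  have : Algebra.IsAlgebraic L K := IsFractionRing.comap_isAlgebraic_iff (A := P) (K := L) (C := K) |>.1 inferInstance
  have : CharZero L := charZero_of_injective_algebraMap (R := k) (algebraMap k L).injective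
  have : Algebra.FormallyEtale L K := Algebra.FormallyEtale.of_isSeparable L K
  have : Algebra.FormallyEtale P L := Algebra.FormallyEtale.of_isLocalization (nonZeroDivisors P)
  have : Algebra.FormallyEtale P K := Algebra.FormallyEtale.comp P L K
  let b : Module.Basis (Fin s) K (Ω[K⁄k]) :=
    ((KaehlerDifferential.mvPolynomialBasis k (Fin s)).baseChange K).map
      (KaehlerDifferential.tensorKaehlerEquivOfFormallyEtale k P K)
  rw [Module.finrank_eq_card_basis b]
  refine (ringKrullDim_le_of_isIntegral P A).trans ?_
  rw [MvPolynomial.ringKrullDim_of_isNoetherianRing]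
  simp [ringKrullDim_eq_zero_of_field]

/-- Modulo the dt_i and 𝔪 Ω the universal derivation kills 𝔪. It then kills everything because the
residue field is algebraic and separable over k, and Nakayama's lemma concludes. -/
theorem span_D_eq_top_of_span_eq_maximalIdeal {k R : Type*} [Field k] [CharZero k] [CommRing R]
    [IsLocalRing R] [Algebra k R] [Algebra.EssFiniteType k R]
    [Algebra.IsAlgebraic k (ResidueField R)] {ι : Type*} (t : ι → R)
    (ht : Ideal.span (Set.range t) = maximalIdeal R) :
    Submodule.span R (Set.range fun i => KaehlerDifferential.D k R (t i)) = ⊤ := by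
  set N := Submodule.span R (Set.range fun i => KaehlerDifferential.D k R (t i)) with hN
  let S : Submodule R (Ω[R⁄k]) := N ⊔ maximalIdeal R • ⊤
  let D : Derivation k R ((Ω[R⁄k]) ⧸ S) := S.mkQ.compDer (KaehlerDifferential.D k R)
  have hDapp (a : R) : D a = S.mkQ (KaehlerDifferential.D k R a) := rfl
  have hm (a : R) (ha : a ∈ maximalIdeal R) : D a = 0 := by
    rw [← ht] at ha
    induction ha using Submodule.span_induction with
    | zero => simp
    | add x y _ _ hx hy => rw [map_add, hx, hy, add_zero]
    | mem x hx =>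
      obtain ⟨i, rfl⟩ := hx
      exact (Submodule.Quotient.mk_eq_zero S).2
        (le_sup_left (a := N) (Submodule.subset_span ⟨i, rfl⟩))
    | smul a x hx hx0 =>
      rw [smul_eq_mul, Derivation.leibniz, hx0, smul_zero, zero_add, hDapp, ← map_smul]
      refine (Submodule.Quotient.mk_eq_zero S).2 (le_sup_right (a := N) ?_)
      exact Submodule.smul_mem_smul (ht ▸ hx) trivial
  have hD (a : R) : D a = 0 := by
    have hintegral : IsIntegral k (residue R a) := (Algebra.IsAlgebraic.isAlgebraic _).isIntegral
    have hsep : (minpoly k (residue R a)).Separable :=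
      (minpoly.irreducible hintegral).separable
    have h0 (f : Polynomial k) : residue R (Polynomial.aeval a f) =
        Polynomial.aeval (residue R a) f :=
      (Polynomial.aeval_algHom_apply (IsScalarTower.toAlgHom k R (ResidueField R)) a f).symm
    -- With f the minimal polynomial of the residue of a, f(a) lies in 𝔪, so 0 = D(f(a)) = f'(a) D
    -- a; separability makes f'(a) a unit.
    have h1 := D.map_aeval (minpoly k (residue R a)) a
    rw [hm _ (by rw [← residue_eq_zero_iff, h0, minpoly.aeval])] at h1
    have h2 : IsUnit (Polynomial.aeval a (Polynomial.derivative (minpoly k (residue R a)))) := by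
      rw [← residue_ne_zero_iff_isUnit, h0]
      exact hsep.aeval_derivative_ne_zero (minpoly.aeval _ _)
    exact (h2.smul_eq_zero).1 h1.symm
  have hS : (⊤ : Submodule R (Ω[R⁄k])) ≤ S := by
    rw [← KaehlerDifferential.span_range_derivation, Submodule.span_le]
    rintro _ ⟨a, rfl⟩
    exact (Submodule.Quotient.mk_eq_zero S).1 (hD a)
  refine eq_top_iff.2 (Submodule.le_of_le_smul_of_le_jacobson_bot
    (Module.finite_def.1 inferInstance) ?_ hS)
  rw [jacobson_eq_maximalIdeal _ bot_ne_top]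

theorem isAlgebraic_residueField (k : Type*) {A : Type*} (R : Type*) [Field k] [CommRing A]
    [Algebra k A] [Algebra.FiniteType k A] (p : Ideal A) [p.IsMaximal] [CommRing R] [Algebra A R]
    [IsLocalization.AtPrime R p] [IsLocalRing R] [Algebra k R] [IsScalarTower k A R] :
    Algebra.IsAlgebraic k (ResidueField R) := by
  let f : A →ₐ[k] ResidueField R := (IsScalarTower.toAlgHom k R (ResidueField R)).comp
    (IsScalarTower.toAlgHom k A R)
  have hf : Function.Surjective f := by
    intro x
    obtain ⟨y, hy⟩ := (IsLocalization.AtPrime.equivQuotMaximalIdeal p R).surjective x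
    obtain ⟨a, rfl⟩ := Ideal.Quotient.mk_surjective y
    exact ⟨a, hy⟩
  have : Algebra.FiniteType k (ResidueField R) := Algebra.FiniteType.of_surjective f hf
  have : Module.Finite k (ResidueField R) := finite_of_finite_type_of_isJacobsonRing k _
  infer_instance

/-- The local ring of a regular closed point of a variety over a field of characteristic zero has
local coordinates which generate the maximal ideal. -/
theorem exists_localCoordinates (k : Type*) {A : Type*} (R K : Type*) [Field k] [CharZero k]
    [CommRing A] [IsDomain A] [Algebra k A] [Algebra.FiniteType k A] (p : Ideal A) [p.IsMaximal]
    [CommRing R] [Algebra A R] [IsLocalization.AtPrime R p] [IsRegularLocalRing R] [Algebra k R]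
    [IsScalarTower k A R] [Field K] [Algebra k K] [Algebra R K] [IsScalarTower k R K]
    [IsFractionRing R K] [Algebra A K] [IsScalarTower k A K] [IsFractionRing A K] :
    ∃ (d : ℕ) (c : LocalCoordinates k R K d),
      Ideal.span (Set.range c.coord) = maximalIdeal R := by
  have := isAlgebraic_residueField k R p
  have : IsDomain R := (IsFractionRing.injective R K).isDomain
  have : Algebra.EssFiniteType A R := Algebra.EssFiniteType.of_isLocalization R p.primeCompl
  have : Algebra.EssFiniteType k R := Algebra.EssFiniteType.comp k A R
  have hfg : (maximalIdeal R).FG := (isNoetherianRing_iff_ideal_fg R).1 inferInstance _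
  obtain ⟨S, hS, hSp⟩ := Submodule.FG.exists_span_set_encard_eq_spanFinrank hfg
  set d := (maximalIdeal R).spanFinrank with hd
  have hSfin : S.Finite := Set.finite_of_encard_eq_coe hS
  have : Finite S := hSfin
  have hcard : Nat.card S = d := by
    rw [Nat.card_coe_set_eq, Set.ncard_def, hS]; rfl
  let e : Fin d ≃ S := (Finite.equivFinOfCardEq hcard).symm
  let t : Fin d → R := fun i => e i
  have hrange : Set.range t = S := by
    change Set.range (Subtype.val ∘ e) = S
    rw [Set.range_comp, e.surjective.range_eq, Set.image_univ, Subtype.range_coe]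
  have ht : Ideal.span (Set.range t) = maximalIdeal R := by rw [hrange]; exact hSp
  have hspan := span_D_eq_top_of_span_eq_maximalIdeal (k := k) t ht
  have hexists (a : R) : ∃ x : Fin d → R,
      KaehlerDifferential.D k R a = ∑ i, x i • KaehlerDifferential.D k R (t i) := by
    have h : KaehlerDifferential.D k R a ∈
        Submodule.span R (Set.range fun i => KaehlerDifferential.D k R (t i)) := by
      rw [hspan]; trivial
    obtain ⟨x, hx⟩ := (Submodule.mem_span_range_iff_exists_fun R).1 h
    exact ⟨x, hx.symm⟩
  choose x hx using hexists
  have hxK (a : R) : KaehlerDifferential.D k K (algebraMap R K a) =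
      ∑ i, algebraMap R K (x a i) • KaehlerDifferential.D k K (algebraMap R K (t i)) := by
    have := congrArg (KaehlerDifferential.map k k R K) (hx a)
    simpa [KaehlerDifferential.map_D] using this
  have hspanK : Submodule.span K
      (Set.range fun i => KaehlerDifferential.D k K (algebraMap R K (t i))) = ⊤ := by
    rw [eq_top_iff, ← KaehlerDifferential.span_range_map_derivation_of_isLocalization k R K
      (nonZeroDivisors R), Submodule.span_le]
    rintro _ ⟨a, rfl⟩
    rw [Function.comp_apply, KaehlerDifferential.map_D, hxK]
    exact Submodule.sum_mem _ fun i _ => Submodule.smul_mem _ _ (Submodule.subset_span ⟨i, rfl⟩)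
  -- By regularity d = dim R, the height of p, which is at most dim A and so at most dim Ω_K. The d
  -- differentials dt_i span Ω_K, so they are a basis.
  have hdim : d ≤ Module.finrank K (Ω[K⁄k]) := by
    have h1 := IsRegularLocalRing.spanFinrank_maximalIdeal (R := R)
    rw [IsLocalization.AtPrime.ringKrullDim_eq_height p R] at h1
    have h2 := (Ideal.height_le_ringKrullDim_of_isPrime (I := p)).trans
      (ringKrullDim_le_finrank_kaehlerDifferential k A K)
    rw [← h1] at h2
    exact_mod_cast h2
  have hdim' : Fintype.card (Fin d) = Module.finrank K (Ω[K⁄k]) :=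
    le_antisymm (by simpa using hdim) (finrank_le_of_span_eq_top hspanK)
  let b := basisOfTopLeSpanOfCardEqFinrank _ hspanK.ge hdim'
  have hb (i) : b i = KaehlerDifferential.D k K (algebraMap R K (t i)) := by
    simp [b]
  let der (i : Fin d) : Derivation k K K := (b.coord i).compDer (KaehlerDifferential.D k K)
  -- The dual derivations preserve R because da has an expansion in the dt_i with coefficients
  -- already in R.
  have hder (i a) : der i (algebraMap R K a) = algebraMap R K (x a i) := by
    change b.coord i (KaehlerDifferential.D k K (algebraMap R K a)) = _
    rw [hxK]
    simp_rw [← hb]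
    simp [Finsupp.single_apply, Algebra.smul_def]
  have hinj := IsFractionRing.injective R K
  let derR (i : Fin d) : Derivation k R R := Derivation.mk'
    { toFun := fun a => x a i
      map_add' := fun a a' => hinj (by rw [map_add, ← hder, ← hder, ← hder, map_add, map_add])
      map_smul' := fun s a => hinj (by
        have h (b : R) : algebraMap R K (s • b) = s • algebraMap R K b := by
          rw [Algebra.smul_def, map_mul, ← IsScalarTower.algebraMap_apply, ← Algebra.smul_def]
        rw [RingHom.id_apply, ← hder, h, h, Derivation.map_smul, hder]) }
    fun a a' => hinj (by
      simp only [LinearMap.coe_mk, AddHom.coe_mk]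
      simp only [smul_eq_mul, map_add, map_mul, ← hder, Derivation.leibniz])
  refine ⟨d, ⟨t, der, derR, hder, fun i j => hinj ?_, hspan⟩, ht⟩
  refine (hder i (t j)).symm.trans ?_
  change b.coord i (KaehlerDifferential.D k K (algebraMap R K (t j))) = _
  rw [← hb, Module.Basis.coord_apply, Module.Basis.repr_self, Finsupp.single_apply]
  simp only [eq_comm (a := j)]
  split_ifs <;> simp

end Regular

/-! ### Sections and stalks inside the generic stalk -/

section Generic

theorem genericPoint_mem {X : Scheme.{u}} [IsIntegral X] {U : X.Opens} {x : X} (hx : x ∈ U) :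
    genericPoint X ∈ U :=
  ((genericPoint_spec X).mem_open_set_iff U.isOpen).2 ⟨x, trivial, hx⟩

theorem specializes_genericPoint {X : Scheme.{u}} [IsIntegral X] (x : X) : genericPoint X ⤳ x :=
  (genericPoint_spec X).specializes trivial

theorem res_smul {X : Scheme.{u}} (M : X.Modules) {U W : X.Opens} (h : W ≤ U) (f : Γ(X, U))
    (s : Γ(M, U)) : M.presheaf.map (homOfLE h).op (f • s) =
      X.presheaf.map (homOfLE h).op f • M.presheaf.map (homOfLE h).op s :=
  M.map_smul (homOfLE h) f s

theorem res_res {X : Scheme.{u}} (M : X.Modules) {U V W : X.Opens} (h : V ≤ U) (h' : W ≤ V)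
    (s : Γ(M, U)) : M.presheaf.map (homOfLE h').op (M.presheaf.map (homOfLE h).op s) =
      M.presheaf.map (homOfLE (h'.trans h)).op s := by
  rw [← ConcreteCategory.comp_apply, ← Functor.map_comp]
  rfl

/-- Sections of `M` over `U` which are a basis of `M` over every open subset of `U`. -/
def IsFrame {X : Scheme.{u}} (M : X.Modules) (U : X.Opens) {r : ℕ} (e : Fin r → Γ(M, U)) : Prop :=
  ∀ (W : X.Opens) (h : W ≤ U) (s : Γ(M, W)), ∃! c : Fin r → Γ(X, W),
    s = ∑ i, c i • M.presheaf.map (homOfLE h).op (e i)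

theorem IsFrame.restrict {X : Scheme.{u}} {M : X.Modules} {U : X.Opens} {r : ℕ}
    {e : Fin r → Γ(M, U)} (he : IsFrame M U e) {U' : X.Opens} (h : U' ≤ U) :
    IsFrame M U' fun i => M.presheaf.map (homOfLE h).op (e i) := by
  intro W hW s
  simp_rw [res_res]
  exact he W (hW.trans h) s

theorem exists_frame {X : Scheme.{u}} {M : X.Modules} (hM : M.IsLocallyFreeOfFiniteRank) {x : X}
    {O : X.Opens} (hx : x ∈ O) :
    ∃ U : X.Opens, x ∈ U ∧ U ≤ O ∧ IsAffineOpen U ∧ ∃ (r : ℕ) (e : Fin r → Γ(M, U)),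
      IsFrame M U e := by
  obtain ⟨U₀, hx₀, r, e, he⟩ := hM x
  obtain ⟨_, ⟨U, hU, rfl⟩, hxU, hUO⟩ := X.isBasis_affineOpens.exists_subset_of_mem_open
    (show x ∈ U₀ ⊓ O from ⟨hx₀, hx⟩) (U₀ ⊓ O).isOpen
  exact ⟨U, hxU, fun y hy => (hUO hy).2, hU, r, _, IsFrame.restrict (M := M) he
    (U' := U) fun y hy => (hUO hy).1⟩

variable (k : Type u) [Field k] {X : Scheme.{u}} [X.Over (Spec (.of k))] (M : X.Modules)

theorem germ_eq_iff {U W : X.Opens} {x : X} (hU : x ∈ U) (hW : x ∈ W) (s : Γ(M, U)) (t : Γ(M, W)) :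
    germ k M hU s = germ k M hW t ↔ ∃ (O : X.Opens) (_ : x ∈ O) (h : O ≤ U) (h' : O ≤ W),
      M.presheaf.map (homOfLE h).op s = M.presheaf.map (homOfLE h').op t := by
  constructor
  · intro h
    obtain ⟨O, hO, i, j, e⟩ := M.presheaf.germ_eq x hU hW s t h
    exact ⟨O, hO, i.le, j.le, e⟩
  · rintro ⟨O, hO, h, h', e⟩
    have h1 := germ_res k M h hO s
    have h2 := germ_res k M h' hO t
    rw [← h1, ← h2]
    exact congrArg _ e

theorem germ_smul {U : X.Opens} {x : X} (hU : x ∈ U) (f : Γ(X, U)) (s : Γ(M, U)) :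
    germ k M hU (f • s) = X.presheaf.germ U x hU f • germ k M hU s :=
  PresheafOfModules.germ_smul (R := X.presheaf) M.val x U hU f s

theorem exists_germ_eq (x : X) (m : M.presheaf.stalk x) :
    ∃ (U : X.Opens) (hU : x ∈ U) (s : Γ(M, U)), germ k M hU s = m := by
  obtain ⟨U, hU, s, hs⟩ := M.presheaf.exists_germ_eq m
  exact ⟨U, hU, s, hs⟩

theorem exists_germ_eq_of_stalk {X : Scheme.{u}} (x : X) (a : X.presheaf.stalk x) :
    ∃ (U : X.Opens) (hU : x ∈ U) (f : Γ(X, U)), X.presheaf.germ U x hU f = a := by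
  obtain ⟨U, hU, f, hf⟩ := X.presheaf.exists_germ_eq a
  exact ⟨U, hU, f, hf⟩

theorem exists_eq_sum_germ {U : X.Opens} {r : ℕ} {e : Fin r → Γ(M, U)} (he : IsFrame M U e)
    {x : X} (hx : x ∈ U) (m : M.presheaf.stalk x) :
    ∃ c : Fin r → X.presheaf.stalk x, m = ∑ i, c i • germ k M hx (e i) := by
  obtain ⟨W, hW, s, rfl⟩ := exists_germ_eq k M _ m
  have hO : x ∈ W ⊓ U := ⟨hW, hx⟩
  obtain ⟨c, hc, -⟩ := he (W ⊓ U) inf_le_right (res k M inf_le_left s)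
  refine ⟨fun i => X.presheaf.germ _ x hO (c i), ?_⟩
  rw [← germ_res k M inf_le_left hO s, hc, map_sum]
  refine Finset.sum_congr rfl fun i _ => ?_
  rw [germ_smul]
  exact congrArg _ (germ_res k M inf_le_right hO (e i))

variable [IsIntegral X]

/-- The stalk of `M` at the generic point. -/
abbrev genericStalk : Type u := M.presheaf.stalk (genericPoint X)

instance isScalarTowerFunctionField (x : X) :
    IsScalarTower k (X.presheaf.stalk x) X.functionField := by
  refine IsScalarTower.of_algebraMap_eq fun c => ?_
  rw [← baseHom_germ k (U := ⊤) (x := x) trivial c, ← baseHom_germ k (U := ⊤)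
    (x := genericPoint X) trivial c]
  exact (TopCat.Presheaf.germ_stalkSpecializes_apply X.presheaf (U := ⊤) (y := x) trivial
    (specializes_genericPoint x) (baseHom k X ⊤ c)).symm

theorem algebraMap_germ {U : X.Opens} {x : X} (hx : x ∈ U) (f : Γ(X, U)) :
    algebraMap (X.presheaf.stalk x) X.functionField (X.presheaf.germ U x hx f) =
      X.presheaf.germ U (genericPoint X) (genericPoint_mem hx) f :=
  TopCat.Presheaf.germ_stalkSpecializes_apply X.presheaf hx (specializes_genericPoint x) f

/-- The map from a stalk to the generic stalk. -/
def toGeneric (x : X) : M.presheaf.stalk x →ₗ[k] genericStalk M where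
  toFun := M.presheaf.stalkSpecializes (specializes_genericPoint x)
  map_add' a b := map_add _ a b
  map_smul' c m := by
    obtain ⟨U, hU, s, rfl⟩ := exists_germ_eq k M x m
    rw [← map_smul]
    change M.presheaf.stalkSpecializes (specializes_genericPoint x) (M.presheaf.germ U x hU (c • s))
      = c • M.presheaf.stalkSpecializes (specializes_genericPoint x) (M.presheaf.germ U x hU s)
    rw [TopCat.Presheaf.germ_stalkSpecializes_apply, TopCat.Presheaf.germ_stalkSpecializes_apply]
    exact (germ k M (genericPoint_mem hU)).map_smul c s

theorem toGeneric_germ {U : X.Opens} {x : X} (hx : x ∈ U) (s : Γ(M, U)) :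
    toGeneric k M x (germ k M hx s) = germ k M (genericPoint_mem hx) s :=
  TopCat.Presheaf.germ_stalkSpecializes_apply M.presheaf hx (specializes_genericPoint x) s

theorem toGeneric_smul (x : X) (a : X.presheaf.stalk x) (m : M.presheaf.stalk x) :
    toGeneric k M x (a • m) = algebraMap (X.presheaf.stalk x) X.functionField a •
      toGeneric k M x m := by
  obtain ⟨U, hU, s, rfl⟩ := exists_germ_eq k M x m
  obtain ⟨W, hW, f, rfl⟩ := exists_germ_eq_of_stalk x a
  have hO : x ∈ U ⊓ W := ⟨hU, hW⟩
  have h1 : germ k M hU s = germ k M hO (res k M inf_le_left s) :=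
    (germ_res k M inf_le_left _ s).symm
  have h2 : X.presheaf.germ W x hW f = X.presheaf.germ (U ⊓ W) x hO
      (X.presheaf.map (homOfLE inf_le_right).op f) :=
    (TopCat.Presheaf.germ_res_apply X.presheaf (homOfLE inf_le_right) x hO f).symm
  rw [h1, h2, ← germ_smul, toGeneric_germ, toGeneric_germ, germ_smul, algebraMap_germ]

/-- In a frame this reduces to functions, which on an integral scheme are determined by their
restriction to a nonempty open set. -/
theorem germ_injective_of_isFrame {U : X.Opens} {r : ℕ} {e : Fin r → Γ(M, U)} (he : IsFrame M U e)
    {W : X.Opens} (h : W ≤ U) (hW : genericPoint X ∈ W) (s : Γ(M, W)) (hs : germ k M hW s = 0) :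
    s = 0 := by
  obtain ⟨c, hc, -⟩ := he W h s
  obtain ⟨O, hO, hOW, _, e0⟩ := (germ_eq_iff k M hW hW s 0).1 (hs.trans (map_zero _).symm)
  rw [map_zero, hc, map_sum] at e0
  simp_rw [res_smul, res_res] at e0
  have hc0 : (fun i => X.presheaf.map (homOfLE hOW).op (c i)) = 0 :=
    (he O (hOW.trans h) 0).unique e0.symm (by simp)
  have : Nonempty O := ⟨⟨_, hO⟩⟩
  have hc' : ∀ i, c i = 0 := fun i =>
    map_injective_of_isIntegral X (homOfLE hOW) ((congrFun hc0 i).trans (map_zero _).symm)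
  rw [hc]
  simp [hc']

variable {M} (hM : M.IsLocallyFreeOfFiniteRank)

include hM

theorem germ_generic_injective {W : X.Opens} (hW : genericPoint X ∈ W) :
    Function.Injective (germ k M hW) := by
  rw [injective_iff_map_eq_zero]
  intro s hs
  refine TopCat.Presheaf.section_ext ⟨M.presheaf, M.isSheaf⟩ W s 0 fun x hx => ?_
  obtain ⟨U, hxU, hUW, -, r, e, he⟩ := exists_frame hM hx
  have h1 : res k M hUW s = 0 := germ_injective_of_isFrame k M he le_rfl (genericPoint_mem hxU) _
    (by rw [germ_res, hs])
  have h2 := germ_res k M hUW hxU s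
  rw [h1, map_zero] at h2
  exact h2.symm.trans (map_zero (germ k M hx)).symm

theorem toGeneric_injective (x : X) : Function.Injective (toGeneric k M x) := by
  rw [injective_iff_map_eq_zero]
  intro m hm
  obtain ⟨U, hU, s, rfl⟩ := exists_germ_eq k M x m
  rw [toGeneric_germ] at hm
  rw [germ_generic_injective k hM _ (hm.trans (map_zero _).symm), map_zero]

/-- An element of the generic stalk which lies in all stalks at points of `W` is a section. -/
theorem exists_section {W : X.Opens} (hW : genericPoint X ∈ W) (m : genericStalk M)
    (hm : ∀ x ∈ W, m ∈ LinearMap.range (toGeneric k M x)) : ∃ s : Γ(M, W), germ k M hW s = m := by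
  have h (x : W) : ∃ (U : X.Opens) (hU : x.1 ∈ U) (hUW : U ≤ W) (s : Γ(M, U)),
      germ k M (genericPoint_mem hU) s = m := by
    obtain ⟨y, hy⟩ := hm x.1 x.2
    obtain ⟨U, hU, s, rfl⟩ := exists_germ_eq k M x.1 y
    refine ⟨U ⊓ W, ⟨hU, x.2⟩, inf_le_right, res k M inf_le_left s, ?_⟩
    rw [germ_res, ← toGeneric_germ k M hU, hy]
  choose U hU hUW s hs using h
  -- The local sections agree on overlaps because all of them have the same germ `m` at the generic
  -- point.
  obtain ⟨t, ht, -⟩ := TopCat.Sheaf.existsUnique_gluing' ⟨M.presheaf, M.isSheaf⟩ U W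
    (fun x => homOfLE (hUW x)) (fun x hx => Opens.mem_iSup.2 ⟨⟨x, hx⟩, hU ⟨x, hx⟩⟩) s (by
      intro x y
      have hη : genericPoint X ∈ U x ⊓ U y :=
        ⟨genericPoint_mem (hU x), genericPoint_mem (hU y)⟩
      refine germ_generic_injective k hM hη ?_
      refine (germ_res k M inf_le_left hη (s x)).trans ?_
      refine Eq.trans ?_ (germ_res k M inf_le_right hη (s y)).symm
      rw [hs, hs])
  let x : W := ⟨_, hW⟩
  refine ⟨t, ?_⟩
  rw [← hs x, ← germ_res k M (hUW x) (hU x) t]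
  exact congrArg _ (ht x)

/-- The basis of the generic stalk defined by a frame. -/
theorem exists_basis_of_isFrame {U : X.Opens} (hU : genericPoint X ∈ U) {r : ℕ}
    {e : Fin r → Γ(M, U)} (he : IsFrame M U e) :
    ∃ b : Module.Basis (Fin r) X.functionField (genericStalk M),
      ∀ i, b i = germ k M hU (e i) := by
  have hli : LinearIndependent X.functionField fun i => germ k M hU (e i) := by
    rw [Fintype.linearIndependent_iff]
    intro a ha
    have h (i : Fin r) : ∃ (W : X.Opens) (hW : genericPoint X ∈ W) (f : Γ(X, W)),
        X.presheaf.germ W _ hW f = a i := exists_germ_eq_of_stalk _ (a i)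
    choose W hW f hf using h
    let O : X.Opens := U ⊓ Finset.univ.inf W
    have hO : genericPoint X ∈ O := ⟨hU, by
      change genericPoint X ∈ (↑(Finset.univ.inf W) : Set X)
      rw [Opens.coe_finset_inf]
      simpa using hW⟩
    have hOU : O ≤ U := inf_le_left
    have hOW (i) : O ≤ W i := inf_le_right.trans (Finset.inf_le (Finset.mem_univ i))
    let g (i : Fin r) : Γ(X, O) := X.presheaf.map (homOfLE (hOW i)).op (f i)
    have hg (i) : X.presheaf.germ O _ hO (g i) = a i :=
      (TopCat.Presheaf.germ_res_apply X.presheaf (homOfLE (hOW i)) _ hO (f i)).trans (hf i)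
    have h0 : ∑ i, g i • M.presheaf.map (homOfLE hOU).op (e i) = 0 := by
      refine germ_generic_injective k hM hO ?_
      rw [map_zero, map_sum, ← ha]
      refine Finset.sum_congr rfl fun i _ => ?_
      rw [germ_smul, hg]
      exact congrArg _ (germ_res k M hOU hO (e i))
    have hg0 : g = 0 := (he O hOU 0).unique h0.symm (by simp)
    intro i
    rw [← hg, hg0, Pi.zero_apply, map_zero]
  refine ⟨Module.Basis.mk hli ?_, fun i => Module.Basis.mk_apply _ _ i⟩
  rintro m -
  obtain ⟨W, hW, s, rfl⟩ := exists_germ_eq k M _ m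
  have hO : genericPoint X ∈ W ⊓ U := ⟨hW, hU⟩
  obtain ⟨c, hc, -⟩ := he (W ⊓ U) inf_le_right (res k M inf_le_left s)
  rw [← germ_res k M inf_le_left hO s, hc, map_sum]
  refine Submodule.sum_mem _ fun i _ => ?_
  rw [germ_smul]
  refine Submodule.smul_mem _ _ (Submodule.subset_span ⟨i, ?_⟩)
  exact (germ_res k M inf_le_right hO (e i)).symm

/-! ### Differential operators on the generic stalk -/

/-- A differential operator on the generic stalk which preserves the stalks at the points of `U`
defines a differential operator on `U`. -/
theorem exists_sheafDiffOp {U : X.Opens} {n : ℕ} (Q : genericStalk M →ₗ[k] genericStalk M)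
    (hQ : IsDO X.functionField (n + 1) Q)
    (h : ∀ x ∈ U, ∀ m, Q (toGeneric k M x m) ∈ LinearMap.range (toGeneric k M x)) :
    ∃ P : sheafEnd k M U, P ∈ sheafDiffOp k M U n ∧
      ∀ (W : {W : X.Opens // W ≤ U}) (hW : genericPoint X ∈ W.1) (s : Γ(M, W.1)),
        germ k M hW (P.1 W s) = Q (germ k M hW s) := by
  classical
  -- An open set which misses the generic point is empty and has only one section, so the value 0
  -- there is immaterial.
  have hex (W : {W : X.Opens // W ≤ U}) (s : Γ(M, W.1)) : ∃ t : Γ(M, W.1),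
      ∀ hW : genericPoint X ∈ W.1, germ k M hW t = Q (germ k M hW s) := by
    by_cases hW : genericPoint X ∈ W.1
    · obtain ⟨t, ht⟩ := exists_section k hM hW (Q (germ k M hW s)) fun x hx => by
        rw [← toGeneric_germ k M hx]
        exact h x (W.2 hx) _
      exact ⟨t, fun _ => ht⟩
    · exact ⟨0, fun h => absurd h hW⟩
  choose T hT using hex
  have hsub (W : X.Opens) (hW : genericPoint X ∉ W) (s t : Γ(M, W)) : s = t :=
    TopCat.Presheaf.section_ext ⟨M.presheaf, M.isSheaf⟩ W s t fun x hx =>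
      absurd (genericPoint_mem hx) hW
  let P (W : {W : X.Opens // W ≤ U}) : Module.End k Γ(M, W.1) :=
    { toFun := T W
      map_add' := fun s t => by
        by_cases hW : genericPoint X ∈ W.1
        · exact germ_generic_injective k hM hW (by simp [hT])
        · exact hsub _ hW _ _
      map_smul' := fun c s => by
        by_cases hW : genericPoint X ∈ W.1
        · exact germ_generic_injective k hM hW (by simp [hT])
        · exact hsub _ hW _ _ }
  have hP (W) (hW : genericPoint X ∈ W.1) (s) : germ k M hW (P W s) = Q (germ k M hW s) :=
    hT W s hW
  refine ⟨⟨P, fun W W' hWW' s => ?_⟩, fun W _ => ?_, hP⟩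
  · by_cases hW : genericPoint X ∈ W'.1
    · refine germ_generic_injective k hM hW ?_
      rw [hP, germ_res, germ_res, hP]
    · exact hsub _ hW _ _
  · change P W ∈ _
    rw [mem_diffOp_iff]
    by_cases hW : genericPoint X ∈ W.1
    · exact IsDO.of_injective (A := Γ(X, W.1)) (B := X.functionField)
        (fun f => X.presheaf.germ W.1 _ hW f) (germ k M hW)
        (germ k M hW).toAddMonoidHom (germ_generic_injective k hM hW)
        (fun f s => germ_smul k M hW f s) (fun f s => germ_smul k M hW f s) hQ (hP W hW)
    · rw [show P W = 0 from LinearMap.ext fun s => hsub _ hW _ _]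
      exact IsDO.zero _

end Generic

/-! ### Affine open subsets -/

section Affine

variable {X : Scheme.{u}} {U : X.Opens} (hU : IsAffineOpen U)

include hU

theorem mem_basicOpen_iff_notMem {x : X} (hx : x ∈ U) (s : Γ(X, U)) :
    x ∈ X.basicOpen s ↔ s ∉ (hU.primeIdealOf ⟨x, hx⟩).asIdeal := by
  let := X.presheaf.algebra_section_stalk ⟨x, hx⟩
  have := hU.isLocalization_stalk ⟨x, hx⟩
  rw [Scheme.mem_basicOpen X s x hx]
  exact IsLocalization.AtPrime.isUnit_to_map_iff (X.presheaf.stalk x)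
    (hU.primeIdealOf ⟨x, hx⟩).asIdeal s

theorem exists_point_of_isPrime (P : Ideal Γ(X, U)) [hP : P.IsPrime] :
    ∃ (x : X) (hx : x ∈ U), (hU.primeIdealOf ⟨x, hx⟩).asIdeal = P := by
  have hx : hU.fromSpec ⟨P, hP⟩ ∈ U := by
    rw [← SetLike.mem_coe, ← hU.range_fromSpec]
    exact ⟨_, rfl⟩
  refine ⟨hU.fromSpec ⟨P, hP⟩, hx, ?_⟩
  have h := hU.fromSpec_primeIdealOf ⟨_, hx⟩
  have := hU.fromSpec.isOpenEmbedding.injective h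
  exact congrArg PrimeSpectrum.asIdeal this

/-- The radical is the intersection of the primes containing I, and primes are points of U. -/
theorem mem_radical_of_forall {I : Ideal Γ(X, U)} {s : Γ(X, U)}
    (h : ∀ x ∈ X.basicOpen s, ∃ a ∈ I, x ∈ X.basicOpen a) : ∃ n : ℕ, s ^ n ∈ I := by
  change s ∈ I.radical
  rw [Ideal.radical_eq_sInf, Ideal.mem_sInf]
  rintro P ⟨hIP, hP⟩
  by_contra hs
  obtain ⟨x, hx, rfl⟩ := exists_point_of_isPrime hU P
  obtain ⟨a, ha, hxa⟩ := h x ((mem_basicOpen_iff_notMem hU hx s).2 hs)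
  exact (mem_basicOpen_iff_notMem hU hx a).1 hxa (hIP ha)

/-- Only maximal ideals need testing, so the local construction is required only at closed points of
U, where local coordinates exist. -/
theorem eq_top_of_forall_isMaximal {I : Ideal Γ(X, U)}
    (h : ∀ (x : X) (hx : x ∈ U), (hU.primeIdealOf ⟨x, hx⟩).asIdeal.IsMaximal →
      ∃ a ∈ I, x ∈ X.basicOpen a) : I = ⊤ := by
  by_contra hI
  obtain ⟨P, hP, hIP⟩ := Ideal.exists_le_maximal I hI
  have hP' := hP.isPrime
  obtain ⟨x, hx, rfl⟩ := exists_point_of_isPrime hU P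
  obtain ⟨a, ha, hxa⟩ := h x hx hP
  exact (mem_basicOpen_iff_notMem hU hx a).1 hxa (hIP ha)

theorem exists_germ_mul_eq {x : X} (hx : x ∈ U) (a : X.presheaf.stalk x) :
    ∃ s f : Γ(X, U), x ∈ X.basicOpen s ∧
      X.presheaf.germ U x hx s * a = X.presheaf.germ U x hx f := by
  let := X.presheaf.algebra_section_stalk ⟨x, hx⟩
  have := hU.isLocalization_stalk ⟨x, hx⟩
  obtain ⟨⟨f, s⟩, h⟩ := IsLocalization.surj (hU.primeIdealOf ⟨x, hx⟩).asIdeal.primeCompl a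
  exact ⟨s, f, (mem_basicOpen_iff_notMem hU hx _).2 s.2, (mul_comm _ _).trans h⟩

end Affine

/-! ### Denominators of differential operators on the generic stalk -/

section Lattices

variable (k : Type u) [Field k] {X : Scheme.{u}} [X.Over (Spec (.of k))]

theorem finiteType_sections [LocallyOfFiniteType (X ↘ Spec (.of k))] {U : X.Opens}
    (hU : IsAffineOpen U) : Algebra.FiniteType k Γ(X, U) := by
  have h1 := (X ↘ Spec (.of k)).finiteType_appLE (isAffineOpen_top _) hU (V := U) le_top
  have h2 : (baseHom k X U) = ((X ↘ Spec (.of k)).appLE ⊤ U le_top).hom.comp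
      (Scheme.ΓSpecIso (.of k)).inv.hom := by
    rw [← CommRingCat.hom_comp]
    rfl
  have h3 : (baseHom k X U).FiniteType := by
    rw [h2]
    refine h1.comp (RingHom.FiniteType.of_surjective _ ?_)
    exact (Scheme.ΓSpecIso (.of k)).commRingCatIsoToRingEquiv.symm.surjective
  exact h3

variable [IsIntegral X]

/-- The local ring of a point as a subring of the function field. -/
def localRing (x : X) : Subalgebra k X.functionField :=
  (IsScalarTower.toAlgHom k (X.presheaf.stalk x) X.functionField).range

variable {k} in
theorem mem_localRing {x : X} {a : X.functionField} :
    a ∈ localRing k x ↔ ∃ b, algebraMap (X.presheaf.stalk x) X.functionField b = a := Iff.rfl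

/-- The sections over `U` in the function field. -/
def sectionHom {U : X.Opens} (hU : genericPoint X ∈ U) : Γ(X, U) →ₐ[k] X.functionField :=
  { (X.presheaf.germ U _ hU).hom with commutes' := fun c => baseHom_germ k hU c }

variable {k}

theorem sectionHom_injective {U : X.Opens} (hU : genericPoint X ∈ U) :
    Function.Injective (sectionHom k hU) :=
  germ_injective_of_isIntegral X _ hU

theorem sectionHom_res {U W : X.Opens} (h : W ≤ U) (hW : genericPoint X ∈ W) (f : Γ(X, U)) :
    sectionHom k hW (X.presheaf.map (homOfLE h).op f) = sectionHom k (h hW) f :=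
  TopCat.Presheaf.germ_res_apply X.presheaf (homOfLE h) _ hW f

theorem algebraMap_germ' {U : X.Opens} {x : X} (hx : x ∈ U) (f : Γ(X, U)) :
    algebraMap (X.presheaf.stalk x) X.functionField (X.presheaf.germ U x hx f) =
      sectionHom k (genericPoint_mem hx) f :=
  algebraMap_germ hx f

theorem sectionHom_mem_localRing {U : X.Opens} {x : X} (hx : x ∈ U) (hU : genericPoint X ∈ U)
    (f : Γ(X, U)) : sectionHom k hU f ∈ localRing k x :=
  ⟨X.presheaf.germ U x hx f, algebraMap_germ' hx f⟩

theorem inv_sectionHom_mem_localRing {U : X.Opens} {x : X} (hU : genericPoint X ∈ U)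
    {s : Γ(X, U)} (hs : x ∈ X.basicOpen s) :
    sectionHom k hU s ≠ 0 ∧ (sectionHom k hU s)⁻¹ ∈ localRing k x := by
  have hx := X.basicOpen_le s hs
  obtain ⟨t, ht⟩ := isUnit_iff_exists_inv.1 ((Scheme.mem_basicOpen X s x hx).1 hs)
  have h := congrArg (algebraMap (X.presheaf.stalk x) X.functionField) ht
  rw [map_mul, algebraMap_germ' (k := k), map_one] at h
  refine ⟨left_ne_zero_of_mul_eq_one h, t, ?_⟩
  exact eq_inv_of_mul_eq_one_right h

variable {M : X.Modules}

variable (k M) in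
/-- The operator `q` maps the stalk of `M` at `x` to the local ring at `x`. -/
def IsIntegralAt (q : genericStalk M →ₗ[k] X.functionField) (x : X) : Prop :=
  ∀ m, q (toGeneric k M x m) ∈ localRing k x

variable (k) in
/-- The module of sections spanned by a frame, in the generic stalk. -/
def frameSpan {U : X.Opens} (hU : genericPoint X ∈ U) {r : ℕ} (e : Fin r → Γ(M, U)) :
    Submodule (sectionHom k hU).range (genericStalk M) :=
  Submodule.span _ (Set.range fun i => germ k M hU (e i))

theorem frameSpan_le {U : X.Opens} (hU : genericPoint X ∈ U) {r : ℕ} (e : Fin r → Γ(M, U))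
    {m : genericStalk M} (hm : m ∈ frameSpan k hU e) : ∃ s : Γ(M, U), germ k M hU s = m := by
  induction hm using Submodule.span_induction with
  | mem x hx => obtain ⟨i, rfl⟩ := hx; exact ⟨e i, rfl⟩
  | zero => exact ⟨0, map_zero _⟩
  | add x y _ _ hx hy =>
    obtain ⟨s, rfl⟩ := hx
    obtain ⟨t, rfl⟩ := hy
    exact ⟨s + t, map_add _ _ _⟩
  | smul a x _ hx =>
    obtain ⟨s, rfl⟩ := hx
    obtain ⟨_, f, rfl⟩ := a
    exact ⟨f • s, germ_smul k M hU f s⟩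

/-- Common denominators for finitely many germs of functions. -/
theorem exists_common_denominator {U : X.Opens} (hU : IsAffineOpen U) {x : X} (hx : x ∈ U)
    {ι : Type*} (t : Finset ι) (a : ι → X.functionField) (ha : ∀ i ∈ t, a i ∈ localRing k x) :
    ∃ s : Γ(X, U), x ∈ X.basicOpen s ∧ ∀ i ∈ t,
      sectionHom k (genericPoint_mem hx) s * a i ∈ (sectionHom k (genericPoint_mem hx)).range := by
  classical
  induction t using Finset.induction_on with
  | empty => exact ⟨1, by simpa using hx, by simp⟩
  | insert i t hi ih =>
    obtain ⟨s, hs, hs'⟩ := ih fun j hj => ha j (by simp [hj])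
    obtain ⟨b, hb⟩ := mem_localRing.1 (ha i (by simp))
    obtain ⟨s₁, f, hs₁, hf⟩ := exists_germ_mul_eq hU hx b
    have hf' := congrArg (algebraMap (X.presheaf.stalk x) X.functionField) hf
    rw [map_mul, algebraMap_germ' (k := k), algebraMap_germ' (k := k), hb] at hf'
    refine ⟨s * s₁, ?_, fun j hj => ?_⟩
    · rw [Scheme.basicOpen_mul]
      exact ⟨hs, hs₁⟩
    · rcases Finset.mem_insert.1 hj with rfl | hj
      · rw [map_mul, mul_assoc, hf', ← map_mul]
        exact ⟨_, rfl⟩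
      · obtain ⟨g, hg⟩ := hs' j hj
        rw [map_mul, mul_right_comm, ← hg]
        exact ⟨g * s₁, map_mul _ _ _⟩

/-- The stalk at x is a localization of the lattice spanned by the frame: clear the denominators of
the coordinates of m. -/
theorem exists_toGeneric_eq_smul {U : X.Opens} (hU : IsAffineOpen U) {r : ℕ} {e : Fin r → Γ(M, U)}
    (he : IsFrame M U e) {x : X} (hx : x ∈ U) (m : M.presheaf.stalk x) :
    ∃ s : Γ(X, U), x ∈ X.basicOpen s ∧ ∃ w ∈ frameSpan k (genericPoint_mem hx) e,
      toGeneric k M x m = (sectionHom k (genericPoint_mem hx) s)⁻¹ • w := by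
  obtain ⟨c, hc⟩ := exists_eq_sum_germ k M he hx m
  obtain ⟨s, hs, hs'⟩ := exists_common_denominator (k := k) hU hx Finset.univ
    (fun i => algebraMap _ X.functionField (c i)) fun i _ => ⟨c i, rfl⟩
  refine ⟨s, hs, sectionHom k (genericPoint_mem hx) s • toGeneric k M x m, ?_, ?_⟩
  · rw [hc, map_sum, Finset.smul_sum]
    refine Submodule.sum_mem _ fun i _ => ?_
    rw [toGeneric_smul, smul_smul, toGeneric_germ]
    exact Submodule.smul_mem _ (⟨_, hs' i (Finset.mem_univ i)⟩ :
      (sectionHom k (genericPoint_mem hx)).range) (Submodule.subset_span ⟨i, rfl⟩)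
  · rw [inv_smul_smul₀ (inv_sectionHom_mem_localRing _ hs).1]

/-- An operator which maps a frame lattice into the local ring is integral at the point. -/
theorem isIntegralAt_of_frameSpan {U : X.Opens} (hU : IsAffineOpen U) {r : ℕ}
    {e : Fin r → Γ(M, U)} (he : IsFrame M U e) {x : X} (hx : x ∈ U) {n : ℕ}
    {q : genericStalk M →ₗ[k] X.functionField} (hq : IsDO X.functionField n q)
    (h : ∀ w ∈ frameSpan k (genericPoint_mem hx) e, q w ∈ localRing k x) :
    IsIntegralAt k M q x := by
  intro m
  obtain ⟨s, hs, w, hw, hm⟩ := exists_toGeneric_eq_smul (k := k) hU he hx m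
  obtain ⟨h0, hinv⟩ := inv_sectionHom_mem_localRing (k := k) (genericPoint_mem hx) hs
  rw [hm]
  refine hq.mem_of_inv (L := Subalgebra.toSubmodule (localRing k x)) h0
    (fun a ha => (localRing k x).mul_mem (sectionHom_mem_localRing hx _ s) ha)
    (fun a ha => (localRing k x).mul_mem hinv ha)
    (S := frameSpan k (genericPoint_mem hx) e) (fun m hm => ?_) h w hw
  exact Submodule.smul_mem _ (⟨_, s, rfl⟩ : (sectionHom k (genericPoint_mem hx)).range) hm

theorem frameSpan_integral {U : X.Opens} {r : ℕ} {e : Fin r → Γ(M, U)} {x : X} (hx : x ∈ U)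
    {q : genericStalk M →ₗ[k] X.functionField} (h : IsIntegralAt k M q x) :
    ∀ w ∈ frameSpan k (genericPoint_mem hx) e, q w ∈ localRing k x := by
  intro w hw
  obtain ⟨s, rfl⟩ := frameSpan_le _ e hw
  rw [← toGeneric_germ k M hx]
  exact h _

variable (k) in
theorem frameSpan_fg {U : X.Opens} (hU : genericPoint X ∈ U) {r : ℕ} (e : Fin r → Γ(M, U)) :
    (frameSpan k hU e).FG :=
  Submodule.fg_span (Set.finite_range _)

variable [LocallyOfFiniteType (X ↘ Spec (.of k))]

theorem fg_sectionHom_range {U : X.Opens} (hU : IsAffineOpen U) (hη : genericPoint X ∈ U) :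
    (sectionHom k hη).range.FG := by
  have := finiteType_sections k hU
  rw [← Algebra.map_top]
  exact this.out.map _

/-- A differential operator with values in the local ring at `x` has denominators which do not
vanish at `x`. -/
theorem exists_denominator {U : X.Opens} (hU : IsAffineOpen U) {x : X} (hx : x ∈ U)
    {S : Submodule (sectionHom k (genericPoint_mem hx)).range (genericStalk M)} (hS : S.FG) {n : ℕ}
    {q : genericStalk M →ₗ[k] X.functionField} (hq : IsDO X.functionField n q)
    (h : ∀ w ∈ S, q w ∈ localRing k x) :
    ∃ s : Γ(X, U), x ∈ X.basicOpen s ∧ ∀ w ∈ S,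
      sectionHom k (genericPoint_mem hx) s * q w ∈
        (sectionHom k (genericPoint_mem hx)).range := by
  -- The image of S spans a finitely generated module, so only finitely many elements of the local
  -- ring need a common denominator.
  obtain ⟨t, ht⟩ := hq.fg_span_image (fg_sectionHom_range hU _) hS
  have hloc : ∀ a ∈ Submodule.span (sectionHom k (genericPoint_mem hx)).range
      (q '' (S : Set (genericStalk M))), a ∈ localRing k x := by
    intro a ha
    induction ha using Submodule.span_induction with
    | mem a ha => obtain ⟨w, hw, rfl⟩ := ha; exact h w hw
    | zero => exact zero_mem _
    | add a b _ _ ha hb => exact add_mem ha hb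
    | smul c a _ ha =>
      obtain ⟨_, f, rfl⟩ := c
      exact (localRing k x).mul_mem (sectionHom_mem_localRing hx _ f) ha
  obtain ⟨s, hs, hs'⟩ := exists_common_denominator (k := k) hU hx t id fun a ha =>
    hloc a (ht ▸ Submodule.subset_span ha)
  refine ⟨s, hs, fun w hw => ?_⟩
  have hw' : q w ∈ Submodule.span (sectionHom k (genericPoint_mem hx)).range
      (t : Set X.functionField) := ht ▸ Submodule.subset_span ⟨w, hw, rfl⟩
  generalize q w = b at hw'
  induction hw' using Submodule.span_induction with
  | mem a ha => exact hs' a ha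
  | zero => rw [mul_zero]; exact zero_mem _
  | add a b _ _ ha hb => rw [mul_add]; exact add_mem ha hb
  | smul c a _ ha =>
    change _ * (c.1 * a) ∈ _
    rw [mul_left_comm]
    exact mul_mem c.2 ha

/-- Integrality of a differential operator is an open condition. -/
theorem exists_isIntegralAt_basicOpen {U : X.Opens} (hU : IsAffineOpen U) {r : ℕ}
    {e : Fin r → Γ(M, U)} (he : IsFrame M U e) {x : X} (hx : x ∈ U) {n : ℕ}
    {q : genericStalk M →ₗ[k] X.functionField} (hq : IsDO X.functionField n q)
    (h : IsIntegralAt k M q x) :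
    ∃ s : Γ(X, U), x ∈ X.basicOpen s ∧ ∀ y ∈ X.basicOpen s, IsIntegralAt k M q y := by
  obtain ⟨s, hs, hs'⟩ := exists_denominator hU hx (frameSpan_fg k _ e) hq
    (frameSpan_integral hx h)
  refine ⟨s, hs, fun y hy => ?_⟩
  refine isIntegralAt_of_frameSpan hU he (X.basicOpen_le s hy) hq fun w hw => ?_
  obtain ⟨h0, hinv⟩ := inv_sectionHom_mem_localRing (k := k)
    (genericPoint_mem (X.basicOpen_le s hy)) hy
  obtain ⟨f, hf⟩ := hs' w hw
  have := (localRing k y).mul_mem hinv (sectionHom_mem_localRing (k := k) (X.basicOpen_le s hy)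
    (genericPoint_mem hx) f)
  have hf' : sectionHom k (genericPoint_mem hx) f = sectionHom k (genericPoint_mem hx) s * q w := hf
  rw [hf', inv_mul_cancel_left₀ h0] at this
  exact this

/-- A differential operator which is integral at the points where `s` does not vanish becomes
integral on an affine open set after multiplication by a power of `s`. -/
theorem exists_pow_isIntegralAt {U : X.Opens} (hU : IsAffineOpen U) (hη : genericPoint X ∈ U)
    {r : ℕ} {e : Fin r → Γ(M, U)} (he : IsFrame M U e) {s : Γ(X, U)} {n : ℕ}
    {q : genericStalk M →ₗ[k] X.functionField} (hq : IsDO X.functionField n q)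
    (h : ∀ y ∈ X.basicOpen s, IsIntegralAt k M q y) :
    ∃ N : ℕ, ∀ N' ≥ N, ∀ y ∈ U, ∀ m,
      sectionHom k hη s ^ N' * q (toGeneric k M y m) ∈ localRing k y := by
  -- The ideal of denominators of q on the frame lattice. Each point where s does not vanish has a
  -- denominator that does not vanish there, so s lies in the radical of I.
  let I : Ideal Γ(X, U) :=
    { carrier := {a | ∀ w ∈ frameSpan k hη e, sectionHom k hη a * q w ∈ (sectionHom k hη).range}
      zero_mem' := fun w _ => by rw [map_zero, zero_mul]; exact zero_mem _
      add_mem' := fun ha hb w hw => by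
        rw [map_add, add_mul]; exact add_mem (ha w hw) (hb w hw)
      smul_mem' := fun c a ha w hw => by
        rw [smul_eq_mul, map_mul, mul_assoc]
        exact mul_mem ⟨c, rfl⟩ (ha w hw) }
  obtain ⟨N, hN⟩ := mem_radical_of_forall hU (I := I) (s := s) fun x hx => by
    obtain ⟨a, ha, ha'⟩ := exists_denominator hU (X.basicOpen_le s hx) (frameSpan_fg k _ e) hq
      (frameSpan_integral (X.basicOpen_le s hx) (h x hx))
    exact ⟨a, ha', ha⟩
  refine ⟨N, fun N' hN' y hy m => ?_⟩
  have hN2 : s ^ N' ∈ I := by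
    rw [← Nat.sub_add_cancel hN', pow_add]
    exact I.mul_mem_left _ hN
  have := isIntegralAt_of_frameSpan hU he hy
    (hq.lsmul_comp (sectionHom k hη (s ^ N'))) (fun w hw => by
      obtain ⟨f, hf⟩ := hN2 w hw
      have hf' : sectionHom k hη f = sectionHom k hη (s ^ N') * q w := hf
      change sectionHom k hη (s ^ N') * q w ∈ _
      rw [← hf']
      exact sectionHom_mem_localRing hy _ f) m
  rw [← map_pow]
  exact this

end Lattices

/-! ### Dual operators at a regular closed point -/

section DualOperators

variable {k : Type u} [Field k] {X : Scheme.{u}} [X.Over (Spec (.of k))] [IsIntegral X]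
  {M : X.Modules}

variable (k) in
theorem exists_localCoordinates_stalk [CharZero k] [LocallyOfFiniteType (X ↘ Spec (.of k))]
    {U : X.Opens} (hU : IsAffineOpen U) {x : X} (hx : x ∈ U)
    (hmax : (hU.primeIdealOf ⟨x, hx⟩).asIdeal.IsMaximal)
    (hreg : IsRegularLocalRing (X.presheaf.stalk x)) :
    ∃ (d : ℕ) (c : LocalCoordinates k (X.presheaf.stalk x) X.functionField d),
      Ideal.span (Set.range c.coord) = IsLocalRing.maximalIdeal (X.presheaf.stalk x) := by
  have : Nonempty U := ⟨⟨x, hx⟩⟩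
  have := finiteType_sections k hU
  let := X.presheaf.algebra_section_stalk ⟨x, hx⟩
  have := hU.isLocalization_stalk ⟨x, hx⟩
  have h1 : IsScalarTower k Γ(X, U) (X.presheaf.stalk x) :=
    IsScalarTower.of_algebraMap_eq fun c => (baseHom_germ k hx c).symm
  have h2 : IsScalarTower k Γ(X, U) X.functionField :=
    IsScalarTower.of_algebraMap_eq fun c => (baseHom_germ k (genericPoint_mem hx) c).symm
  have := functionField_isFractionRing_of_isAffineOpen X U hU
  exact exists_localCoordinates k (X.presheaf.stalk x) X.functionField
    (hU.primeIdealOf ⟨x, hx⟩).asIdeal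

/-- Functionals at a point of finite order, with values in the residue field, lift to differential
operators. -/
theorem exists_integral_dual_operators [CharZero k] (hM : M.IsLocallyFreeOfFiniteRank) {x : X}
    {d : ℕ} (c : LocalCoordinates k (X.presheaf.stalk x) X.functionField d) {n m : ℕ}
    {l : Fin m → M.presheaf.stalk x →ₗ[k] IsLocalRing.ResidueField (X.presheaf.stalk x)}
    (hl : ∀ i, IsDO (X.presheaf.stalk x) (n + 1) (l i)) (v : Fin m → M.presheaf.stalk x)
    (hv : ∀ i j, l i (v j) = if i = j then 1 else 0) :
    ∃ q : Fin m → genericStalk M →ₗ[k] X.functionField,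
      (∀ i, IsDO X.functionField (n + 1) (q i)) ∧ (∀ i, IsIntegralAt k M (q i) x) ∧
      ∀ i j, q i (toGeneric k M x (v j)) = if i = j then 1 else 0 := by
  obtain ⟨U, hx, -, -, r, e, he⟩ := exists_frame hM (x := x) (O := ⊤) trivial
  obtain ⟨b, hb⟩ := exists_basis_of_isFrame k hM (genericPoint_mem hx) he
  choose w hw using fun j => exists_eq_sum_germ k M he hx (v j)
  let T : (Fin r → X.presheaf.stalk x) →ₗ[X.presheaf.stalk x] M.presheaf.stalk x :=
    Fintype.linearCombination _ fun i => germ k M hx (e i)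
  have hT (w) : T w = ∑ i, w i • germ k M hx (e i) := Fintype.linearCombination_apply _ _ _
  have hTgen (w : Fin r → X.presheaf.stalk x) : toGeneric k M x (T w) =
      ∑ i, algebraMap (X.presheaf.stalk x) X.functionField (w i) • b i := by
    simp only [hT, map_sum, toGeneric_smul, toGeneric_germ, hb]
  have hlT (i) : IsDO (X.presheaf.stalk x) (n + 1) (l i ∘ₗ T.restrictScalars k) := by
    have := IsDO.comp (m := 0) (IsDO.of_linear (A := X.presheaf.stalk x)
      (q := T.restrictScalars k) fun a m => map_smul T a m) (hl i)
    simpa using this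
  obtain ⟨q, hq, hqi, hqv⟩ := c.exists_dual_operators b hlT w fun i j => by
    rw [← hv i j, hw j, ← hT]
    rfl
  refine ⟨q, hq, fun i m => ?_, fun i j => ?_⟩
  · obtain ⟨w, rfl⟩ := exists_eq_sum_germ k M he hx m
    obtain ⟨a, ha⟩ := hqi i w
    rw [← hT, hTgen]
    exact ⟨a, ha.symm⟩
  · rw [← hqv i j, ← hTgen, hT, ← hw j]

/-- An operator which is integral at `y` as a map from the stalk to the local ring at `y`. -/
def IsIntegralAt.toStalk {q : genericStalk M →ₗ[k] X.functionField} {y : X}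
    (h : IsIntegralAt k M q y) : M.presheaf.stalk y →ₗ[k] X.presheaf.stalk y :=
  (AlgEquiv.ofInjective (IsScalarTower.toAlgHom k (X.presheaf.stalk y) X.functionField)
      (IsFractionRing.injective _ _)).symm.toLinearMap ∘ₗ
    LinearMap.codRestrict (Subalgebra.toSubmodule (localRing k y)) (q ∘ₗ toGeneric k M y) h

theorem IsIntegralAt.algebraMap_toStalk {q : genericStalk M →ₗ[k] X.functionField} {y : X}
    (h : IsIntegralAt k M q y) (m : M.presheaf.stalk y) :
    algebraMap (X.presheaf.stalk y) X.functionField (h.toStalk m) = q (toGeneric k M y m) := by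
  have := AlgEquiv.apply_symm_apply
    (AlgEquiv.ofInjective (IsScalarTower.toAlgHom k (X.presheaf.stalk y) X.functionField)
      (IsFractionRing.injective _ _)) ⟨q (toGeneric k M y m), h m⟩
  exact congrArg Subtype.val this

theorem IsIntegralAt.isDO_toStalk {q : genericStalk M →ₗ[k] X.functionField} {y : X}
    (h : IsIntegralAt k M q y) {n : ℕ} (hq : IsDO X.functionField n q) :
    IsDO (X.presheaf.stalk y) n h.toStalk :=
  IsDO.of_injective (algebraMap (X.presheaf.stalk y) X.functionField) (toGeneric k M y)
    (algebraMap (X.presheaf.stalk y) X.functionField).toAddMonoidHom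
    (IsFractionRing.injective _ _) (toGeneric_smul k M y)
    (fun a m => map_mul (algebraMap (X.presheaf.stalk y) X.functionField) a m) hq
    h.algebraMap_toStalk

theorem IsIntegralAt.lsmul_comp {q : genericStalk M →ₗ[k] X.functionField} {y : X}
    (h : IsIntegralAt k M q y) {a : X.functionField} (ha : a ∈ localRing k y) :
    IsIntegralAt k M (Algebra.lsmul k k _ a ∘ₗ q) y :=
  fun m => mul_mem ha (h m)

theorem IsIntegralAt.add {q q' : genericStalk M →ₗ[k] X.functionField} {y : X}
    (h : IsIntegralAt k M q y) (h' : IsIntegralAt k M q' y) : IsIntegralAt k M (q + q') y :=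
  fun m => add_mem (h m) (h' m)

/-- The operator `∑ q i (_) • w i`. -/
def sumSmulRight {m : ℕ} (q : Fin m → genericStalk M →ₗ[k] X.functionField)
    (w : Fin m → genericStalk M) : genericStalk M →ₗ[k] genericStalk M :=
  ∑ i, (LinearMap.toSpanSingleton X.functionField _ (w i)).restrictScalars k ∘ₗ q i

theorem sumSmulRight_apply {m : ℕ} (q : Fin m → genericStalk M →ₗ[k] X.functionField)
    (w : Fin m → genericStalk M) (e : genericStalk M) :
    sumSmulRight q w e = ∑ i, q i e • w i := by
  simp [sumSmulRight]

theorem isDO_sumSmulRight {m n : ℕ} {q : Fin m → genericStalk M →ₗ[k] X.functionField}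
    (hq : ∀ i, IsDO X.functionField (n + 1) (q i)) (w : Fin m → genericStalk M) :
    IsDO X.functionField (n + 1) (sumSmulRight q w) := by
  refine IsDO.sum _ fun i _ => ?_
  have := IsDO.comp (n := 0) (hq i) (IsDO.of_linear (A := X.functionField)
    (q := (LinearMap.toSpanSingleton X.functionField _ (w i)).restrictScalars k)
    fun a m => map_smul (LinearMap.toSpanSingleton X.functionField _ (w i)) a m)
  exact this

theorem sumSmulRight_mem {m : ℕ} {q : Fin m → genericStalk M →ₗ[k] X.functionField}
    {w : Fin m → genericStalk M} {y : X} (hq : ∀ i, IsIntegralAt k M (q i) y)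
    (hw : ∀ i, w i ∈ LinearMap.range (toGeneric k M y)) (s : M.presheaf.stalk y) :
    sumSmulRight q w (toGeneric k M y s) ∈ LinearMap.range (toGeneric k M y) := by
  rw [sumSmulRight_apply]
  refine Submodule.sum_mem _ fun i _ => ?_
  obtain ⟨a, ha⟩ := mem_localRing.1 (hq i s)
  obtain ⟨t, ht⟩ := hw i
  exact ⟨a • t, by rw [toGeneric_smul, ha, ht]⟩

end DualOperators

/-! ### Global dual operators on an affine variety -/

section AffineVariety

variable {k : Type u} [Field k] {X : Scheme.{u}} [X.Over (Spec (.of k))] [IsIntegral X]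
  {M : X.Modules} [LocallyOfFiniteType (X ↘ Spec (.of k))] [IsAffine X]

/-- A differential operator integral at `x` becomes integral everywhere after multiplication by a
function which does not vanish at `x`. -/
theorem exists_mul_isIntegralAt (hM : M.IsLocallyFreeOfFiniteRank) {x : X} {n : ℕ}
    {q : genericStalk M →ₗ[k] X.functionField} (hq : IsDO X.functionField n q)
    (h : IsIntegralAt k M q x) :
    ∃ u : Γ(X, ⊤), x ∈ X.basicOpen u ∧ ∀ y,
      IsIntegralAt k M (Algebra.lsmul k k _ (sectionHom k (U := ⊤) trivial u) ∘ₗ q) y := by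
  obtain ⟨U₀, hx, -, hU₀, r, e, he⟩ := exists_frame hM (x := x) (O := ⊤) trivial
  obtain ⟨s, hs, hs'⟩ := exists_isIntegralAt_basicOpen hU₀ he hx hq h
  -- Since X is affine, u can be a global function. The operator is integral where u does not
  -- vanish, and on each member of a finite affine cover a power of u absorbs the poles.
  obtain ⟨u, hus, hu⟩ := (isAffineOpen_top X).exists_basicOpen_le ⟨x, hs⟩ trivial
  have key (z : X) : ∃ (U : X.Opens) (_ : z ∈ U) (N : ℕ), ∀ N' ≥ N, ∀ y ∈ U, ∀ m,
      sectionHom k (U := ⊤) trivial u ^ N' * q (toGeneric k M y m) ∈ localRing k y := by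
    obtain ⟨U, hz, -, hU, r, e, he⟩ := exists_frame hM (x := z) (O := ⊤) trivial
    obtain ⟨N, hN⟩ := exists_pow_isIntegralAt hU (genericPoint_mem hz) he hq
      (s := X.presheaf.map (homOfLE le_top).op u) fun y hy => hs' y (hus (by
        rw [Scheme.basicOpen_res] at hy
        exact hy.2))
    rw [sectionHom_res (k := k) le_top] at hN
    exact ⟨U, hz, N, hN⟩
  choose U hzU N hN using key
  obtain ⟨t, ht⟩ := isCompact_univ.elim_finite_subcover (fun z => (U z : Set X))
    (fun z => (U z).isOpen) fun z _ => Set.mem_iUnion.2 ⟨z, hzU z⟩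
  -- The + 1 makes the exponent positive, so that the power has the same basic open set as u.
  refine ⟨u ^ (t.sup N + 1), ?_, fun y m => ?_⟩
  · rw [Scheme.basicOpen_pow _ _ (by omega)]
    exact hu
  · obtain ⟨z, hz, hy⟩ := Set.mem_iUnion₂.1 (ht (Set.mem_univ y))
    rw [map_pow]
    exact hN z _ ((Finset.le_sup hz).trans (Nat.le_succ _)) y hy m

theorem exists_mul_isIntegralAt_family (hM : M.IsLocallyFreeOfFiniteRank) {x : X} {n m : ℕ}
    {q : Fin m → genericStalk M →ₗ[k] X.functionField} (hq : ∀ i, IsDO X.functionField n (q i))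
    (h : ∀ i, IsIntegralAt k M (q i) x) :
    ∃ u : Γ(X, ⊤), x ∈ X.basicOpen u ∧ ∀ i y,
      IsIntegralAt k M (Algebra.lsmul k k _ (sectionHom k (U := ⊤) trivial u) ∘ₗ q i) y := by
  choose u hu hu' using fun i => exists_mul_isIntegralAt hM (hq i) (h i)
  refine ⟨∏ i, u i, ?_, fun i y => ?_⟩
  · have hx : x ∈ (⊤ : X.Opens) := trivial
    rw [Scheme.mem_basicOpen X _ x hx, map_prod]
    exact IsUnit.prod_univ_iff.2 fun i => (Scheme.mem_basicOpen X _ x hx).1 (hu i)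
  · rw [← Finset.prod_erase_mul _ _ (Finset.mem_univ i), map_mul]
    intro w
    have := (hu' i y).lsmul_comp (sectionHom_mem_localRing (k := k) (U := ⊤) (x := y) trivial trivial
      (∏ j ∈ Finset.univ.erase i, u j)) w
    simpa [mul_assoc] using this

variable (k M) in
/-- The functions `u` such that there are operators `q i` of order at most `n`, integral everywhere,
with `q i (v j) = u δ i j`. -/
def dualIdeal (n : ℕ) {m : ℕ} (v : Fin m → Γ(M, ⊤)) : Ideal Γ(X, ⊤) where
  carrier := {u | ∃ q : Fin m → genericStalk M →ₗ[k] X.functionField,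
    (∀ i, IsDO X.functionField (n + 1) (q i)) ∧ (∀ i y, IsIntegralAt k M (q i) y) ∧
    ∀ i j, q i (germ k M (U := ⊤) trivial (v j)) =
      if i = j then sectionHom k (U := ⊤) trivial u else 0}
  zero_mem' := ⟨0, fun i => IsDO.zero _, fun i y m => zero_mem _, fun i j => by simp⟩
  add_mem' := by
    rintro a b ⟨q, hq, hq', hqv⟩ ⟨p, hp, hp', hpv⟩
    refine ⟨q + p, fun i => (hq i).add (hp i), fun i y => (hq' i y).add (hp' i y), fun i j => ?_⟩
    rw [Pi.add_apply, LinearMap.add_apply, hqv, hpv]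
    split_ifs <;> simp
  smul_mem' := by
    rintro a b ⟨q, hq, hq', hqv⟩
    refine ⟨fun i => Algebra.lsmul k k _ (sectionHom k (U := ⊤) trivial a) ∘ₗ q i,
      fun i => (hq i).lsmul_comp _, fun i y => (hq' i y).lsmul_comp
        (sectionHom_mem_localRing (U := ⊤) (x := y) trivial trivial a), fun i j => ?_⟩
    rw [LinearMap.comp_apply, hqv]
    split_ifs <;> simp

variable (V : Submodule k Γ(M, ⊤))

omit [IsIntegral X] [LocallyOfFiniteType (X ↘ Spec (.of k))] [IsAffine X] in
theorem taylorFibre_injective_mono {x : X} {m n : ℕ} (hmn : m ≤ n)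
    (h : Function.Injective (taylorFibre k M V x m)) :
    Function.Injective (taylorFibre k M V x n) :=
  fibreTaylorMap_injective_mono hmn h

omit [IsIntegral X] [LocallyOfFiniteType (X ↘ Spec (.of k))] [IsAffine X] in
theorem nInjAt_le_iff {x : X} {n : ℕ} :
    nInjAt k M V x ≤ n ↔ Function.Injective (taylorFibre k M V x n) := by
  constructor
  · intro h
    obtain ⟨N, ⟨m, rfl, hm⟩, hN⟩ := sInf_lt_iff.1 (h.trans_lt (Order.lt_add_one_iff_of_not_isMax
      (by simp) |>.2 le_rfl : (n : ℕ∞) < n + 1))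
    refine taylorFibre_injective_mono V ?_ hm
    have : m < n + 1 := by exact_mod_cast hN
    omega
  · intro h
    exact sInf_le ⟨n, rfl, h⟩

variable {V} {m : ℕ} (b : Module.Basis (Fin m) k V)

/-- The local theory in one statement: dual functionals, their lift along local coordinates, and
clearing of denominators by u. The point has to be closed for local coordinates to generate the
differentials. -/
theorem exists_mem_dualIdeal [CharZero k] (hreg : IsRegularScheme X)
    (hM : M.IsLocallyFreeOfFiniteRank) {x : X} {n : ℕ}
    (hmax : ((isAffineOpen_top X).primeIdealOf ⟨x, trivial⟩).asIdeal.IsMaximal)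
    (h : Function.Injective (taylorFibre k M V x n)) :
    ∃ u ∈ dualIdeal k M n fun i => (b i : Γ(M, ⊤)), x ∈ X.basicOpen u := by
  obtain ⟨l, hl, hlv⟩ := exists_dual_functionals b h
  obtain ⟨d, c, -⟩ := exists_localCoordinates_stalk k (isAffineOpen_top X) trivial hmax (hreg x)
  obtain ⟨q, hq, hqx, hqv⟩ := exists_integral_dual_operators hM c hl _ hlv
  obtain ⟨u, hu, hu'⟩ := exists_mul_isIntegralAt_family hM hq hqx
  refine ⟨u, ⟨_, fun i => (hq i).lsmul_comp _, hu', fun i j => ?_⟩, hu⟩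
  have hx : x ∈ (⊤ : X.Opens) := trivial
  have h1 := toGeneric_germ k M hx (b j : Γ(M, ⊤))
  have h2 : q i (germ k M (genericPoint_mem hx) (b j : Γ(M, ⊤))) = _ := h1 ▸ hqv i j
  rw [LinearMap.comp_apply, h2]
  split_ifs <;> simp

-- The operators act on the stalk at y, where u is a unit. Neither closedness nor regularity of y
-- enters, so this also controls the non-closed points.
omit [LocallyOfFiniteType (X ↘ Spec (.of k))] [IsAffine X] in
theorem taylorFibre_injective_of_mem_dualIdeal {y : X} {n : ℕ} {u : Γ(X, ⊤)}
    (hu : u ∈ dualIdeal k M n fun i => (b i : Γ(M, ⊤))) (hy : y ∈ X.basicOpen u) :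
    Function.Injective (taylorFibre k M V y n) := by
  obtain ⟨q, hq, hqy, hqv⟩ := hu
  refine fibreTaylorMap_injective b (fun i => (hqy i y).toStalk)
    (fun i => (hqy i y).isDO_toStalk (hq i)) ((Scheme.mem_basicOpen X u y trivial).1 hy)
    fun i j => ?_
  apply IsFractionRing.injective (X.presheaf.stalk y) X.functionField
  have hy' : y ∈ (⊤ : X.Opens) := trivial
  refine ((hqy i y).algebraMap_toStalk _).trans
    ((congrArg (q i) (toGeneric_germ k M hy' (b j : Γ(M, ⊤)))).trans ((hqv i j).trans ?_))
  split_ifs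
  · exact (algebraMap_germ' hy' u).symm
  · rw [map_zero]

-- Separatedness gives an order at each closed point separately. The ideals `J n` increase and
-- together generate the unit ideal; as 1 already lies in one of them, a single order works at all
-- points.
include b in
theorem nInj_ne_top [CharZero k] (hreg : IsRegularScheme X) (hM : M.IsLocallyFreeOfFiniteRank)
    (hV : IsSeparatedSubspace k M V) : nInj k M V ≠ ⊤ := by
  let J (n : ℕ) := dualIdeal k M n fun i => (b i : Γ(M, ⊤))
  have hJ : Monotone J := by
    rintro a c hac u ⟨q, hq, h⟩
    exact ⟨q, fun i => (hq i).mono (by omega), h⟩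
  have htop : ⨆ n, J n = ⊤ := by
    refine eq_top_of_forall_isMaximal (isAffineOpen_top X) fun x hx hmax => ?_
    obtain ⟨N, hN⟩ := hV x
    obtain ⟨u, hu, hux⟩ := exists_mem_dualIdeal b hreg hM hmax (hN N le_rfl)
    exact ⟨u, (le_iSup J N) hu, hux⟩
  have h1 : (1 : Γ(X, ⊤)) ∈ ⨆ n, J n := htop ▸ Submodule.mem_top
  obtain ⟨n, hn⟩ := (Submodule.mem_iSup_of_directed J hJ.directed_le).1 h1
  refine ne_top_of_le_ne_top (ENat.natCast_ne_top n) (iSup_le fun y => ?_)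
  exact (nInjAt_le_iff V).2 (taylorFibre_injective_of_mem_dualIdeal b hn (by simp))

-- Once 1 lies in the dual ideal there are global q_i with q_i(b_j) = δ_ij, and ∑ q_i(·) φ(b_i)
-- induces φ.
include b in
theorem evalOn_surjective [CharZero k] (hreg : IsRegularScheme X)
    (hM : M.IsLocallyFreeOfFiniteRank) {n : ℕ} (hn : nInj k M V ≤ n) :
    Function.Surjective (evalOn (globalAction k M) (sheafDiffOp k M ⊤ n) V) := by
  have htop : (dualIdeal k M n fun i => (b i : Γ(M, ⊤))) = ⊤ := by
    refine eq_top_of_forall_isMaximal (isAffineOpen_top X) fun x hx hmax => ?_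
    exact exists_mem_dualIdeal b hreg hM hmax
      ((nInjAt_le_iff V).1 ((le_iSup (nInjAt k M V) x).trans hn))
  obtain ⟨q, hq, hqy, hqv⟩ := (Ideal.eq_top_iff_one _).1 htop
  intro φ
  have hη : genericPoint X ∈ (⊤ : X.Opens) := trivial
  obtain ⟨P, hP, hPs⟩ := exists_sheafDiffOp k hM (U := ⊤) (n := n)
    (sumSmulRight q fun i => germ k M hη (φ (b i) : Γ(M, ⊤))) (isDO_sumSmulRight hq _)
    fun y _ => sumSmulRight_mem (fun i => hqy i y) fun i =>
      ⟨germ k M (U := ⊤) trivial (φ (b i) : Γ(M, ⊤)), toGeneric_germ k M _ _⟩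
  have key (j) : globalAction k M P (b j : Γ(M, ⊤)) = φ (b j) := by
    apply germ_generic_injective k hM hη
    refine (hPs ⟨⊤, le_top⟩ hη _).trans ?_
    rw [sumSmulRight_apply, Finset.sum_eq_single j]
    · rw [hqv, if_pos rfl, map_one, one_smul]
    · intro i _ hij
      rw [hqv, if_neg hij, zero_smul]
    · simp
  have key' (v : V) : globalAction k M P (v : Γ(M, ⊤)) = φ v := by
    have : globalAction k M P ∘ₗ V.subtype = V.subtype ∘ₗ φ := b.ext key
    exact LinearMap.congr_fun this v
  refine ⟨⟨P, hP, fun v hv => ?_⟩, ?_⟩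
  · rw [key' ⟨v, hv⟩]
    exact (φ _).2
  · ext v
    exact key' v

end AffineVariety

/-! ### Exactness -/

section Exact

variable {k D N : Type*} [Field k] [AddCommGroup D] [Module k D] [AddCommGroup N] [Module k N]
  {act : D →ₗ[k] Module.End k N} {S : Submodule k D} {V : Submodule k N}

/-- Injectivity on the left and exactness in the middle hold by definition; surjectivity of W is the
only content. -/
theorem isExactSequence_of_surjective (h : Function.Surjective (evalOn act S V)) :
    IsExactSequence act S V := by
  refine ⟨Submodule.inclusion_injective _, fun P => ⟨fun hP => ?_, ?_⟩, h⟩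
  · refine ⟨⟨P.1, P.2.1, fun v hv => ?_⟩, rfl⟩
    exact congrArg Subtype.val (LinearMap.congr_fun hP ⟨v, hv⟩)
  · rintro ⟨P, rfl⟩
    ext v
    exact P.2.2 v v.2

theorem evalOn_surjective_mono {S' : Submodule k D} (hS : S ≤ S')
    (h : Function.Surjective (evalOn act S V)) : Function.Surjective (evalOn act S' V) := by
  intro φ
  obtain ⟨P, rfl⟩ := h φ
  exact ⟨⟨P.1, hS P.2.1, P.2.2⟩, rfl⟩

/-- If all endomorphisms of `V` are induced by operators, `V` is irreducible. -/
theorem eq_bot_or_eq_of_surjective (h : Function.Surjective (evalOn act S V)) {U : Submodule k N}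
    (hUV : U ≤ V) (hU : ∀ P ∈ preserving act S V, ∀ w ∈ U, act P w ∈ U) : U = ⊥ ∨ U = V := by
  rw [or_iff_not_imp_left]
  intro h0
  obtain ⟨w, hw, hw0⟩ := U.exists_mem_ne_zero_of_ne_bot h0
  refine le_antisymm hUV fun v hv => ?_
  obtain ⟨f, hf⟩ : ∃ f : Module.Dual k V, f ⟨w, hUV hw⟩ ≠ 0 := by
    by_contra! hf
    exact hw0 (congrArg Subtype.val ((Module.forall_dual_apply_eq_zero_iff k _).1 hf))
  -- The rank one endomorphism f(·) f(w)⁻¹ v sends w to v.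
  obtain ⟨P, hP⟩ := h (f.smulRight ((f ⟨w, hUV hw⟩)⁻¹ • ⟨v, hv⟩))
  have h1 := LinearMap.congr_fun hP ⟨w, hUV hw⟩
  rw [LinearMap.smulRight_apply, smul_inv_smul₀ hf] at h1
  have h2 : act P.1 w = v := congrArg Subtype.val h1
  rw [← h2]
  exact hU P.1 P.2 w hw

end Exact

theorem affine_variety (k : Type u) [Field k] [CharZero k] (X : Scheme.{u}) [X.Over (Spec (.of k))]
    [IsIntegral X] [IsAffine X] [LocallyOfFiniteType (X ↘ Spec (.of k))]
    (hreg : IsRegularScheme X) (M : X.Modules) (hM : M.IsLocallyFreeOfFiniteRank)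
    (V : Submodule k Γ(M, ⊤)) (_ : FiniteDimensional k V) (hV : IsSeparatedSubspace k M V) :
    nInj k M V ≠ ⊤ ∧
    (∀ n : ℕ, nInj k M V ≤ n → IsExactSequence (globalAction k M) (sheafDiffOp k M ⊤ n) V) ∧
    IsExactSequence (globalAction k M) (globalDiffOp k M) V ∧
    (∀ U : Submodule k Γ(M, ⊤), U ≤ V →
      (∀ P ∈ preserving (globalAction k M) (globalDiffOp k M) V,
        ∀ w ∈ U, globalAction k M P w ∈ U) → U = ⊥ ∨ U = V) := by
  let b := Module.finBasis k V
  have h1 := nInj_ne_top b hreg hM hV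
  obtain ⟨n, hn⟩ := ENat.ne_top_iff_exists.1 h1
  have h2 : Function.Surjective (evalOn (globalAction k M) (globalDiffOp k M) V) :=
    evalOn_surjective_mono (fun P hP => ⟨n, hP⟩) (evalOn_surjective b hreg hM hn.ge)
  exact ⟨h1, fun n hn => isExactSequence_of_surjective (evalOn_surjective b hreg hM hn),
    isExactSequence_of_surjective h2, fun U hUV hU => eq_bot_or_eq_of_surjective h2 hUV hU⟩

/-! ### Flows of derivations and the real points of an affine variety -/

section Flow

open MvPolynomial

variable {σ : Type*} [Fintype σ]

omit [Fintype σ] in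
theorem hasDerivAt_eval {h : σ → MvPolynomial σ ℝ} {z : ℝ → σ → ℝ} {t : ℝ}
    (hz : HasDerivAt z (fun j => eval (z t) (h j)) t) (p : MvPolynomial σ ℝ) :
    HasDerivAt (fun t => eval (z t) p) (eval (z t) (mkDerivation ℝ h p)) t := by
  induction p using MvPolynomial.induction_on with
  | C a => simpa using hasDerivAt_const t a
  | add p q hp hq =>
    simp only [map_add]
    exact hp.add hq
  | mul_X p i hp =>
    have := hp.mul (hasDerivAt_pi.1 hz i)
    simp only [Derivation.leibniz, mkDerivation_X, smul_eq_mul, map_add, map_mul, eval_X]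
    rw [add_comm, mul_comm (z t i)]
    exact this

/-- An integral curve which starts on the zero set of an ideal stable under the vector field stays
on this zero set. -/
theorem eval_eq_zero_of_flow {h : σ → MvPolynomial σ ℝ} {I : Ideal (MvPolynomial σ ℝ)}
    (hI : ∀ f ∈ I, mkDerivation ℝ h f ∈ I) {z : ℝ → σ → ℝ} {ε : ℝ}
    (hz : ∀ t ∈ Set.Icc 0 ε, HasDerivAt z (fun j => eval (z t) (h j)) t)
    (h0 : ∀ f ∈ I, eval (z 0) f = 0) {f : MvPolynomial σ ℝ} (hf : f ∈ I) :
    ∀ t ∈ Set.Icc 0 ε, eval (z t) f = 0 := by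
  obtain ⟨S, rfl⟩ : I.FG := (isNoetherianRing_iff_ideal_fg _).1 inferInstance I
  -- Stability of I means that along the curve the generators satisfy a homogeneous linear system
  -- with continuous coefficients. With zero initial values the solution is zero by Grönwall's
  -- inequality.
  have hS (i : S) : ∃ c : S → MvPolynomial σ ℝ, mkDerivation ℝ h i = ∑ j, c j * j := by
    have := hI i (Ideal.subset_span i.2)
    obtain ⟨c, -, hc⟩ := Submodule.mem_span_finset.1 this
    exact ⟨fun j => c j, by rw [← hc, ← Finset.sum_coe_sort]; rfl⟩
  choose c hc using hS
  have hcont (p : MvPolynomial σ ℝ) : ContinuousOn (fun t => eval (z t) p) (Set.Icc 0 ε) :=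
    fun t ht => (hasDerivAt_eval (hz t ht) p).continuousAt.continuousWithinAt
  obtain ⟨K, hK⟩ := isCompact_Icc.exists_bound_of_continuousOn
    (f := fun t => ∑ i, ∑ j, |eval (z t) (c i j)|) (s := Set.Icc 0 ε)
    (continuousOn_finsetSum _ fun i _ => continuousOn_finsetSum _ fun j _ => (hcont _).abs)
  have key := eq_zero_of_abs_deriv_le_mul_abs_self_of_eq_zero_right
    (f := fun t (i : S) => eval (z t) (i : MvPolynomial σ ℝ))
    (f' := fun t i => eval (z t) (mkDerivation ℝ h (i : MvPolynomial σ ℝ))) (K := K) (a := 0)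
    (b := ε) (continuousOn_pi.2 fun i => hcont i)
    (fun t ht => (hasDerivAt_pi.2 fun i =>
      hasDerivAt_eval (hz t (Set.Ico_subset_Icc_self ht)) _).hasDerivWithinAt)
    (funext fun i => h0 i (Ideal.subset_span i.2)) (fun t ht => by
      refine (pi_norm_le_iff_of_nonneg (mul_nonneg ?_ (norm_nonneg _))).2 fun i => ?_
      · exact (norm_nonneg _).trans (hK t (Set.Ico_subset_Icc_self ht))
      · rw [hc i, map_sum]
        refine (norm_sum_le _ _).trans ?_
        refine le_trans ?_ (mul_le_mul_of_nonneg_right ((le_abs_self _).trans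
          (hK t (Set.Ico_subset_Icc_self ht))) (norm_nonneg _))
        refine le_trans ?_ (mul_le_mul_of_nonneg_right (Finset.single_le_sum
          (f := fun i => ∑ j, |eval (z t) (c i j)|) (fun i _ => by positivity)
          (Finset.mem_univ i)) (norm_nonneg _))
        rw [Finset.sum_mul]
        refine Finset.sum_le_sum fun j _ => ?_
        rw [map_mul, norm_mul, Real.norm_eq_abs]
        exact mul_le_mul_of_nonneg_left (norm_le_pi_norm
          (fun i : S => eval (z t) (i : MvPolynomial σ ℝ)) j) (abs_nonneg _))
  intro t ht
  have h1 : Ideal.span (S : Set (MvPolynomial σ ℝ)) ≤ RingHom.ker (eval (z t)) :=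
    Ideal.span_le.2 fun i hi => congrFun (key t ht) ⟨i, hi⟩
  exact h1 hf

/-- The ideal of functions which vanish at all real points is stable under derivations. -/
theorem derivation_vanishing {A : Type*} [CommRing A] [Algebra ℝ A] [Algebra.FiniteType ℝ A]
    (D : Derivation ℝ A A) {a : A} (ha : ∀ φ : A →ₐ[ℝ] ℝ, φ a = 0) (φ : A →ₐ[ℝ] ℝ) :
    φ (D a) = 0 := by
  obtain ⟨n, π, hπ⟩ := Algebra.FiniteType.iff_quotient_mvPolynomial''.1
    (inferInstance : Algebra.FiniteType ℝ A)
  -- A polynomial vector field on affine space lifting D. The kernel of `π` is stable under it, so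
  -- its integral curve through φ stays on the zero set of this kernel.
  choose h hh using fun j : Fin n => hπ (D (π (X j)))
  have hD (p : MvPolynomial (Fin n) ℝ) : π (mkDerivation ℝ h p) = D (π p) := by
    induction p using MvPolynomial.induction_on with
    | C a => simp
    | add p q hp hq => simp [hp, hq]
    | mul_X p i hp => simp [Derivation.leibniz, hp, hh]
  have hφ (p : MvPolynomial (Fin n) ℝ) : φ (π p) = eval (fun j => φ (π (X j))) p := by
    have : (φ.comp π) = aeval (fun j => φ (π (X j))) := by
      ext j
      simp
    rw [← MvPolynomial.coe_aeval_eq_eval, ← this]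
    rfl
  let v : (Fin n → ℝ) → Fin n → ℝ := fun y j => eval y (h j)
  have hv : ContDiff ℝ 1 v := by
    refine contDiff_pi.2 fun j => ?_
    exact (AnalyticOnNhd.eval_mvPolynomial (h j)).contDiff
  obtain ⟨z, hz0, ε, hε, hz⟩ :=
    (hv.contDiffAt (x := fun j => φ (π (X j)))).exists_forall_mem_closedBall_exists_eq_forall_mem_Ioo_hasDerivAt₀ 0
  have hz' : ∀ t ∈ Set.Icc 0 (ε / 2), HasDerivAt z (fun j => eval (z t) (h j)) t :=
    fun t ht => hz t ⟨by linarith [ht.1], by linarith [ht.2]⟩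
  have hker : ∀ t ∈ Set.Icc 0 (ε / 2), ∀ f ∈ RingHom.ker π, eval (z t) f = 0 := by
    intro t ht f hf
    refine eval_eq_zero_of_flow (I := RingHom.ker π) (fun f hf => ?_) hz' (fun f hf => ?_) hf t ht
    · rw [RingHom.mem_ker] at hf ⊢
      rw [hD, hf, map_zero]
    · rw [RingHom.mem_ker] at hf
      rw [hz0, ← hφ, hf, map_zero]
  obtain ⟨p, rfl⟩ := hπ a
  have hp : ∀ t ∈ Set.Icc 0 (ε / 2), eval (z t) p = 0 := by
    intro t ht
    -- Each point of the curve is again a real point of A, where `a` vanishes by hypothesis.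
    let ψ : A →ₐ[ℝ] ℝ := (Ideal.Quotient.liftₐ (RingHom.ker π) (aeval (z t)) (hker t ht)).comp
      (Ideal.quotientKerAlgEquivOfSurjective hπ).symm.toAlgHom
    have h1 := ha ψ
    have h2 : (Ideal.quotientKerAlgEquivOfSurjective hπ).symm (π p) =
        Ideal.Quotient.mk _ p := by
      rw [AlgEquiv.symm_apply_eq]
      rfl
    have h3 : ψ (π p) = eval (z t) p :=
      congrArg (Ideal.Quotient.liftₐ (RingHom.ker π) (aeval (z t)) (hker t ht)) h2
    rw [← h3, h1]
  -- The function p is constantly 0 along the curve, while its one-sided derivative at time 0 is the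
  -- value of D a at φ.
  have hd := (hasDerivAt_eval (hz' 0 ⟨le_rfl, by linarith⟩) p).hasDerivWithinAt
    (s := Set.Icc 0 (ε / 2))
  have hd' : HasDerivWithinAt (fun t => eval (z t) p) 0 (Set.Icc 0 (ε / 2)) 0 :=
    (hasDerivWithinAt_const 0 _ (0 : ℝ)).congr hp (hp 0 ⟨le_rfl, by linarith⟩)
  have := (uniqueDiffOn_Icc (by linarith : (0 : ℝ) < ε / 2)).eq ⟨le_rfl, by linarith⟩ hd.hasFDerivWithinAt
    hd'.hasFDerivWithinAt
  have h4 := congrArg (fun L : ℝ →L[ℝ] ℝ => L 1) this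
  simp only [ContinuousLinearMap.toSpanSingleton_apply, one_smul] at h4
  rw [← hD, hφ, ← hz0]
  exact h4

end Flow

/-! ### Ideals stable under the dual derivations -/

namespace LocalCoordinates

open IsLocalRing

variable {k R K : Type*} [Field k] [CharZero k] [CommRing R] [IsLocalRing R] [Algebra k R] [Field K]
  [Algebra k K] [Algebra R K] {d : ℕ} (c : LocalCoordinates k R K d)
  (hc : Ideal.span (Set.range c.coord) = maximalIdeal R)

include hc

-- The vector field ∑ t_i ∂_i fixes every t_i, so by the Leibniz rule it acts on 𝔪ⁿ / 𝔪ⁿ⁺¹ as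
-- multiplication by n.
omit [CharZero k] in
theorem euler_derivation (n : ℕ) : ∀ a ∈ maximalIdeal R ^ n,
    ∑ i, c.coord i * c.derR i a - n * a ∈ maximalIdeal R ^ (n + 1) := by
  have hcm (i) : c.coord i ∈ maximalIdeal R := hc ▸ Ideal.subset_span ⟨i, rfl⟩
  let E : R →+ R := ∑ i, (AddMonoidHom.mulLeft (c.coord i)).comp (c.derR i : R →ₗ[k] R).toAddMonoidHom
  have hE (a) : E a = ∑ i, c.coord i * c.derR i a := by simp [E]
  have hmul (a b) : E (a * b) = a * E b + b * E a := by
    simp only [hE, Derivation.leibniz, smul_eq_mul, Finset.mul_sum, ← Finset.sum_add_distrib]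
    exact Finset.sum_congr rfl fun i _ => by ring
  have hEt (j) : E (c.coord j) = c.coord j := by
    rw [hE, Finset.sum_eq_single j]
    · simp [c.derR_coord]
    · intro i _ hij
      simp [c.derR_coord, hij]
    · simp
  have hEm (a) : E a ∈ maximalIdeal R := by
    rw [hE]
    exact Ideal.sum_mem _ fun i _ => Ideal.mul_mem_right _ _ (hcm i)
  simp_rw [← hE]
  induction n with
  | zero => intro a _; simpa using hEm a
  | succ n ih =>
    intro a ha
    have h1 : ∀ x ∈ maximalIdeal R, ∀ b ∈ maximalIdeal R ^ n,
        E (x * b) - (n + 1 : ℕ) * (x * b) ∈ maximalIdeal R ^ (n + 1 + 1) := by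
      intro x hx
      rw [← hc] at hx
      induction hx using Submodule.span_induction with
      | mem x hx =>
        obtain ⟨j, rfl⟩ := hx
        intro b hb
        rw [hmul, hEt]
        have : c.coord j * E b + b * c.coord j - (n + 1 : ℕ) * (c.coord j * b) =
            c.coord j * (E b - n * b) := by push_cast; ring
        rw [this, pow_succ' _ (n + 1)]
        exact Ideal.mul_mem_mul (hcm j) (ih b hb)
      | zero => intro b _; simp
      | add x y _ _ hx hy =>
        intro b hb
        have := add_mem (hx b hb) (hy b hb)
        rw [add_mul, map_add, mul_add]
        convert this using 1
        ring
      | smul r x _ hx =>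
        intro b hb
        have := hx (r * b) (Ideal.mul_mem_left _ _ hb)
        rwa [smul_eq_mul, mul_comm r x, mul_assoc]
    rw [pow_succ'] at ha
    induction ha using Submodule.mul_induction_on' with
    | mem_mul_mem x hx b hb => exact h1 x hx b hb
    | add a _ b _ ha hb =>
      rw [map_add, mul_add]
      convert add_mem ha hb using 1
      ring

/-- Taylor's formula: a function all whose derivatives have order `≥ n` has order `≥ n + 1` if
it vanishes. -/
theorem mem_pow_succ {n : ℕ} {a : R} (ha : a ∈ maximalIdeal R ^ (n + 1))
    (h : ∀ i, c.derR i a ∈ maximalIdeal R ^ (n + 1)) : a ∈ maximalIdeal R ^ (n + 2) := by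
  have hcm (i) : c.coord i ∈ maximalIdeal R := hc ▸ Ideal.subset_span ⟨i, rfl⟩
  -- Both E a and E a − (n + 1) a lie in 𝔪ⁿ⁺², and n + 1 is invertible in characteristic 0.
  have h1 := c.euler_derivation hc (n + 1) a ha
  have h2 : ∑ i, c.coord i * c.derR i a ∈ maximalIdeal R ^ (n + 2) :=
    Ideal.sum_mem _ fun i _ => by
      rw [pow_succ' _ (n + 1)]
      exact Ideal.mul_mem_mul (hcm i) (h i)
  have h3 := sub_mem h2 h1
  rw [sub_sub_cancel] at h3
  have h4 : ((n + 1 : ℕ) : R) = algebraMap k R ((n + 1 : ℕ) : k) := by simp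
  have h5 : algebraMap k R (((n + 1 : ℕ) : k)⁻¹) * (((n + 1 : ℕ) : R) * a) = a := by
    rw [h4, ← mul_assoc, ← map_mul, inv_mul_cancel₀ (by exact_mod_cast n.succ_ne_zero), map_one,
      one_mul]
  rw [← h5]
  exact Ideal.mul_mem_left _ _ h3

/-- A set of functions in the maximal ideal which is stable under the derivations up to units is
zero. -/
theorem eq_zero_of_stable [IsNoetherianRing R] {S : Set R} (hS : S ⊆ maximalIdeal R)
    (hder : ∀ i, ∀ a ∈ S, ∃ g : R, IsUnit g ∧ g * c.derR i a ∈ S) : ∀ a ∈ S, a = 0 := by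
  -- If S lies in 𝔪ⁿ⁺¹, so do the derivatives of its elements, units being harmless; Taylor's
  -- formula then puts S in 𝔪ⁿ⁺². Krull's intersection theorem concludes.
  have h (n : ℕ) : S ⊆ (maximalIdeal R ^ (n + 1) : Ideal R) := by
    induction n with
    | zero => simpa using hS
    | succ n ih =>
      intro a ha
      refine c.mem_pow_succ hc (ih ha) fun i => ?_
      obtain ⟨g, hg, hgS⟩ := hder i a ha
      exact (Ideal.unit_mul_mem_iff_mem _ hg).1 (ih hgS)
  intro a ha
  rw [← Ideal.mem_bot, ← Ideal.iInf_pow_eq_bot_of_isLocalRing (maximalIdeal R)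
    (Ideal.IsPrime.ne_top inferInstance), Ideal.mem_iInf]
  exact fun n => Ideal.pow_le_pow_right n.le_succ (h n ha)

end LocalCoordinates

/-! ### Values at rational points -/

section Values

variable {k : Type u} [Field k] {X : Scheme.{u}} [X.Over (Spec (.of k))]

/-- The value of a germ at a rational point. -/
def ratValue (x : RatPt k X) : X.presheaf.stalk x.1 →ₐ[k] k :=
  (AlgEquiv.ofBijective
    (Algebra.ofId k (IsLocalRing.ResidueField (X.presheaf.stalk x.1))) x.2).symm.toAlgHom.comp
    (IsScalarTower.toAlgHom k (X.presheaf.stalk x.1) _)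

theorem algebraMap_ratValue (x : RatPt k X) (a : X.presheaf.stalk x.1) :
    algebraMap k (IsLocalRing.ResidueField (X.presheaf.stalk x.1)) (ratValue x a) =
      IsLocalRing.residue _ a :=
  AlgEquiv.apply_symm_apply (AlgEquiv.ofBijective (Algebra.ofId k _) x.2) _

theorem ratValue_eq_zero_iff {x : RatPt k X} {a : X.presheaf.stalk x.1} :
    ratValue x a = 0 ↔ a ∈ IsLocalRing.maximalIdeal (X.presheaf.stalk x.1) := by
  rw [← IsLocalRing.residue_eq_zero_iff, ← algebraMap_ratValue]
  exact (map_eq_zero (algebraMap k _)).symm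

theorem ratValue_ne_zero_iff {x : RatPt k X} {a : X.presheaf.stalk x.1} :
    ratValue x a ≠ 0 ↔ IsUnit a := by
  rw [ne_eq, ratValue_eq_zero_iff, IsLocalRing.mem_maximalIdeal, mem_nonunits_iff, not_not]

/-- The value of a section at a rational point. -/
def evalAt {U : X.Opens} (x : RatPt k X) (hx : x.1 ∈ U) : Γ(X, U) →ₐ[k] k :=
  (ratValue x).comp { (X.presheaf.germ U x.1 hx).hom with commutes' := fun c => baseHom_germ k hx c }

theorem evalAt_apply {U : X.Opens} (x : RatPt k X) (hx : x.1 ∈ U) (f : Γ(X, U)) :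
    evalAt x hx f = ratValue x (X.presheaf.germ U x.1 hx f) := rfl

theorem mem_basicOpen_iff_evalAt {U : X.Opens} (x : RatPt k X) (hx : x.1 ∈ U) (f : Γ(X, U)) :
    x.1 ∈ X.basicOpen f ↔ evalAt x hx f ≠ 0 := by
  rw [Scheme.mem_basicOpen X f x.1 hx, evalAt_apply, ratValue_ne_zero_iff]

variable {U : X.Opens} (hU : IsAffineOpen U)

include hU

theorem primeIdealOf_ratPt (x : RatPt k X) (hx : x.1 ∈ U) :
    (hU.primeIdealOf ⟨x.1, hx⟩).asIdeal = RingHom.ker (evalAt x hx) := by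
  ext f
  rw [RingHom.mem_ker, ← not_iff_not, ← mem_basicOpen_iff_notMem hU hx f]
  exact mem_basicOpen_iff_evalAt x hx f

theorem isMaximal_primeIdealOf_ratPt (x : RatPt k X) (hx : x.1 ∈ U) :
    (hU.primeIdealOf ⟨x.1, hx⟩).asIdeal.IsMaximal := by
  rw [primeIdealOf_ratPt hU]
  exact RingHom.ker_isMaximal_of_surjective _ fun c => ⟨algebraMap k _ c, by simp⟩

/-- The algebra homomorphisms to the base field are the evaluations at rational points. -/
theorem exists_ratPt_of_algHom (φ : Γ(X, U) →ₐ[k] k) :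
    ∃ (x : RatPt k X) (hx : x.1 ∈ U), evalAt x hx = φ := by
  have hφ : Function.Surjective φ := fun c => ⟨algebraMap k _ c, by simp⟩
  have := RingHom.ker_isPrime φ
  obtain ⟨x, hx, hxφ⟩ := exists_point_of_isPrime hU (RingHom.ker φ)
  have hker (f : Γ(X, U)) (hf : φ f = 0) : IsLocalRing.residue (X.presheaf.stalk x)
      (X.presheaf.germ U x hx f) = 0 := by
    rw [IsLocalRing.residue_eq_zero_iff, IsLocalRing.mem_maximalIdeal, mem_nonunits_iff,
      ← Scheme.mem_basicOpen X f x hx, mem_basicOpen_iff_notMem hU hx, hxφ, not_not]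
    exact hf
  have hval (f : Γ(X, U)) : IsLocalRing.residue (X.presheaf.stalk x) (X.presheaf.germ U x hx f) =
      algebraMap k _ (φ f) := by
    have := hker (f - algebraMap k _ (φ f)) (by simp)
    rw [map_sub, map_sub, sub_eq_zero] at this
    rw [this]
    exact congrArg (IsLocalRing.residue _) (baseHom_germ k hx (φ f))
  have hbij : Function.Bijective
      (algebraMap k (IsLocalRing.ResidueField (X.presheaf.stalk x))) := by
    refine ⟨(algebraMap k _).injective, fun y => ?_⟩
    -- Write the germ as a fraction f / s. Sections have values in k, given by φ, so the residue is
    -- φ(f) / φ(s).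
    obtain ⟨a, rfl⟩ := IsLocalRing.residue_surjective y
    obtain ⟨s, f, hs, hf⟩ := exists_germ_mul_eq hU hx a
    have h1 := congrArg (IsLocalRing.residue _) hf
    rw [map_mul, hval, hval] at h1
    have h0 : φ s ≠ 0 := by
      intro h
      refine (mem_basicOpen_iff_notMem hU hx s).1 hs ?_
      rw [hxφ]
      exact h
    refine ⟨(φ s)⁻¹ * φ f, ?_⟩
    rw [map_mul, ← h1, ← mul_assoc, ← map_mul, inv_mul_cancel₀ h0, map_one, one_mul]
  refine ⟨⟨x, hbij⟩, hx, ?_⟩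
  ext f
  apply (algebraMap k (IsLocalRing.ResidueField (X.presheaf.stalk x))).injective
  rw [← hval f]
  exact algebraMap_ratValue ⟨x, hbij⟩ _

end Values

/-! ### Density of the real points -/

section Density

variable {k : Type u} [Field k] {X : Scheme.{u}} [X.Over (Spec (.of k))] [IsIntegral X]
  [LocallyOfFiniteType (X ↘ Spec (.of k))]

/-- A derivation of the function field which preserves a local ring preserves the ring of sections
on an affine neighbourhood after multiplication by a function which does not vanish at the
point. -/
theorem exists_derivation_sections {U : X.Opens} (hU : IsAffineOpen U) {x : X} (hx : x ∈ U)
    (δ : Derivation k X.functionField X.functionField)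
    (hδ : ∀ a ∈ localRing k x, δ a ∈ localRing k x) :
    ∃ (g : Γ(X, U)) (D : Derivation k Γ(X, U) Γ(X, U)), x ∈ X.basicOpen g ∧
      ∀ f, sectionHom k (genericPoint_mem hx) (D f) = sectionHom k (genericPoint_mem hx) g *
        δ (sectionHom k (genericPoint_mem hx) f) := by
  set ι := sectionHom k (genericPoint_mem hx) with hι
  obtain ⟨S, hS⟩ := (finiteType_sections k hU).out
  -- g clears the denominators of δ on algebra generators; by the Leibniz rule g δ then preserves
  -- the whole ring of sections.
  obtain ⟨g, hg, hgS⟩ := exists_common_denominator (k := k) hU hx S (fun f => δ (ι f))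
    fun f _ => hδ _ (sectionHom_mem_localRing hx _ f)
  have hmem (f : Γ(X, U)) : ι g * δ (ι f) ∈ ι.range := by
    have hf : f ∈ Algebra.adjoin k (S : Set Γ(X, U)) := hS ▸ Algebra.mem_top
    induction hf using Algebra.adjoin_induction with
    | mem f hf => exact hgS f hf
    | algebraMap c => rw [AlgHom.commutes, Derivation.map_algebraMap, mul_zero]; exact zero_mem _
    | add f f' _ _ hf hf' => rw [map_add, map_add, mul_add]; exact add_mem hf hf'
    | mul f f' _ _ hf hf' =>
      rw [map_mul, Derivation.leibniz, smul_eq_mul, smul_eq_mul, mul_add, mul_left_comm,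
        mul_left_comm (ι g)]
      exact add_mem (mul_mem ⟨f, rfl⟩ hf') (mul_mem ⟨f', rfl⟩ hf)
  have hinj : Function.Injective ι := sectionHom_injective _
  choose D hD using hmem
  have hD' (f) : ι (D f) = ι g * δ (ι f) := hD f
  let D₀ : Γ(X, U) →ₗ[k] Γ(X, U) :=
    { toFun := D
      map_add' := fun a b => hinj (by simp only [map_add, hD', mul_add])
      map_smul' := fun c a => hinj (by
        simp only [map_smul, hD', RingHom.id_apply, Derivation.map_smul, mul_smul_comm]) }
  refine ⟨g, Derivation.mk' D₀ fun a b => hinj ?_, hg, hD'⟩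
  · simp only [D₀, LinearMap.coe_mk, AddHom.coe_mk, smul_eq_mul, map_add, map_mul, hD',
      Derivation.leibniz, mul_add]
    ring

/-- The real points of a neighbourhood of a regular real point are dense. -/
theorem eq_zero_of_forall_evalAt {X : Scheme.{0}} [X.Over (Spec (.of ℝ))] [IsIntegral X]
    [LocallyOfFiniteType (X ↘ Spec (.of ℝ))] (hreg : IsRegularScheme X) (x : RatPt ℝ X)
    {U : X.Opens} (hx : x.1 ∈ U) (s : Γ(X, U))
    (h : ∀ (y : RatPt ℝ X) (hy : y.1 ∈ U), evalAt y hy s = 0) : s = 0 := by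
  obtain ⟨W, hW, hxW, hWU⟩ := exists_isAffineOpen_mem_and_subset hx
  have hWU : W ≤ U := hWU
  have := hreg x.1
  have := finiteType_sections ℝ hW
  obtain ⟨d, c, hc⟩ := exists_localCoordinates_stalk ℝ hW hxW
    (isMaximal_primeIdealOf_ratPt hW x hxW) (hreg x.1)
  -- Germs of functions on W vanishing at all its real points. A multiple of ∂_i by a function g
  -- invertible at x is a derivation of the ring of sections over W, so it preserves S by
  -- `derivation_vanishing`.
  let S : Set (X.presheaf.stalk x.1) :=
    {a | ∃ f : Γ(X, W), (∀ φ : Γ(X, W) →ₐ[ℝ] ℝ, φ f = 0) ∧ X.presheaf.germ W x.1 hxW f = a}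
  have hS : ∀ a ∈ S, a = 0 := by
    refine c.eq_zero_of_stable hc ?_ ?_
    · rintro _ ⟨f, hf, rfl⟩
      exact ratValue_eq_zero_iff.1 (hf (evalAt x hxW))
    · rintro i _ ⟨f, hf, rfl⟩
      obtain ⟨g, D, hg, hD⟩ := exists_derivation_sections hW hxW (c.der i) (by
        rintro _ ⟨a, rfl⟩
        exact ⟨c.derR i a, (c.der_algebraMap i a).symm⟩)
      refine ⟨X.presheaf.germ W x.1 hxW g, (Scheme.mem_basicOpen X g x.1 hxW).1 hg, D f,
        derivation_vanishing D hf, ?_⟩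
      apply IsFractionRing.injective (X.presheaf.stalk x.1) X.functionField
      rw [map_mul, ← c.der_algebraMap, algebraMap_germ' (k := ℝ), algebraMap_germ' (k := ℝ),
        algebraMap_germ' (k := ℝ), hD]
  have h0 := hS _ ⟨X.presheaf.map (homOfLE hWU).op s, fun φ => by
    obtain ⟨y, hy, rfl⟩ := exists_ratPt_of_algHom hW φ
    rw [← h y (hWU hy), evalAt_apply, evalAt_apply]
    exact congrArg _ (TopCat.Presheaf.germ_res_apply X.presheaf (homOfLE hWU) y.1 hy s), rfl⟩
  have h1 := (TopCat.Presheaf.germ_res_apply X.presheaf (homOfLE hWU) x.1 hxW s).symm.trans h0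
  exact germ_injective_of_isIntegral X x.1 hx (h1.trans (map_zero _).symm)

end Density

/-! ### Functionals of finite order at a rational point -/

section LocalFunctionals

open IsLocalRing

variable {k R P : Type*} [Field k] [CommRing R] [IsLocalRing R] [Algebra k R] [AddCommGroup P]
  [Module k P] [Module R P] [IsScalarTower k R P]
  (hk : Function.Surjective (algebraMap k (ResidueField R)))

include hk

/-- At a rational point a = c + t with c constant and t in the maximal ideal. So [l, a](w) = l(t w),
and commutators kill successively lower powers of the maximal ideal. -/
theorem isDO_of_forall_mem_pow_smul {n : ℕ} {l : P →ₗ[k] ResidueField R}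
    (h : ∀ w ∈ (maximalIdeal R ^ n • ⊤ : Submodule R P), l w = 0) : IsDO R n l := by
  induction n generalizing l with
  | zero =>
    ext w
    exact h w (by simp)
  | succ n ih =>
    intro a
    refine ih fun w hw => ?_
    obtain ⟨c, hc⟩ := hk (residue R a)
    have ha : a - algebraMap k R c ∈ maximalIdeal R := by
      rw [← residue_eq_zero_iff, map_sub, ← hc, sub_eq_zero]
      rfl
    have h1 := h ((a - algebraMap k R c) • w) (by
      rw [pow_succ', mul_smul]
      exact Submodule.smul_mem_smul ha hw)
    have h2 : l (c • w) = c • l w := l.map_smul c w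
    rw [sub_smul, algebraMap_smul, map_sub, h2, sub_eq_zero] at h1
    rw [bracket_apply, h1, Algebra.smul_def c, hc, Algebra.smul_def a]
    exact sub_self _

/-- The vectors of the span lying in 𝔪ⁿ P form a decreasing sequence of finite-dimensional spaces,
zero for large n by Krull's intersection theorem. The family thus stays independent in P / 𝔪ⁿ P,
where dual functionals exist; no separatedness is needed. -/
theorem exists_dual_functionals_of_linearIndependent [IsNoetherianRing R] [Module.Finite R P]
    {m : ℕ} {w : Fin m → P} (hw : LinearIndependent k w) :
    ∃ (n : ℕ) (l : Fin m → P →ₗ[k] ResidueField R), (∀ i, IsDO R (n + 1) (l i)) ∧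
      ∀ i j, l i (w j) = if i = j then 1 else 0 := by
  let T := Fintype.linearCombination k w
  have hT : LinearMap.ker T = ⊥ := LinearMap.ker_eq_bot'.2 fun g hg =>
    funext (Fintype.linearIndependent_iff.1 hw g hg)
  let G (n : ℕ) : Submodule R P := maximalIdeal R ^ n • ⊤
  let F : ℕ →o (Submodule k (Fin m → k))ᵒᵈ :=
    ⟨fun n => OrderDual.toDual (((G n).restrictScalars k).comap T), fun a b hab v hv =>
      Submodule.smul_mono_left (Ideal.pow_le_pow_right hab) hv⟩
  obtain ⟨n, hn⟩ := IsArtinian.monotone_stabilizes F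
  have hFn : ∀ v, T v ∈ G n → v = 0 := by
    intro v hv
    rw [← Submodule.mem_bot k, ← hT, LinearMap.mem_ker, ← Submodule.mem_bot R,
      ← Ideal.iInf_pow_smul_eq_bot_of_isLocalRing (M := P) (maximalIdeal R)
        (Ideal.IsPrime.ne_top inferInstance), Submodule.mem_iInf]
    intro i
    rcases le_total i n with h | h
    · exact Submodule.smul_mono_left (Ideal.pow_le_pow_right h) hv
    · have e : ((G n).restrictScalars k).comap T = ((G i).restrictScalars k).comap T := hn i h
      exact e.le hv
  have hinj : LinearMap.ker ((G n).mkQ.restrictScalars k ∘ₗ T) = ⊥ := by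
    rw [LinearMap.ker_eq_bot']
    intro v hv
    exact hFn v ((Submodule.Quotient.mk_eq_zero _).1 hv)
  obtain ⟨g, hg⟩ := LinearMap.exists_leftInverse_of_injective _ hinj
  refine ⟨n, fun i => Algebra.linearMap k (ResidueField R) ∘ₗ LinearMap.proj i ∘ₗ g ∘ₗ
    (G n).mkQ.restrictScalars k, fun i => (isDO_of_forall_mem_pow_smul hk fun v hv => ?_).succ,
    fun i j => ?_⟩
  · have : (G n).mkQ v = 0 := (Submodule.Quotient.mk_eq_zero _).2 hv
    simp only [LinearMap.comp_apply, LinearMap.restrictScalars_apply, this, map_zero]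
  · have h1 := LinearMap.congr_fun hg (Pi.single j 1)
    have h2 : T (Pi.single j 1) = w j := by simp [T]
    rw [LinearMap.comp_apply, LinearMap.comp_apply, h2] at h1
    simp only [LinearMap.comp_apply, h1]
    simp [Pi.single_apply]

end LocalFunctionals

/-! ### Rational functions with a value at a rational point -/

section HasValue

variable {k : Type u} [Field k] {X : Scheme.{u}} [X.Over (Spec (.of k))] [IsIntegral X]

/-- The rational function `τ` is regular at `x` and has value `c`. -/
def HasValue (x : RatPt k X) (τ : X.functionField) (c : k) : Prop :=
  ∃ a : X.presheaf.stalk x.1, algebraMap _ X.functionField a = τ ∧ ratValue x a = c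

namespace HasValue

variable {x : RatPt k X} {τ τ' : X.functionField} {c c' : k}

theorem mem (h : HasValue x τ c) : τ ∈ localRing k x.1 :=
  let ⟨a, ha, _⟩ := h
  ⟨a, ha⟩

theorem sub (h : HasValue x τ c) (h' : HasValue x τ' c') : HasValue x (τ - τ') (c - c') := by
  obtain ⟨a, rfl, rfl⟩ := h
  obtain ⟨b, rfl, rfl⟩ := h'
  exact ⟨a - b, map_sub _ _ _, map_sub _ _ _⟩

theorem mul (h : HasValue x τ c) (h' : HasValue x τ' c') : HasValue x (τ * τ') (c * c') := by
  obtain ⟨a, rfl, rfl⟩ := h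
  obtain ⟨b, rfl, rfl⟩ := h'
  exact ⟨a * b, map_mul _ _ _, map_mul _ _ _⟩

theorem unique (h : HasValue x τ c) (h' : HasValue x τ c') : c = c' := by
  obtain ⟨a, rfl, rfl⟩ := h
  obtain ⟨b, hb, rfl⟩ := h'
  rw [IsFractionRing.injective (X.presheaf.stalk x.1) X.functionField hb]

theorem inv_mem (h : HasValue x τ c) (hc : c ≠ 0) : τ ≠ 0 ∧ τ⁻¹ ∈ localRing k x.1 := by
  obtain ⟨a, rfl, rfl⟩ := h
  obtain ⟨b, hb⟩ := isUnit_iff_exists_inv.1 (ratValue_ne_zero_iff.1 hc)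
  have hb' := congrArg (algebraMap (X.presheaf.stalk x.1) X.functionField) hb
  rw [map_mul, map_one] at hb'
  exact ⟨left_ne_zero_of_mul_eq_one hb', b, eq_inv_of_mul_eq_one_right hb'⟩

theorem sectionHom {U : X.Opens} (hx : x.1 ∈ U) (hη : genericPoint X ∈ U) (f : Γ(X, U)) :
    HasValue x (sectionHom k hη f) (evalAt x hx f) :=
  ⟨X.presheaf.germ U x.1 hx f, algebraMap_germ' hx f, rfl⟩

theorem aeval {N : ℕ} {τ : Fin N → X.functionField} {c : Fin N → k}
    (h : ∀ i, HasValue x (τ i) (c i)) (p : MvPolynomial (Fin N) k) :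
    HasValue x (MvPolynomial.aeval τ p) (MvPolynomial.eval c p) := by
  choose a ha hac using h
  refine ⟨MvPolynomial.aeval a p, ?_, ?_⟩
  · rw [← MvPolynomial.aeval_algebraMap_apply]
    congr 2
    exact funext ha
  · have : (ratValue x).comp (MvPolynomial.aeval a) = MvPolynomial.aeval c := by
      ext i
      simp [hac]
    rw [← MvPolynomial.coe_aeval_eq_eval, ← this]
    rfl

end HasValue

/-- A rational function which is regular at `x` is given by a section near `x`. -/
theorem exists_sectionHom_eq {x : X} {τ : X.functionField} (h : τ ∈ localRing k x) :
    ∃ (U : X.Opens) (hx : x ∈ U) (f : Γ(X, U)), sectionHom k (genericPoint_mem hx) f = τ := by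
  obtain ⟨a, rfl⟩ := mem_localRing.1 h
  obtain ⟨U, hx, f, rfl⟩ := exists_germ_eq_of_stalk x a
  exact ⟨U, hx, f, (algebraMap_germ' hx f).symm⟩

end HasValue

/-! ### Regular functions on the real points as rational functions -/

section RealPoints

variable {X : Scheme.{0}} [X.Over (Spec (.of ℝ))] [IsIntegral X]
    [LocallyOfFiniteType (X ↘ Spec (.of ℝ))] (hreg : IsRegularScheme X)

include hreg

/-- Density of the real points, in the form used for rational functions: near x, τ is a section all
of whose values vanish. -/
theorem eq_zero_of_hasValue {U : X.Opens} {x : RatPt ℝ X} (hx : x.1 ∈ U) {τ : X.functionField}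
    (h : ∀ y : RatPt ℝ X, y.1 ∈ U → HasValue y τ 0) : τ = 0 := by
  obtain ⟨W, hxW, f, rfl⟩ := exists_sectionHom_eq (h x hx).mem
  have hWU : W ⊓ U ≤ W := inf_le_left
  have := eq_zero_of_forall_evalAt hreg x (U := W ⊓ U) ⟨hxW, hx⟩
    (X.presheaf.map (homOfLE hWU).op f) fun y hy => by
      refine HasValue.unique (HasValue.sectionHom hy (genericPoint_mem hy) _) ?_
      rw [sectionHom_res hWU]
      exact h y hy.2
  have hη : genericPoint X ∈ W ⊓ U := genericPoint_mem (x := x.1) ⟨hxW, hx⟩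
  rw [← sectionHom_res hWU hη, this, map_zero]

/-- Every nonempty open set has a real point, if there is a real point. -/
theorem exists_ratPt_mem (x₀ : RatPt ℝ X) {W : X.Opens} (hW : genericPoint X ∈ W) :
    ∃ x : RatPt ℝ X, x.1 ∈ W := by
  obtain ⟨U, hU, hx₀, -⟩ := exists_isAffineOpen_mem_and_subset (x := x₀.1) (U := ⊤) trivial
  obtain ⟨f, hf, hη⟩ := hU.exists_basicOpen_le ⟨genericPoint X, hW⟩ (genericPoint_mem hx₀)
  by_contra! hne
  have h0 := eq_zero_of_forall_evalAt hreg x₀ hx₀ f fun y hy => by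
    by_contra h
    exact hne y (hf ((mem_basicOpen_iff_evalAt y hy f).2 h))
  rw [h0, Scheme.basicOpen_zero] at hη
  exact hη

/-- Functions on `X(ℝ)` which are locally given by sections are given by a rational function. -/
theorem exists_functionField_of_isRegularOn (x₀ : RatPt ℝ X) {φ : RatPt ℝ X → ℝ}
    (h : IsRegularOn ℝ X Set.univ φ) : ∃ τ : X.functionField, ∀ x, HasValue x τ (φ x) := by
  have h' (x : RatPt ℝ X) : ∃ (U : X.Opens) (hx : x.1 ∈ U) (s : Γ(X, U)),
      ∀ (y : RatPt ℝ X) (hy : y.1 ∈ U), φ y = evalAt y hy s := by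
    obtain ⟨U, hx, s, hs⟩ := h x trivial
    refine ⟨U, hx, s, fun y hy => ?_⟩
    apply (algebraMap ℝ (IsLocalRing.ResidueField (X.presheaf.stalk y.1))).injective
    rw [hs y trivial hy, evalAt_apply, algebraMap_ratValue]
  choose U hU s hs using h'
  refine ⟨sectionHom ℝ (genericPoint_mem (hU x₀)) (s x₀), fun x => ?_⟩
  have hη : genericPoint X ∈ U x₀ ⊓ U x := ⟨genericPoint_mem (hU x₀), genericPoint_mem (hU x)⟩
  obtain ⟨y, hy⟩ := exists_ratPt_mem hreg x₀ hη
  -- Both sections have the values φ on their overlap, which contains a real point, so they define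
  -- the same rational function.
  have key : sectionHom ℝ (genericPoint_mem (hU x)) (s x) -
      sectionHom ℝ (genericPoint_mem (hU x₀)) (s x₀) = 0 := by
    refine eq_zero_of_hasValue hreg hy fun z hz => ?_
    have := (HasValue.sectionHom hz.2 (genericPoint_mem (hU x)) (s x)).sub
      (HasValue.sectionHom hz.1 (genericPoint_mem (hU x₀)) (s x₀))
    rwa [← hs, ← hs, sub_self] at this
  rw [← sub_eq_zero.1 key, hs x x (hU x)]
  exact HasValue.sectionHom _ _ _

/-- If `X(ℝ)` is affine, its regular functions are the quotients of polynomials in finitely many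
rational functions on `X`. -/
theorem exists_coordinates (x₀ : RatPt ℝ X) (hX : IsAffineRatPt ℝ X) :
    ∃ (N : ℕ) (ev : RatPt ℝ X → Fin N → ℝ) (Φ : MvPolynomial (Fin N) ℝ →ₐ[ℝ] X.functionField),
      (∀ x p, HasValue x (Φ p) (MvPolynomial.eval (ev x) p)) ∧
      ∀ x : RatPt ℝ X, ∀ τ ∈ localRing ℝ x.1, ∃ p q,
        MvPolynomial.eval (ev x) q ≠ 0 ∧ Φ q * τ = Φ p := by
  classical
  obtain ⟨N, I, e, htop, hfun⟩ := hX
  have hcoord (i : Fin N) : ∃ τ : X.functionField, ∀ x, HasValue x τ ((e x).1 i) := by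
    refine exists_functionField_of_isRegularOn hreg x₀ ((hfun Set.univ isOpen_univ
      (fun z => z.1 i)).1 fun z _ => ⟨MvPolynomial.X i, 1, by simp, fun w _ _ => by simp⟩)
  choose τ hτ using hcoord
  have hval (x p) : HasValue x (MvPolynomial.aeval τ p) (MvPolynomial.eval (e x).1 p) :=
    HasValue.aeval (fun i => hτ i x) p
  refine ⟨N, fun x => (e x).1, MvPolynomial.aeval τ, hval, fun x σ hσ => ?_⟩
  obtain ⟨U, hx, f, rfl⟩ := exists_sectionHom_eq hσ
  let O : Set (RatPt ℝ X) := {y | y.1 ∈ U}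
  have hO : IsOpen O := U.isOpen.preimage continuous_subtype_val
  let φ : RatPt ℝ X → ℝ := fun y => if hy : y.1 ∈ U then evalAt y hy f else 0
  have hφ : IsRegularOn ℝ X O ((φ ∘ e.symm) ∘ e) := by
    intro y hy
    refine ⟨U, hy, f, fun z hz hz' => ?_⟩
    have h1 : ((φ ∘ e.symm) ∘ e) z = evalAt z hz' f := by
      rw [Function.comp_apply, Function.comp_apply, Equiv.symm_apply_apply]
      exact dif_pos hz'
    rw [h1, evalAt_apply, algebraMap_ratValue]
  obtain ⟨p, q, hq, hpq⟩ := (hfun O hO (φ ∘ e.symm)).2 hφ (e x) ⟨x, hx, rfl⟩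
  refine ⟨p, q, hq, ?_⟩
  have h0 := ((hval x q).inv_mem hq).1
  -- The equality f = p / q is known only where q does not vanish; the extra factor q makes the
  -- identity hold at the remaining real points of U.
  have key : MvPolynomial.aeval τ q * (MvPolynomial.aeval τ q *
      sectionHom ℝ (genericPoint_mem hx) f - MvPolynomial.aeval τ p) = 0 := by
    refine eq_zero_of_hasValue hreg hx fun y hy => ?_
    have h1 := (hval y q).mul (((hval y q).mul
      (HasValue.sectionHom hy (genericPoint_mem hx) f)).sub (hval y p))
    convert h1 using 1
    by_cases hqy : MvPolynomial.eval (e y).1 q = 0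
    · rw [hqy, zero_mul]
    · have := hpq (e y) ⟨y, hy, rfl⟩ hqy
      simp only [Function.comp_apply, Equiv.symm_apply_apply, φ, dif_pos hy] at this
      rw [this, mul_div_cancel₀ _ hqy, sub_self, mul_zero]
  exact sub_eq_zero.1 ((mul_eq_zero.1 key).resolve_left h0)

end RealPoints

/-! ### Dual operators integral at all real points -/

section RealDual

variable {X : Scheme.{0}} [X.Over (Spec (.of ℝ))] [IsIntegral X]
  [LocallyOfFiniteType (X ↘ Spec (.of ℝ))] {M : X.Modules}

/-- Dual operators of a linearly independent family, integral at `x` on a given lattice. -/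
theorem exists_dual_operators_at (hreg : IsRegularScheme X) (hM : M.IsLocallyFreeOfFiniteRank)
    (x : RatPt ℝ X) (G : Finset (genericStalk M)) {m : ℕ} {v : Fin m → genericStalk M}
    (hvG : ∀ j, v j ∈ G) (hv : LinearIndependent ℝ v) :
    ∃ (n : ℕ) (q : Fin m → genericStalk M →ₗ[ℝ] X.functionField),
      (∀ i, IsDO X.functionField (n + 1) (q i)) ∧
      (∀ i, ∀ w ∈ Submodule.span (localRing ℝ x.1) (G : Set (genericStalk M)),
        q i w ∈ localRing ℝ x.1) ∧
      ∀ i j, q i (v j) = if i = j then 1 else 0 := by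
  obtain ⟨U, hx, -, hU, r, e, he⟩ := exists_frame hM (x := x.1) (O := ⊤) trivial
  have := hreg x.1
  obtain ⟨d, c, -⟩ := exists_localCoordinates_stalk ℝ hU hx
    (isMaximal_primeIdealOf_ratPt hU x hx) (hreg x.1)
  obtain ⟨b₀, -⟩ := exists_basis_of_isFrame ℝ hM (genericPoint_mem hx) he
  -- Elements of G need not lie in the stalk at x. Dividing the basis by a common denominator γ of
  -- their coordinates puts G into a free lattice over the local ring, where Krull's argument
  -- applies.
  obtain ⟨g, hg⟩ := IsLocalization.exist_integer_multiples
    (nonZeroDivisors (X.presheaf.stalk x.1)) (G ×ˢ (Finset.univ : Finset (Fin r)))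
    fun p => b₀.repr p.1 p.2
  set γ := algebraMap (X.presheaf.stalk x.1) X.functionField g with hγ
  have hγ0 : γ ≠ 0 := IsLocalization.to_map_ne_zero_of_mem_nonZeroDivisors _ le_rfl g.2
  let b := b₀.isUnitSMul (w := fun _ => γ⁻¹) fun _ => (isUnit_iff_ne_zero.2 (inv_ne_zero hγ0))
  let T : (Fin r → X.presheaf.stalk x.1) →ₗ[ℝ] genericStalk M :=
    { toFun := fun w => ∑ i, algebraMap (X.presheaf.stalk x.1) X.functionField (w i) • b i
      map_add' := fun w w' => by simp [add_smul, Finset.sum_add_distrib]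
      map_smul' := fun a w => by
        simp only [Pi.smul_apply, RingHom.id_apply, Finset.smul_sum, smul_assoc,
          Algebra.algebraMap_eq_smul_one] }
  have hT (w) : T w = ∑ i, algebraMap (X.presheaf.stalk x.1) X.functionField (w i) • b i := rfl
  have hG : ∀ y ∈ G, ∃ w, T w = y := by
    intro y hy
    choose w hw using fun i => hg (y, i) (by simp [hy])
    refine ⟨w, ?_⟩
    refine (hT w).trans ((Finset.sum_congr rfl fun i _ => ?_).trans (b₀.sum_repr y))
    rw [hw i, Module.Basis.isUnitSMul_apply, smul_smul]
    congr 1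
    rw [Algebra.smul_def]
    change γ * _ * γ⁻¹ = _
    field_simp
  choose w hw using fun j => hG (v j) (hvG j)
  have hwli : LinearIndependent ℝ w := by
    refine LinearIndependent.of_comp T ?_
    convert hv
    exact funext hw
  obtain ⟨n, l, hl, hlw⟩ := exists_dual_functionals_of_linearIndependent
    (R := X.presheaf.stalk x.1) x.2.2 hwli
  obtain ⟨q, hq, hqi, hqv⟩ := c.exists_dual_operators b hl w hlw
  refine ⟨n, q, hq, fun i y hy => ?_, fun i j => ?_⟩
  · obtain ⟨w, rfl⟩ : ∃ w, T w = y := by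
      induction hy using Submodule.span_induction with
      | mem y hy => exact hG y hy
      | zero => exact ⟨0, map_zero T⟩
      | add y y' _ _ hy hy' =>
        obtain ⟨w, rfl⟩ := hy
        obtain ⟨w', rfl⟩ := hy'
        exact ⟨w + w', map_add T _ _⟩
      | smul a y _ hy =>
        obtain ⟨w, rfl⟩ := hy
        obtain ⟨_, a, rfl⟩ := a
        refine ⟨a • w, ?_⟩
        change T (a • w) = (algebraMap (X.presheaf.stalk x.1) X.functionField a) • T w
        simp only [hT, Pi.smul_apply, smul_eq_mul, map_mul, mul_smul, Finset.smul_sum]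
    obtain ⟨a, ha⟩ := hqi i w
    exact ⟨a, ha.symm⟩
  · rw [← hqv i j, ← hw j]
    rfl

variable {N : ℕ} {ev : RatPt ℝ X → Fin N → ℝ} {Φ : MvPolynomial (Fin N) ℝ →ₐ[ℝ] X.functionField}
  (hval : ∀ x p, HasValue x (Φ p) (MvPolynomial.eval (ev x) p))
  (hfrac : ∀ x : RatPt ℝ X, ∀ τ ∈ localRing ℝ x.1, ∃ p q,
    MvPolynomial.eval (ev x) q ≠ 0 ∧ Φ q * τ = Φ p)

omit [LocallyOfFiniteType (X ↘ Spec (.of ℝ))] in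
include hfrac in
theorem exists_polynomial_denominator (x : RatPt ℝ X) {ι : Type*} (t : Finset ι)
    (a : ι → X.functionField) (ha : ∀ i ∈ t, a i ∈ localRing ℝ x.1) :
    ∃ q, MvPolynomial.eval (ev x) q ≠ 0 ∧ ∀ i ∈ t, Φ q * a i ∈ Φ.range := by
  classical
  induction t using Finset.induction_on with
  | empty => exact ⟨1, by simp, by simp⟩
  | insert i t hi ih =>
    obtain ⟨s, hs, hs'⟩ := ih fun j hj => ha j (by simp [hj])
    obtain ⟨p, q, hq, hpq⟩ := hfrac x (a i) (ha i (by simp))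
    refine ⟨s * q, by simp [hs, hq], fun j hj => ?_⟩
    rcases Finset.mem_insert.1 hj with rfl | hj
    · rw [map_mul, mul_assoc, hpq]
      exact mul_mem ⟨s, rfl⟩ ⟨p, rfl⟩
    · rw [map_mul, mul_right_comm]
      exact mul_mem (hs' j hj) ⟨q, rfl⟩

include hval hfrac

omit [LocallyOfFiniteType (X ↘ Spec (.of ℝ))] in
/-- A differential operator which maps a lattice over the ring of polynomials to the local ring is
integral on the localization of the lattice. -/
theorem mem_localRing_of_span (x : RatPt ℝ X) (G : Finset (genericStalk M)) {n : ℕ}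
    {q : genericStalk M →ₗ[ℝ] X.functionField} (hq : IsDO X.functionField n q)
    (h : ∀ w ∈ Submodule.span Φ.range (G : Set (genericStalk M)), q w ∈ localRing ℝ x.1) :
    ∀ w ∈ Submodule.span (localRing ℝ x.1) (G : Set (genericStalk M)), q w ∈ localRing ℝ x.1 := by
  intro w hw
  obtain ⟨c, -, rfl⟩ := Submodule.mem_span_finset.1 hw
  obtain ⟨s, hs, hs'⟩ := exists_polynomial_denominator hfrac x G (fun g => (c g : X.functionField))
    fun g _ => (c g).2
  obtain ⟨h0, hinv⟩ := (hval x s).inv_mem hs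
  have hw' : Φ s • ∑ g ∈ G, c g • g ∈ Submodule.span Φ.range (G : Set (genericStalk M)) := by
    rw [Finset.smul_sum]
    refine Submodule.sum_mem _ fun g hg => ?_
    have : Φ s • c g • g = (⟨_, hs' g hg⟩ : Φ.range) • g := (mul_smul _ _ _).symm
    rw [this]
    exact Submodule.smul_mem _ _ (Submodule.subset_span hg)
  rw [← inv_smul_smul₀ h0 (∑ g ∈ G, c g • g)]
  exact hq.mem_of_inv (L := Subalgebra.toSubmodule (localRing ℝ x.1)) h0
    (fun a ha => (localRing ℝ x.1).mul_mem (hval x s).mem ha)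
    (fun a ha => (localRing ℝ x.1).mul_mem hinv ha)
    (S := Submodule.span Φ.range (G : Set (genericStalk M)))
    (fun m hm => Submodule.smul_mem _ (⟨_, s, rfl⟩ : Φ.range) hm) h _ hw'

omit [LocallyOfFiniteType (X ↘ Spec (.of ℝ))] in
/-- A differential operator which is integral on a lattice at a real point becomes integral at all
real points after multiplication by a polynomial which does not vanish at the point. -/
theorem exists_polynomial_mul (x : RatPt ℝ X) (G : Finset (genericStalk M)) {n : ℕ}
    {q : genericStalk M →ₗ[ℝ] X.functionField} (hq : IsDO X.functionField n q)
    (h : ∀ w ∈ Submodule.span (localRing ℝ x.1) (G : Set (genericStalk M)),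
      q w ∈ localRing ℝ x.1) :
    ∃ s, MvPolynomial.eval (ev x) s ≠ 0 ∧ ∀ y : RatPt ℝ X,
      ∀ w ∈ Submodule.span (localRing ℝ y.1) (G : Set (genericStalk M)),
        Φ s * q w ∈ localRing ℝ y.1 := by
  have hΦ : Φ.range.FG := by
    rw [← Algebra.map_top]
    exact (inferInstance : Algebra.FiniteType ℝ (MvPolynomial (Fin N) ℝ)).out.map _
  have hΦx (x : RatPt ℝ X) {a : X.functionField} (ha : a ∈ Φ.range) : a ∈ localRing ℝ x.1 := by
    obtain ⟨p, rfl⟩ := ha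
    exact (hval x p).mem
  obtain ⟨t, ht⟩ := hq.fg_span_image hΦ
    (Submodule.fg_span G.finite_toSet : (Submodule.span Φ.range (G : Set (genericStalk M))).FG)
  have hsub : ∀ w ∈ Submodule.span Φ.range (G : Set (genericStalk M)),
      w ∈ Submodule.span (localRing ℝ x.1) (G : Set (genericStalk M)) := by
    intro w hw
    induction hw using Submodule.span_induction with
    | mem w hw => exact Submodule.subset_span hw
    | zero => exact zero_mem _
    | add w w' _ _ hw hw' => exact add_mem hw hw'
    | smul a w _ hw => exact Submodule.smul_mem _ (⟨a.1, hΦx x a.2⟩ : localRing ℝ x.1) hw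
  have hloc : ∀ a ∈ Submodule.span Φ.range
      (q '' (Submodule.span Φ.range (G : Set (genericStalk M)) : Set (genericStalk M))),
      a ∈ localRing ℝ x.1 := by
    intro a ha
    induction ha using Submodule.span_induction with
    | mem a ha => obtain ⟨w, hw, rfl⟩ := ha; exact h w (hsub w hw)
    | zero => exact zero_mem _
    | add a b _ _ ha hb => exact add_mem ha hb
    | smul c a _ ha => exact (localRing ℝ x.1).mul_mem (hΦx x c.2) ha
  obtain ⟨s, hs, hs'⟩ := exists_polynomial_denominator hfrac x t id fun a ha =>
    hloc a (ht ▸ Submodule.subset_span ha)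
  refine ⟨s, hs, fun y => mem_localRing_of_span hval hfrac y G (hq.lsmul_comp (Φ s))
    fun w hw => hΦx y ?_⟩
  have hw' : q w ∈ Submodule.span Φ.range (t : Set X.functionField) :=
    ht ▸ Submodule.subset_span ⟨w, hw, rfl⟩
  change Φ s * q w ∈ _
  generalize q w = b at hw'
  induction hw' using Submodule.span_induction with
  | mem a ha => exact hs' a ha
  | zero => rw [mul_zero]; exact zero_mem _
  | add a b _ _ ha hb => rw [mul_add]; exact add_mem ha hb
  | smul c a _ ha =>
    change _ * (c.1 * a) ∈ _
    rw [mul_left_comm]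
    exact mul_mem c.2 ha

/-- Dual operators of a linearly independent family, integral at all real points on a given
lattice. -/
theorem exists_dual_operators_real (hreg : IsRegularScheme X) (hM : M.IsLocallyFreeOfFiniteRank)
    (G : Finset (genericStalk M)) {m : ℕ} {v : Fin m → genericStalk M}
    (hvG : ∀ j, v j ∈ G) (hv : LinearIndependent ℝ v) (x₀ : RatPt ℝ X) :
    ∃ (n : ℕ) (q : Fin m → genericStalk M →ₗ[ℝ] X.functionField),
      (∀ i, IsDO X.functionField (n + 1) (q i)) ∧
      (∀ (x : RatPt ℝ X) (i), ∀ w ∈ Submodule.span (localRing ℝ x.1) (G : Set (genericStalk M)),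
        q i w ∈ localRing ℝ x.1) ∧
      ∀ i j, q i (v j) = if i = j then 1 else 0 := by
  -- The analogue of `dualIdeal` with polynomials in the coordinates of X(ℝ) as multipliers. The
  -- order n may depend on the polynomial.
  let J : Ideal (MvPolynomial (Fin N) ℝ) :=
    { carrier := {p | ∃ (n : ℕ) (q : Fin m → genericStalk M →ₗ[ℝ] X.functionField),
        (∀ i, IsDO X.functionField (n + 1) (q i)) ∧
        (∀ (x : RatPt ℝ X) (i), ∀ w ∈ Submodule.span (localRing ℝ x.1) (G : Set (genericStalk M)),
          q i w ∈ localRing ℝ x.1) ∧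
        ∀ i j, q i (v j) = if i = j then Φ p else 0}
      zero_mem' := ⟨0, 0, fun i => IsDO.zero _, fun x i w _ => zero_mem _, fun i j => by simp⟩
      add_mem' := by
        rintro a b ⟨n, q, hq, hqx, hqv⟩ ⟨n', q', hq', hqx', hqv'⟩
        refine ⟨max n n', q + q', fun i => ((hq i).mono (by omega)).add ((hq' i).mono (by omega)),
          fun x i w hw => add_mem (hqx x i w hw) (hqx' x i w hw), fun i j => ?_⟩
        rw [Pi.add_apply, LinearMap.add_apply, hqv, hqv']
        split_ifs <;> simp
      smul_mem' := by
        rintro a b ⟨n, q, hq, hqx, hqv⟩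
        refine ⟨n, fun i => Algebra.lsmul ℝ ℝ _ (Φ a) ∘ₗ q i, fun i => (hq i).lsmul_comp _,
          fun x i w hw => mul_mem (hval x a).mem (hqx x i w hw), fun i j => ?_⟩
        rw [LinearMap.comp_apply, hqv]
        split_ifs <;> simp }
  have hJ (x : RatPt ℝ X) : ∃ p ∈ J, MvPolynomial.eval (ev x) p ≠ 0 := by
    obtain ⟨n, q, hq, hqx, hqv⟩ := exists_dual_operators_at hreg hM x G hvG hv
    choose s hs hs' using fun i => exists_polynomial_mul hval hfrac x G (hq i) (hqx i)
    refine ⟨∏ i, s i, ⟨n, fun i => Algebra.lsmul ℝ ℝ _ (Φ (∏ i, s i)) ∘ₗ q i,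
      fun i => (hq i).lsmul_comp _, fun y i w hw => ?_, fun i j => ?_⟩, ?_⟩
    · have := mul_mem (hval y (∏ j ∈ Finset.univ.erase i, s j)).mem (hs' i y w hw)
      rw [← mul_assoc, ← map_mul, Finset.prod_erase_mul _ _ (Finset.mem_univ i)] at this
      exact this
    · rw [LinearMap.comp_apply, hqv]
      split_ifs <;> simp
    · rw [map_prod]
      exact Finset.prod_ne_zero_iff.2 fun i _ => hs i
  obtain ⟨S, hS⟩ : J.FG := (isNoetherianRing_iff_ideal_fg _).1 inferInstance J
  -- J has no zero on X(ℝ) but need not contain 1. Over ℝ the sum of squares of its generators has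
  -- no zero on X(ℝ) either, so its image in the function field is a unit in the local ring of every
  -- real point and can be divided out.
  have hP : ∑ p ∈ S, p * p ∈ J := Ideal.sum_mem _ fun p hp =>
    J.mul_mem_left _ (hS ▸ Ideal.subset_span hp)
  have hP0 (x : RatPt ℝ X) : MvPolynomial.eval (ev x) (∑ p ∈ S, p * p) ≠ 0 := by
    intro h
    rw [map_sum] at h
    simp only [map_mul] at h
    rw [Finset.sum_eq_zero_iff_of_nonneg fun p _ => mul_self_nonneg _] at h
    obtain ⟨p, hp, hp0⟩ := hJ x
    have hle : J ≤ RingHom.ker (MvPolynomial.eval (ev x)) :=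
      hS ▸ Ideal.span_le.2 fun p hp => mul_self_eq_zero.1 (h p hp)
    exact hp0 (hle hp)
  obtain ⟨n, q, hq, hqx, hqv⟩ := hP
  have hΦ0 := ((hval x₀ _).inv_mem (hP0 x₀)).1
  refine ⟨n, fun i => Algebra.lsmul ℝ ℝ _ (Φ (∑ p ∈ S, p * p))⁻¹ ∘ₗ q i,
    fun i => (hq i).lsmul_comp _, fun x i w hw =>
      mul_mem ((hval x _).inv_mem (hP0 x)).2 (hqx x i w hw), fun i j => ?_⟩
  rw [LinearMap.comp_apply, hqv]
  split_ifs
  · exact inv_mul_cancel₀ hΦ0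
  · exact map_zero _

end RealDual

/-! ### Sections and operators on the real points -/

section StalkOperator

variable {k : Type u} [Field k] {X : Scheme.{u}} [X.Over (Spec (.of k))] [IsIntegral X]
  {M : X.Modules} (hM : M.IsLocallyFreeOfFiniteRank)

include hM in
/-- An endomorphism of the generic stalk which preserves the stalk at `y`, as an endomorphism of
this stalk. -/
theorem exists_stalk_operator {Q : genericStalk M →ₗ[k] genericStalk M} {y : X}
    (h : ∀ m, Q (toGeneric k M y m) ∈ LinearMap.range (toGeneric k M y)) :
    ∃ P : Module.End k (M.presheaf.stalk y), ∀ m, toGeneric k M y (P m) = Q (toGeneric k M y m) := by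
  let f := LinearEquiv.ofInjective (toGeneric k M y) (toGeneric_injective k hM y)
  refine ⟨f.symm.toLinearMap ∘ₗ LinearMap.codRestrict _ (Q ∘ₗ toGeneric k M y) h, fun m => ?_⟩
  exact congrArg Subtype.val (f.apply_symm_apply ⟨Q (toGeneric k M y m), h m⟩)

omit [IsIntegral X] in
/-- An intersection of finitely many neighbourhoods. -/
theorem exists_open_forall {x : X} {m : ℕ} {p : Fin m → X → Prop}
    (h : ∀ i, ∃ U : X.Opens, x ∈ U ∧ ∀ y ∈ U, p i y) :
    ∃ U : X.Opens, x ∈ U ∧ ∀ i, ∀ y ∈ U, p i y := by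
  choose U hxU hU using h
  exact ⟨Finset.univ.inf U, by simpa [← SetLike.mem_coe, Opens.coe_finset_inf] using hxU,
    fun i y hy => hU i y ((Finset.inf_le (Finset.mem_univ i) : _ ≤ U i) hy)⟩

end StalkOperator

/-! ### Reduction to interpolation on independent families -/

section Abstract

variable {D S E : Type*} [AddCommGroup D] [Module ℝ D] [AddCommGroup S] [Module ℝ S]
  [AddCommGroup E] [Module ℝ E]

/-- It suffices to prescribe values on linearly independent families. Independence is stated after
the injection g, which will be the map to the generic stalk, where the operators are built. -/
theorem evalOn_surjective_of_interpolation {act : D →ₗ[ℝ] Module.End ℝ S} {g : S →ₗ[ℝ] E}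
    (hg : Function.Injective g)
    (h : ∀ (m : ℕ) (v : Fin m → S), LinearIndependent ℝ (fun j => g (v j)) →
      ∀ w : Fin m → S, ∃ P : D, ∀ j, act P (v j) = w j)
    (V : Submodule ℝ S) (hV : FiniteDimensional ℝ V) :
    Function.Surjective (evalOn act ⊤ V) := by
  let b := Module.finBasis ℝ V
  have hb := b.linearIndependent.map' (g ∘ₗ V.subtype)
    (LinearMap.ker_eq_bot.2 (hg.comp Subtype.val_injective))
  intro φ
  obtain ⟨P, hP⟩ := h _ _ hb fun j => (φ (b j)).1
  have h1 : act P ∘ₗ V.subtype = V.subtype ∘ₗ φ := b.ext hP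
  have h2 (u : V) : act P u.1 = (φ u).1 := LinearMap.congr_fun h1 u
  refine ⟨⟨P, trivial, fun u hu => ?_⟩, LinearMap.ext fun u => Subtype.ext (h2 u)⟩
  rw [h2 ⟨u, hu⟩]
  exact (φ _).2

/-- This covers the case of empty X(ℝ), where there are no nonzero sections. -/
theorem evalOn_surjective_of_subsingleton [Subsingleton S] {act : D →ₗ[ℝ] Module.End ℝ S}
    {V : Submodule ℝ S} : Function.Surjective (evalOn act ⊤ V) :=
  fun _ => ⟨0, LinearMap.ext fun _ => Subsingleton.elim _ _⟩

end Abstract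

/-! ### Surjectivity on the real points -/

section RealVariety

variable {X : Scheme.{0}} [X.Over (Spec (.of ℝ))] [IsIntegral X]
  [LocallyOfFiniteType (X ↘ Spec (.of ℝ))] (hreg : IsRegularScheme X)
  {M : X.Modules} (hM : M.IsLocallyFreeOfFiniteRank)

-- A single real point suffices: the germ there determines the generic germ, and hence the section.
include hM in
omit [LocallyOfFiniteType (X ↘ Spec (.of ℝ))] in
theorem toRatSections_injective (h : Nonempty (RatPt ℝ X)) :
    Function.Injective (toRatSections ℝ M) := by
  obtain ⟨x⟩ := h
  rw [injective_iff_map_eq_zero]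
  intro s hs
  have hx : x.1 ∈ (⊤ : X.Opens) := trivial
  have h1 : germ ℝ M hx s = 0 := congrFun (congrArg Subtype.val hs) x
  have h2 := toGeneric_germ ℝ M hx s
  rw [h1, map_zero] at h2
  exact (injective_iff_map_eq_zero _).1 (germ_generic_injective ℝ hM (genericPoint_mem hx)) s h2.symm

include hreg in
/-- The germs of a section of `M` on `X(ℝ)` have a common image in the generic stalk. -/
theorem toGeneric_eq (f : ratSections ℝ M) (x y : RatPt ℝ X) :
    toGeneric ℝ M x.1 (f.1 x) = toGeneric ℝ M y.1 (f.1 y) := by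
  obtain ⟨U, hx, s, hs⟩ := f.2 x
  obtain ⟨U', hy, s', hs'⟩ := f.2 y
  obtain ⟨z, hz⟩ := exists_ratPt_mem hreg x (W := U ⊓ U') ⟨genericPoint_mem hx, genericPoint_mem hy⟩
  have h1 := hs z hz.1
  have h2 := hs' z hz.2
  rw [hs x hx, hs' y hy, toGeneric_germ, toGeneric_germ, ← toGeneric_germ ℝ M hz.1, ← h1, h2,
    toGeneric_germ]

/-- The image of a section of `M` on `X(ℝ)` in the generic stalk. -/
def ratGeneric (M : X.Modules) (x₀ : RatPt ℝ X) : ratSections ℝ M →ₗ[ℝ] genericStalk M :=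
  toGeneric ℝ M x₀.1 ∘ₗ LinearMap.proj x₀ ∘ₗ (ratSections ℝ M).subtype

include hreg in
theorem toGeneric_apply (x₀ : RatPt ℝ X) (f : ratSections ℝ M) (x : RatPt ℝ X) :
    toGeneric ℝ M x.1 (f.1 x) = ratGeneric M x₀ f :=
  toGeneric_eq hreg f x x₀

include hreg hM in
theorem ratGeneric_injective (x₀ : RatPt ℝ X) : Function.Injective (ratGeneric M x₀) := by
  intro f g h
  refine Subtype.ext (funext fun x => toGeneric_injective ℝ hM x.1 ?_)
  rw [toGeneric_apply hreg x₀, toGeneric_apply hreg x₀, h]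

include hreg hM in
/-- An operator `∑ q i (_) • w i`, where the `q i` are integral at the real points and the `w i`
are sections on `X(ℝ)`, defines a differential operator on `X(ℝ)`. -/
theorem exists_ratDiffOp (x₀ : RatPt ℝ X) {m n : ℕ}
    {q : Fin m → genericStalk M →ₗ[ℝ] X.functionField}
    (hq : ∀ i, IsDO X.functionField (n + 1) (q i))
    (hqx : ∀ (x : RatPt ℝ X) i, IsIntegralAt ℝ M (q i) x.1) (w : Fin m → ratSections ℝ M) :
    ∃ P : ratDiffOp ℝ M, ∀ f, ratGeneric M x₀ (ratAction ℝ M P f) =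
      sumSmulRight q (fun i => ratGeneric M x₀ (w i)) (ratGeneric M x₀ f) := by
  set Q := sumSmulRight q (fun i => ratGeneric M x₀ (w i))
  choose P hP using fun x : RatPt ℝ X => exists_stalk_operator (k := ℝ) hM (Q := Q) (y := x.1)
    (sumSmulRight_mem (hqx x) fun i => ⟨_, toGeneric_apply hreg x₀ (w i) x⟩)
  have hPmem : P ∈ ratDiffOp ℝ M := by
    intro x
    -- Integrality of the q_i is an open condition and the w_i are sections near x. So the operator
    -- preserves the stalks at all points of a neighbourhood of x in X, non-real ones included, and
    -- is a differential operator there.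
    obtain ⟨U, hxU, hU⟩ := exists_open_forall (x := x.1)
      (p := fun i y => IsIntegralAt ℝ M (q i) y) fun i => by
        obtain ⟨W, hx, -, hW, r, e, he⟩ := exists_frame hM (x := x.1) (O := ⊤) trivial
        obtain ⟨s, hs, hs'⟩ := exists_isIntegralAt_basicOpen hW he hx (hq i) (hqx x i)
        exact ⟨X.basicOpen s, hs, hs'⟩
    obtain ⟨U', hxU', hU'⟩ := exists_open_forall (x := x.1)
      (p := fun i y => ratGeneric M x₀ (w i) ∈ LinearMap.range (toGeneric ℝ M y)) fun i => by
        obtain ⟨W, hx, s, hs⟩ := (w i).2 x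
        refine ⟨W, hx, fun y hy => ⟨germ ℝ M hy s, ?_⟩⟩
        rw [← toGeneric_apply hreg x₀ (w i) x, hs x hx, toGeneric_germ, toGeneric_germ]
    obtain ⟨R, hR, hRs⟩ := exists_sheafDiffOp ℝ hM (U := U ⊓ U') Q (isDO_sumSmulRight hq _)
      fun y hy => sumSmulRight_mem (fun i => hU i y hy.1) fun i => hU' i y hy.2
    refine ⟨U ⊓ U', ⟨hxU, hxU'⟩, n, R, hR, fun y W hy s => ?_⟩
    apply toGeneric_injective ℝ hM y.1
    rw [hP, toGeneric_germ, toGeneric_germ, hRs]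
  refine ⟨⟨P, hPmem⟩, fun f => ?_⟩
  rw [← toGeneric_apply hreg x₀ _ x₀, ← toGeneric_apply hreg x₀ f x₀]
  exact hP x₀ (f.1 x₀)

include hM in
omit [LocallyOfFiniteType (X ↘ Spec (.of ℝ))] in
/-- Finitely many generic sections generate all stalks of `M`. -/
theorem exists_generators [CompactSpace X] : ∃ G : Finset (genericStalk M), ∀ (x : X) (m),
    toGeneric ℝ M x m ∈ Submodule.span (localRing ℝ x) (G : Set (genericStalk M)) := by
  classical
  choose U hxU _ _ r e he using fun x : X => exists_frame hM (x := x) (O := ⊤) trivial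
  obtain ⟨t, ht⟩ := isCompact_univ.elim_finite_subcover (fun z => (U z : Set X))
    (fun z => (U z).isOpen) fun z _ => Set.mem_iUnion.2 ⟨z, hxU z⟩
  refine ⟨t.biUnion fun z => Finset.univ.image fun i => germ ℝ M (genericPoint_mem (hxU z)) (e z i),
    fun x m => ?_⟩
  obtain ⟨z, hz, hx⟩ := Set.mem_iUnion₂.1 (ht (Set.mem_univ x))
  obtain ⟨c, rfl⟩ := exists_eq_sum_germ ℝ M (he z) hx m
  rw [map_sum]
  refine Submodule.sum_mem _ fun i _ => ?_
  rw [toGeneric_smul, toGeneric_germ]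
  refine Submodule.smul_mem _ (⟨_, c i, rfl⟩ : localRing ℝ x) (Submodule.subset_span ?_)
  simp only [Finset.coe_biUnion, Set.mem_iUnion, Finset.coe_image]
  exact ⟨z, hz, i, Finset.mem_coe.2 (Finset.mem_univ i), rfl⟩

include hreg hM in
/-- There are differential operators with arbitrary values on a linearly independent family. -/
theorem exists_ratAction_eq [CompactSpace X] (hX : IsAffineRatPt ℝ X) (x₀ : RatPt ℝ X) {m : ℕ}
    {v : Fin m → ratSections ℝ M} (hv : LinearIndependent ℝ fun j => ratGeneric M x₀ (v j))
    (w : Fin m → ratSections ℝ M) :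
    ∃ P : ratDiffOp ℝ M, ∀ j, ratAction ℝ M P (v j) = w j := by
  classical
  obtain ⟨G, hG⟩ := exists_generators hM
  obtain ⟨N, ev, Φ, hval, hfrac⟩ := exists_coordinates hreg x₀ hX
  -- The v_j are adjoined to the generators so that duality is tested inside the lattice;
  -- integrality on the enlarged lattice gives integrality on the stalks of M.
  obtain ⟨n, q, hq, hqG, hqv⟩ := exists_dual_operators_real hval hfrac hreg hM
    (G ∪ Finset.univ.image fun j => ratGeneric M x₀ (v j)) (fun j => by simp) hv x₀
  have hqx (x : RatPt ℝ X) (i) : IsIntegralAt ℝ M (q i) x.1 := fun m =>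
    hqG x i _ (Submodule.span_mono (by simp) (hG x.1 m))
  obtain ⟨P, hP⟩ := exists_ratDiffOp hreg hM x₀ hq hqx w
  refine ⟨P, fun j => ratGeneric_injective hreg hM x₀ ?_⟩
  rw [hP, sumSmulRight_apply, Finset.sum_eq_single j]
  · rw [hqv, if_pos rfl, one_smul]
  · intro i _ hij
    rw [hqv, if_neg hij, zero_smul]
  · simp

include hreg hM in
theorem ratAction_evalOn_surjective [CompactSpace X] (hX : IsAffineRatPt ℝ X)
    (V : Submodule ℝ (ratSections ℝ M)) (hV : FiniteDimensional ℝ V) :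
    Function.Surjective (evalOn (ratAction ℝ M) ⊤ V) := by
  rcases isEmpty_or_nonempty (RatPt ℝ X) with h | ⟨⟨x₀⟩⟩
  · have : Subsingleton (ratSections ℝ M) := ⟨fun f g => Subtype.ext (funext fun x => h.elim x)⟩
    exact evalOn_surjective_of_subsingleton (D := ratDiffOp ℝ M) (S := ratSections ℝ M)
      (act := ratAction ℝ M) (V := V)
  · exact evalOn_surjective_of_interpolation (D := ratDiffOp ℝ M) (S := ratSections ℝ M)
      (act := ratAction ℝ M) (ratGeneric_injective hreg hM x₀)
      (fun m v hv w => exists_ratAction_eq hreg hM hX x₀ hv w) V hV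

end RealVariety

theorem real_variety (X : Scheme.{0}) [X.Over (Spec (.of ℝ))] [IsIntegral X]
    [LocallyOfFiniteType (X ↘ Spec (.of ℝ))] [QuasiCompact (X ↘ Spec (.of ℝ))]
    (hreg : IsRegularScheme X) (hX : IsAffineRatPt ℝ X)
    (M : X.Modules) (hM : M.IsLocallyFreeOfFiniteRank) :
    (Nonempty (RatPt ℝ X) → Function.Injective (toRatSections ℝ M)) ∧
    ∀ (V : Submodule ℝ (ratSections ℝ M)) (_ : FiniteDimensional ℝ V),
      IsExactSequence (ratAction ℝ M) ⊤ V := by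
  have : CompactSpace X := QuasiCompact.compactSpace_of_compactSpace (X ↘ Spec (.of ℝ))
  exact ⟨toRatSections_injective hM, fun V hV =>
    isExactSequence_of_surjective (ratAction_evalOn_surjective hreg hM hX V hV)⟩

end TaylorDiff

end

theorem mainTheorem1 :
    (∀ (k : Type u) [Field k] [CharZero k] (X : Scheme.{u}) [X.Over (Spec (.of k))]
      [IsIntegral X] [IsAffine X] [LocallyOfFiniteType (X ↘ Spec (.of k))]
      (_ : IsRegularScheme X) (M : X.Modules) (_ : M.IsLocallyFreeOfFiniteRank)
      (V : Submodule k Γ(M, ⊤)) (_ : FiniteDimensional k V) (_ : IsSeparatedSubspace k M V),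
      nInj k M V ≠ ⊤ ∧
      (∀ n : ℕ, nInj k M V ≤ n →
        IsExactSequence (globalAction k M) (sheafDiffOp k M ⊤ n) V) ∧
      IsExactSequence (globalAction k M) (globalDiffOp k M) V ∧
      (∀ U : Submodule k Γ(M, ⊤), U ≤ V →
        (∀ P ∈ preserving (globalAction k M) (globalDiffOp k M) V,
          ∀ w ∈ U, globalAction k M P w ∈ U) → U = ⊥ ∨ U = V)) ∧
    (∀ (X : Scheme.{0}) [X.Over (Spec (.of ℝ))] [IsIntegral X]
      [LocallyOfFiniteType (X ↘ Spec (.of ℝ))] [QuasiCompact (X ↘ Spec (.of ℝ))]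
      (_ : IsRegularScheme X) (_ : IsAffineRatPt ℝ X)
      (M : X.Modules) (_ : M.IsLocallyFreeOfFiniteRank),
      (Nonempty (RatPt ℝ X) → Function.Injective (toRatSections ℝ M)) ∧
      ∀ (V : Submodule ℝ (ratSections ℝ M)) (_ : FiniteDimensional ℝ V),
        IsExactSequence (ratAction ℝ M) ⊤ V) := by
  refine ⟨fun k _ _ X _ _ _ _ hreg M hM V hV hs => affine_variety k X hreg M hM V hV hs,
    fun X _ _ _ _ hreg hX M hM => real_variety X hreg hX M hM⟩
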